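/- **Corollary (Approximating output probabilities of quantum circuits).** Consider quantum circuits over the universal gate set consisting of the Hadamard gate and the Toffoli gate. A circuit $C$ on $n$ qubits with $m$ gates is given as an explicit list of its gates, together with $n$ in unary. Let $\sigma:\mathbb N\to\mathbb N\cup\{\infty\}$ be any size bound with $\sigma(n)\ge n$ for all $n$ (for example a polynomial, or no restriction, $\sigma\equiv\infty$), and consider only $n$-qubit circuits with $m\le\sigma(n)$ gates. Then approximating the output probability $$p(C)=|\langle 0^n|C|0^n\rangle|^2$$ by a rational number $s$ is $\mathsf{GapP}$-complete in each of the following two settings: (a) up to relative error $\epsilon$, i.e. $(1-\epsilon)\,p(C)\le s\le(1+\epsilon)\,p(C)$, for any fixed real $0<\epsilon<1/2$; (b) up to additive error $2^{-2n}$, i.e. $|p(C)-s|\le 2^{-2n}$. Here $\mathsf{\#P}$ is the class of functions $f:\{0,1\}^*\to\mathbb N$ of the form $f(x)=|\{y\in\{0,1\}^{q(|x|)}: V(x,y)=1\}|$ with $V$ computable in polynomial time and $q$ a polynomial, and $\mathsf{GapP}$ is the class of differences $g-h$ of two functions $g,h\in\mathsf{\#P}$. That one of the two approximation problems is *$\mathsf{GapP}$-complete*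 means: * (membership) there are $g\in\mathsf{GapP}$ and $t:\{0,1\}^*\to\mathbb N$, with $x\mapsto 1^{t(x)}$ computable in polynomial time, such that $s=g(C)/2^{t(C)}$ is an admissible approximation of $p(C)$ for every circuit $C$ considered; * (hardness, under polynomial-time Turing reductions) for every $g\in\mathsf{GapP}$ and every polynomial $b$ there is a polynomial-time oracle machine that computes $g$ when given any oracle that answers each query encoding one of the circuits considered with an admissible rational approximation of its output probability, and whose answers, written in binary, have length at most $b$ of the length of the query. A query costs one time step; queries that do not encode such a circuit may be answered by any rational number. -/

import Mathlib

namespace QGap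

/-! ### Deterministic oracle machines with a step count

A machine has finitely many instructions and works on stacks of bits (the head of a list is the top
of the stack); it is a multi-tape Turing machine whose tapes are accessed as stacks. Stack `0` holds
the input and, at the end, the output; stack `1` holds the second input, if there is one. Stack `2` is
the query tape and stack `3` the answer tape of the oracle. -/

/-- Instructions. `push r b` pushes the bit `b` on stack `r`. `pop r e z o` jumps to `e` if stack `r`
is empty; otherwise it removes the top bit and jumps to `z` if this bit is `false`, to `o` if it is
`true`. `ask` calls the oracle. -/
inductive Instr : Type
  | push (r : ℕ) (b : Bool)
  | pop (r e z o : ℕ)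
  | ask

/-- A program; the machine halts when the program counter leaves the program. -/
abbrev Machine : Type := List Instr

/-- A configuration: the program counter and the contents of the stacks. -/
structure Config : Type where
  pc : ℕ
  stk : ℕ → List Bool

/-- One instruction, with oracle `O`. A call of the oracle is a single step: it writes the answer to
the query on stack `2` on stack `3` (replacing what was there) and empties stack `2`. -/
def Instr.exec (O : List Bool → List Bool) (c : Config) : Instr → Config
  | .push r b => ⟨c.pc + 1, Function.update c.stk r (b :: c.stk r)⟩
  | .pop r e z o =>
    match c.stk r with
    | [] => ⟨e, c.stk⟩
    | false :: l => ⟨z, Function.update c.stk r l⟩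
    | true :: l => ⟨o, Function.update c.stk r l⟩
  | .ask => ⟨c.pc + 1, Function.update (Function.update c.stk 3 (O (c.stk 2))) 2 []⟩

/-- One step of the machine `M` with oracle `O`; a machine that has halted does not move. -/
def step (O : List Bool → List Bool) (M : Machine) (c : Config) : Config :=
  match M[c.pc]? with
  | some i => i.exec O c
  | none => c

/-- The initial configuration with the inputs `xs` on the stacks `0`, `1`, … -/
def start (xs : List (List Bool)) : Config := ⟨0, fun r => xs.getD r []⟩

/-- On inputs `xs` and with oracle `O`, the machine `M` halts after at most `t` steps with output `w`. -/
def OutputsWithin (O : List Bool → List Bool) (M : Machine) (xs : List (List Bool)) (t : ℕ)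
    (w : List Bool) : Prop :=
  M.length ≤ ((step O M)^[t] (start xs)).pc ∧ ((step O M)^[t] (start xs)).stk 0 = w

/-- The trivial oracle, for machines without oracle. -/
def noOracle : List Bool → List Bool := fun _ => []

/-! ### Polynomial time, `#P` and `GapP` -/

/-- `f` is computable in polynomial time. -/
def IsFP (f : List Bool → List Bool) : Prop :=
  ∃ (M : Machine) (p : Polynomial ℕ), ∀ x, OutputsWithin noOracle M [x] (p.eval x.length) (f x)

/-- The two-place predicate `V` is decidable in polynomial time. -/
def IsPolyTimePred (V : List Bool → List Bool → Bool) : Prop :=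
  ∃ (M : Machine) (p : Polynomial ℕ), ∀ x y,
    OutputsWithin noOracle M [x, y] (p.eval (x.length + y.length)) [V x y]

/-- The class `#P`. -/
def IsSharpP (f : List Bool → ℕ) : Prop :=
  ∃ (V : List Bool → List Bool → Bool) (p : Polynomial ℕ), IsPolyTimePred V ∧
    ∀ x, f x = (Finset.univ.filter
      fun y : Fin (p.eval x.length) → Bool => V x (List.ofFn y) = true).card

/-- The class `GapP`: differences of two `#P` functions. -/
def IsGapP (f : List Bool → ℤ) : Prop :=
  ∃ g h : List Bool → ℕ, IsSharpP g ∧ IsSharpP h ∧ ∀ x, f x = (g x : ℤ) - (h x : ℤ)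

/-! ### Estimation problems and `GapP`-completeness -/

/-- Binary encoding of integers: the sign, then the bits of the absolute value, least significant
bit first. -/
def encodeInt (z : ℤ) : List Bool := decide (z < 0) :: z.natAbs.bits

/-- Encoding of rational numbers: numerator and denominator in lowest terms. Every bit of the
numerator is preceded by `true`, and `false` marks where the denominator starts. -/
def encodeRat (q : ℚ) : List Bool :=
  ((encodeInt q.num).flatMap fun b => [true, b]) ++ false :: q.den.bits

/-- An estimation problem: for every input the set of its admissible answers. -/
abbrev EstimationProblem : Type := List Bool → Set ℚ

/-- The oracle `A` solves the problem `P`, with answers of length at most `b` (as a function of the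
length of the query). -/
def Solves (P : EstimationProblem) (b : Polynomial ℕ) (A : List Bool → List Bool) : Prop :=
  ∀ x, (A x).length ≤ b.eval x.length ∧ ∃ q ∈ P x, A x = encodeRat q

/-- `P` is solved by a `GapP` function, up to normalization by an efficiently computable power of two. -/
def InGapP (P : EstimationProblem) : Prop :=
  ∃ (g : List Bool → ℤ) (t : List Bool → ℕ), IsGapP g ∧
    IsFP (fun x => List.replicate (t x) true) ∧ ∀ x, (g x : ℚ) / 2 ^ t x ∈ P x

/-- `P` is `GapP`-hard under polynomial-time Turing (Cook) reductions: every `GapP` function is computed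
in polynomial time by a machine that may call an oracle for `P`. The machine and its running time are
the same for all oracles that solve `P` with answers of a given polynomially bounded length. -/
def GapPHard (P : EstimationProblem) : Prop :=
  ∀ g : List Bool → ℤ, IsGapP g → ∀ b : Polynomial ℕ,
    ∃ (M : Machine) (p : Polynomial ℕ), ∀ A : List Bool → List Bool, Solves P b A →
      ∀ x, OutputsWithin A M [x] (p.eval x.length) (encodeInt (g x))

/-- `P` is `GapP`-complete. -/
def GapPComplete (P : EstimationProblem) : Prop := InGapP P ∧ GapPHard P

/-! ### Quantum circuits -/

/-- Gates on `n` qubits: a Hadamard gate on qubit `i`, or a Toffoli gate with controls `a`, `b` and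
target `c`. -/
inductive Gate (n : ℕ) : Type
  | had (i : Fin n)
  | tof (a b c : Fin n) (hab : a ≠ b) (hac : a ≠ c) (hbc : b ≠ c)

/-- The matrix of a gate on `(ℂ²)^{⊗ n}`, in the standard basis. -/
noncomputable def Gate.matrix {n : ℕ} : Gate n → Matrix (Fin n → Bool) (Fin n → Bool) ℂ
  | .had i => Matrix.of fun x y =>
      if ∀ j, j ≠ i → x j = y j then
        (if x i && y i then -1 else 1) / ((Real.sqrt 2 : ℝ) : ℂ)
      else 0
  | .tof a b c _ _ _ => Matrix.of fun x y =>
      if x = Function.update y c (xor (y c) (y a && y b)) then 1 else 0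

/-- A quantum circuit on `n` qubits: its gates, in the order in which they are applied. -/
abbrev Circuit (n : ℕ) : Type := List (Gate n)

/-- The unitary matrix of a circuit. -/
noncomputable def Circuit.matrix {n : ℕ} : Circuit n → Matrix (Fin n → Bool) (Fin n → Bool) ℂ
  | [] => 1
  | g :: C => Circuit.matrix C * g.matrix

/-- The output probability `|⟨0ⁿ|C|0ⁿ⟩|²`. -/
noncomputable def Circuit.zeroProb {n : ℕ} (C : Circuit n) : ℝ :=
  ‖Circuit.matrix C (fun _ => false) (fun _ => false)‖ ^ 2

/-- Unary code of a natural number. -/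
def encodeUnary (k : ℕ) : List Bool := List.replicate k true ++ [false]

/-- Code of a gate. -/
def Gate.encode {n : ℕ} : Gate n → List Bool
  | .had i => false :: encodeUnary i
  | .tof a b c _ _ _ => true :: (encodeUnary a ++ encodeUnary b ++ encodeUnary c)

/-- Code of a circuit: the number of qubits in unary, then the list of gates. -/
def Circuit.encode {n : ℕ} (C : Circuit n) : List Bool :=
  encodeUnary n ++ C.flatMap Gate.encode

/-! ### The two approximation problems -/

/-- `s` is an `r`-relative approximation of `S`. -/
def IsRelApprox (r S s : ℝ) : Prop := (1 - r) * S ≤ s ∧ s ≤ (1 + r) * S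

/-- `s` is an `ε`-additive approximation of `S`. -/
def IsAddApprox (ε S s : ℝ) : Prop := |S - s| ≤ ε

/-- Given an `n`-qubit circuit `C` with at most `σ n` gates, approximate `|⟨0ⁿ|C|0ⁿ⟩|²` up to relative
error `ε`. Inputs that do not encode such a circuit may be answered arbitrarily. -/
def RelProblem (σ : ℕ → ℕ∞) (ε : ℝ) : EstimationProblem := fun x =>
  {q | ∀ (n : ℕ) (C : Circuit n), (C.length : ℕ∞) ≤ σ n → x = Circuit.encode C →
    IsRelApprox ε C.zeroProb (q : ℝ)}

/-- Given an `n`-qubit circuit `C` with at most `σ n` gates, approximate `|⟨0ⁿ|C|0ⁿ⟩|²` up to additive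
error `2^{-2n}`. Inputs that do not encode such a circuit may be answered arbitrarily. -/
def AddProblem (σ : ℕ → ℕ∞) : EstimationProblem := fun x =>
  {q | ∀ (n : ℕ) (C : Circuit n), (C.length : ℕ∞) ≤ σ n → x = Circuit.encode C →
    IsAddApprox (1 / 2 ^ (2 * n)) C.zeroProb (q : ℝ)}

end QGap

/-! Membership. With Hadamard and Toffoli gates the amplitude of the zero state is an integer
divided by the square root of 2^h, where h is the number of Hadamard gates: the integer adds the
signs of the computational paths that lead from zero to zero (`Circuit.zeroProb_eq_amp`). Its square
adds the signs of pairs of paths (`Circuit.sum_weight`). The pairs of sign + and the pairs of sign −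
are counted by two #P functions, so the output probability itself is a GapP function divided by 2^h,
and the exact value is admissible for every notion of error (`inGapP_of_exact`).

Hardness. Let f be the number of accepted certificates of length q of a verifier. A layer of
Hadamard gates, doubly controlled phase flips and a second layer produce the amplitude 2^{-N} ∑_z
(-1)^{P(z)}, where P is any sum of cubic monomials in three distinct variables
(`exists_cubic_circuit`). For a number c with k binary digits, P is chosen such that the sum is a
known power of two times Y = 2^{q+1} c - 2^k f (`cubicSum_allMonos_eq`). Three devices make this
possible.

Checks. The run of the verifier is written as a tableau in which every bit that is not a certificate
bit satisfies a quadratic equation over the field with two elements, involving nearby bits only. An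
equation Q = 0 gets a variable w of its own and the cubic terms of wQ. As ∑_w (-1)^{wQ} is 2 if Q =
0 and 0 otherwise, only tableaux of genuine runs survive (`sum_checks`, `gridChecks_iff`), and these
correspond to the certificates (`sum_tableau`).

Constants. Terms of lower degree are padded by two variables that stand for the constant one. A
cubic form in six more variables, whose exponential sum vanishes, is coupled to them and kills every
summand in which they are not both one (`sum_gadget`).

Comparison. Further checks compute whether a k-bit number v is less than c, and a final phase with
two more variables weighs this against the accepting bit a, so that the sum over v is 4c - 2^{k+1} a
(`sum_finalBit`).

The output probability p of this circuit satisfies p 2^N = 4 Y². The circuit is given as many qubits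
as the code of its gates has bits. Hence it has at most n gates on its n qubits, so that the size
bound never excludes it, and the additive error 4^{-n} is tiny compared with 2^{-N}. Under either
notion of error an answer therefore bounds Y² within a constant factor (`EstimationProblem.Good`),
which suffices to certify Y ≥ 2^{q+1} or Y < 3·2^{q+1}, merely from the bit lengths of numerator and
denominator (`isLarge_spec`).

This drives a digit by digit search for f. The invariant is 0 ≤ Y < 3·2^{q+1}. A new last digit of c
doubles Y; three queries, each followed by a decrement of c if the answer is large, restore the
bound. After q + 2 digits, 4f ≤ c < 4f + 3, so f is c without its last two digits (`search_spec`). A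
GapP function takes two searches and a subtraction.

Everything is carried out by explicit programs for the stack machine, each with a polynomial bound
on its running time. -/

namespace QGap

/-! ### Structured programs over stacks -/

/-- Structured programs. `cs r E Z O` pops stack `r` and branches; `wh r c₀ P₀ c₁ P₁` pops stack `r`
repeatedly, runs `P₀` or `P₁` according to the bit, and goes on after the bit `b` if `c_b` holds; it
ends when the stack is empty. -/
inductive Prog : Type
  | skip
  | push (r : ℕ) (b : Bool)
  | ask
  | seq (P Q : Prog)
  | cs (r : ℕ) (E Z O : Prog)
  | wh (r : ℕ) (c₀ : Bool) (P₀ : Prog) (c₁ : Bool) (P₁ : Prog)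

namespace Prog

/-- The number of instructions of the compiled program. -/
def len : Prog → ℕ
  | skip => 0
  | push _ _ => 1
  | ask => 1
  | seq P Q => P.len + Q.len
  | cs _ E Z O => 1 + (E.len + 2) + (Z.len + 2) + O.len
  | wh _ _ P₀ _ P₁ => 1 + (P₀.len + 2) + (P₁.len + 2)

/-- An unconditional jump. -/
def jump (t : ℕ) : List Instr := [.push 0 true, .pop 0 t t t]

/-- The instructions of a program placed at the address `off`. -/
def compile : Prog → ℕ → List Instr
  | skip, _ => []
  | push r b, _ => [.push r b]
  | ask, _ => [.ask]
  | seq P Q, off => P.compile off ++ Q.compile (off + P.len)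
  | cs r E Z O, off =>
    [.pop r (off + 1) (off + 1 + (E.len + 2)) (off + 1 + (E.len + 2) + (Z.len + 2))] ++
    (E.compile (off + 1) ++ jump (off + 1 + (E.len + 2) + (Z.len + 2) + O.len)) ++
    (Z.compile (off + 1 + (E.len + 2)) ++ jump (off + 1 + (E.len + 2) + (Z.len + 2) + O.len)) ++
    O.compile (off + 1 + (E.len + 2) + (Z.len + 2))
  | wh r c₀ P₀ c₁ P₁, off =>
    [.pop r (off + 1 + (P₀.len + 2) + (P₁.len + 2)) (off + 1) (off + 1 + (P₀.len + 2))] ++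
    (P₀.compile (off + 1) ++
      jump (if c₀ then off else off + 1 + (P₀.len + 2) + (P₁.len + 2))) ++
    (P₁.compile (off + 1 + (P₀.len + 2)) ++
      jump (if c₁ then off else off + 1 + (P₀.len + 2) + (P₁.len + 2)))

@[simp] theorem length_jump (t : ℕ) : (jump t).length = 2 := rfl

@[simp] theorem length_compile (P : Prog) (off : ℕ) : (P.compile off).length = P.len := by
  induction P generalizing off <;> simp_all [compile, len] <;> omega

end Prog

/-- The list `l` occurs in `M` at the address `off`. -/
def CodeAt (M : Machine) (off : ℕ) (l : List Instr) : Prop :=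
  ∃ pre post, M = pre ++ l ++ post ∧ pre.length = off

theorem CodeAt.left {M : Machine} {off : ℕ} {l₁ l₂ : List Instr} (h : CodeAt M off (l₁ ++ l₂)) :
    CodeAt M off l₁ := by
  obtain ⟨pre, post, rfl, h⟩ := h
  exact ⟨pre, l₂ ++ post, by simp, h⟩

theorem CodeAt.right {M : Machine} {off : ℕ} {l₁ l₂ : List Instr} (h : CodeAt M off (l₁ ++ l₂))
    {off' : ℕ} (ho : off' = off + l₁.length) : CodeAt M off' l₂ := by
  obtain ⟨pre, post, rfl, h⟩ := h
  exact ⟨pre ++ l₁, post, by simp, by simp [h, ho]⟩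

theorem CodeAt.get {M : Machine} {off : ℕ} {i : Instr} {l : List Instr}
    (h : CodeAt M off (i :: l)) : M[off]? = some i := by
  obtain ⟨pre, post, rfl, rfl⟩ := h
  simp

theorem CodeAt.step {M : Machine} {off : ℕ} {i : Instr} {l : List Instr}
    (h : CodeAt M off (i :: l)) (O : List Bool → List Bool) (S : ℕ → List Bool) :
    step O M ⟨off, S⟩ = i.exec O ⟨off, S⟩ := by
  simp [QGap.step, h.get]

/-- The machine goes from `c` to `c'` in at most `k` steps. -/
def Reach (O : List Bool → List Bool) (M : Machine) (c : Config) (k : ℕ) (c' : Config) : Prop :=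
  ∃ t ≤ k, (step O M)^[t] c = c'

theorem Reach.refl {O : List Bool → List Bool} {M : Machine} (c : Config) : Reach O M c 0 c :=
  ⟨0, le_rfl, rfl⟩

theorem Reach.one {O : List Bool → List Bool} {M : Machine} {c c' : Config}
    (h : step O M c = c') : Reach O M c 1 c' := ⟨1, le_rfl, by simpa using h⟩

theorem Reach.trans {O : List Bool → List Bool} {M : Machine} {c c' c'' : Config} {k l : ℕ}
    (h : Reach O M c k c') (h' : Reach O M c' l c'') : Reach O M c (k + l) c'' := by
  obtain ⟨t, ht, rfl⟩ := h
  obtain ⟨t', ht', rfl⟩ := h'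
  exact ⟨t' + t, by omega, by rw [Function.iterate_add_apply]⟩

theorem Reach.mono {O : List Bool → List Bool} {M : Machine} {c c' : Config} {k l : ℕ}
    (h : Reach O M c k c') (hl : k ≤ l) : Reach O M c l c' := by
  obtain ⟨t, ht, h⟩ := h
  exact ⟨t, ht.trans hl, h⟩

/-- A bit is pushed only to be popped at once, with the same target in all three cases; so the jump
costs two steps and leaves the stacks unchanged. -/
theorem Reach.jump {O : List Bool → List Bool} {M : Machine} {off t : ℕ}
    (h : CodeAt M off (Prog.jump t)) (S : ℕ → List Bool) : Reach O M ⟨off, S⟩ 2 ⟨t, S⟩ := by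
  refine (Reach.one (h.step O S)).trans (l := 1) (Reach.one ?_)
  have h2 : CodeAt M (off + 1) [.pop 0 t t t] :=
    CodeAt.right (l₁ := [.push 0 true]) h rfl
  simp [Instr.exec, h2.step]

/-- The program `P` with oracle `O` takes the stacks `S` to `S'` in at most `k` steps. -/
def Runs (O : List Bool → List Bool) (P : Prog) (S : ℕ → List Bool) (k : ℕ)
    (S' : ℕ → List Bool) : Prop :=
  ∀ (M : Machine) (off : ℕ), CodeAt M off (P.compile off) →
    Reach O M ⟨off, S⟩ k ⟨off + P.len, S'⟩

/-! ### Correctness and running time of compiled programs -/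

namespace Runs

variable {O : List Bool → List Bool} {S S' S'' : ℕ → List Bool} {P Q E Z P₀ P₁ : Prog} {k l r : ℕ}

theorem mono (h : Runs O P S k S') (hl : k ≤ l) : Runs O P S l S' :=
  fun M off hM => (h M off hM).mono hl

theorem congr (h : Runs O P S k S') (hl : k ≤ l) (hS : S' = S'') : Runs O P S l S'' :=
  hS ▸ h.mono hl

theorem skip : Runs O .skip S 0 S := fun _ _ _ => Reach.refl _

theorem push (r : ℕ) (b : Bool) : Runs O (.push r b) S 1 (Function.update S r (b :: S r)) :=
  fun _ _ hM => Reach.one (hM.step O S)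

theorem ask : Runs O .ask S 1 (Function.update (Function.update S 3 (O (S 2))) 2 []) :=
  fun _ _ hM => Reach.one (hM.step O S)

theorem seq (h : Runs O P S k S') (h' : Runs O Q S' l S'') : Runs O (.seq P Q) S (k + l) S'' := by
  intro M off hM
  have h1 := h M off hM.left
  have h2 := h' M (off + P.len) (hM.right (by simp))
  simpa [Prog.len, Nat.add_assoc] using h1.trans h2

theorem cs_nil (hr : S r = []) (h : Runs O E S k S') : Runs O (.cs r E Z Q) S (k + 3) S' := by
  intro M off hM
  have hE := hM.left.left.right (off' := off + 1) rfl
  have h1 : Reach O M ⟨off, S⟩ 1 ⟨off + 1, S⟩ := Reach.one (by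
    rw [hM.left.left.left.step]; simp [Instr.exec, hr])
  have h2 := h M (off + 1) hE.left
  have h3 := Reach.jump (O := O) (hE.right (off' := off + 1 + E.len) (by simp)) S'
  have h4 := (h1.trans (h2.trans h3)).mono (l := k + 3) (by omega)
  convert h4 using 2
  simp only [Prog.len]; omega

theorem cs_false {t : List Bool} (hr : S r = false :: t)
    (h : Runs O Z (Function.update S r t) k S') : Runs O (.cs r E Z Q) S (k + 3) S' := by
  intro M off hM
  have hE := hM.left.right (off' := off + 1 + (E.len + 2)) (by simp; omega)
  have h1 : Reach O M ⟨off, S⟩ 1 ⟨off + 1 + (E.len + 2), Function.update S r t⟩ := Reach.one (by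
    rw [hM.left.left.left.step]; simp [Instr.exec, hr])
  have h2 := h M _ hE.left
  have h3 := Reach.jump (O := O) (hE.right (off' := off + 1 + (E.len + 2) + Z.len) (by simp)) S'
  have h4 := (h1.trans (h2.trans h3)).mono (l := k + 3) (by omega)
  convert h4 using 2
  simp only [Prog.len]; omega

theorem cs_true {t : List Bool} (hr : S r = true :: t)
    (h : Runs O Q (Function.update S r t) k S') : Runs O (.cs r E Z Q) S (k + 3) S' := by
  intro M off hM
  have hE := hM.right (off' := off + 1 + (E.len + 2) + (Z.len + 2)) (by simp; omega)
  have h1 : Reach O M ⟨off, S⟩ 1 ⟨off + 1 + (E.len + 2) + (Z.len + 2), Function.update S r t⟩ :=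
    Reach.one (by rw [hM.left.left.left.step]; simp [Instr.exec, hr])
  have h2 := h M _ hE
  have h4 := (h1.trans h2).mono (l := k + 3) (by omega)
  convert h4 using 2
  simp only [Prog.len]; omega

theorem wh_nil {c₀ c₁ : Bool} (hr : S r = []) : Runs O (.wh r c₀ P₀ c₁ P₁) S 1 S := by
  intro M off hM
  refine Reach.one ?_
  rw [hM.left.left.step]
  simp only [Instr.exec, hr, Prog.len, Config.mk.injEq, and_true]; omega

theorem wh_false_stop {c₁ : Bool} {t : List Bool} (hr : S r = false :: t)
    (h : Runs O P₀ (Function.update S r t) k S') : Runs O (.wh r false P₀ c₁ P₁) S (k + 3) S' := by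
  intro M off hM
  have hE := hM.left.right (off' := off + 1) rfl
  have h1 : Reach O M ⟨off, S⟩ 1 ⟨off + 1, Function.update S r t⟩ := Reach.one (by
    rw [hM.left.left.step]; simp [Instr.exec, hr])
  have h2 := h M (off + 1) hE.left
  have h3 := Reach.jump (O := O) (hE.right (off' := off + 1 + P₀.len) (by simp)) S'
  have h4 := (h1.trans (h2.trans h3)).mono (l := k + 3) (by omega)
  convert h4 using 2
  simp [Prog.len]; omega

theorem wh_true_stop {c₀ : Bool} {t : List Bool} (hr : S r = true :: t)
    (h : Runs O P₁ (Function.update S r t) k S') : Runs O (.wh r c₀ P₀ false P₁) S (k + 3) S' := by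
  intro M off hM
  have hE := hM.right (off' := off + 1 + (P₀.len + 2)) (by simp; omega)
  have h1 : Reach O M ⟨off, S⟩ 1 ⟨off + 1 + (P₀.len + 2), Function.update S r t⟩ := Reach.one (by
    rw [hM.left.left.step]; simp [Instr.exec, hr])
  have h2 := h M _ hE.left
  have h3 := Reach.jump (O := O) (hE.right (off' := off + 1 + (P₀.len + 2) + P₁.len) (by simp)) S'
  have h4 := (h1.trans (h2.trans h3)).mono (l := k + 3) (by omega)
  convert h4 using 2
  simp [Prog.len]; omega

theorem wh_false {c₁ : Bool} {t : List Bool} (hr : S r = false :: t)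
    (h : Runs O P₀ (Function.update S r t) k S') (h' : Runs O (.wh r true P₀ c₁ P₁) S' l S'') :
    Runs O (.wh r true P₀ c₁ P₁) S (k + 3 + l) S'' := by
  intro M off hM
  have hE := hM.left.right (off' := off + 1) rfl
  have h1 : Reach O M ⟨off, S⟩ 1 ⟨off + 1, Function.update S r t⟩ := Reach.one (by
    rw [hM.left.left.step]; simp [Instr.exec, hr])
  have h2 := h M (off + 1) hE.left
  have h3 := Reach.jump (O := O) (hE.right (off' := off + 1 + P₀.len) (by simp)) S'
  exact (h1.trans (h2.trans (h3.trans (h' M off hM)))).mono (by omega)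

theorem wh_true {c₀ : Bool} {t : List Bool} (hr : S r = true :: t)
    (h : Runs O P₁ (Function.update S r t) k S') (h' : Runs O (.wh r c₀ P₀ true P₁) S' l S'') :
    Runs O (.wh r c₀ P₀ true P₁) S (k + 3 + l) S'' := by
  intro M off hM
  have hE := hM.right (off' := off + 1 + (P₀.len + 2)) (by simp; omega)
  have h1 : Reach O M ⟨off, S⟩ 1 ⟨off + 1 + (P₀.len + 2), Function.update S r t⟩ := Reach.one (by
    rw [hM.left.left.step]; simp [Instr.exec, hr])
  have h2 := h M _ hE.left
  have h3 := Reach.jump (O := O) (hE.right (off' := off + 1 + (P₀.len + 2) + P₁.len) (by simp)) S'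
  exact (h1.trans (h2.trans (h3.trans (h' M off hM)))).mono (by omega)

/-- A structured program is a machine. -/
theorem outputsWithin {xs : List (List Bool)} (h : Runs O P (fun r => xs.getD r []) k S')
    (hl : k ≤ l) : OutputsWithin O (P.compile 0) xs l (S' 0) := by
  obtain ⟨t, ht, h⟩ := h (P.compile 0) 0 ⟨[], [], by simp, rfl⟩
  -- The program counter has left the code, so the configuration is a fixed point; this is why a
  -- time bound larger than the actual number of steps does no harm.
  have hfix : ∀ m, (step O (P.compile 0))^[m] ⟨0 + P.len, S'⟩ = ⟨0 + P.len, S'⟩ := by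
    intro m
    refine Function.iterate_fixed ?_ m
    simp [step]
  obtain ⟨m, rfl⟩ : ∃ m, l = m + t := ⟨l - t, by omega⟩
  have : (step O (P.compile 0))^[m + t] (start xs) = ⟨0 + P.len, S'⟩ := by
    rw [Function.iterate_add_apply, start, h, hfix]
  simp [OutputsWithin, this]

end Runs

/-! ### Amplitudes of circuits -/

/-- The sign `(-1)^b`. -/
def sgn (b : Bool) : ℤ := if b then -1 else 1

@[simp] theorem sgn_true : sgn true = -1 := rfl

@[simp] theorem sgn_false : sgn false = 1 := rfl

open Matrix

theorem Gate.had_apply {n : ℕ} (i : Fin n) (x y : Fin n → Bool) :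
    (Gate.had i).matrix x y =
      if ∀ j, j ≠ i → x j = y j then (sgn (x i && y i) : ℂ) / ((Real.sqrt 2 : ℝ) : ℂ) else 0 := by
  simp only [Gate.matrix, Matrix.of_apply]
  congr 2
  cases x i && y i <;> simp

theorem eq_update_of_forall_ne {n : ℕ} {i : Fin n} {x y : Fin n → Bool}
    (h : ∀ j, j ≠ i → x j = y j) : x = Function.update y i (x i) := by
  funext j
  by_cases hj : j = i
  · subst hj; simp
  · simp [hj, h j hj]

/-- A row of the matrix of a Hadamard gate has only two nonzero entries, one for each value of the
qubit it acts on. -/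
theorem sum_eq_update {n : ℕ} (i : Fin n) (x : Fin n → Bool) (f : (Fin n → Bool) → ℂ)
    (hf : ∀ y, (¬ ∀ j, j ≠ i → x j = y j) → f y = 0) :
    ∑ y, f y = f (Function.update x i false) + f (Function.update x i true) := by
  have hne : Function.update x i false ≠ Function.update x i true := fun h => by
    simpa using congrFun h i
  rw [← Finset.sum_pair hne]
  symm
  refine Finset.sum_subset (Finset.subset_univ _) fun y _ hy => hf y fun h => hy ?_
  have := eq_update_of_forall_ne (x := y) (y := x) (i := i) fun j hj => (h j hj).symm
  rw [this]
  cases y i <;> simp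

theorem had_mulVec {n : ℕ} (i : Fin n) (v : (Fin n → Bool) → ℂ) (x : Fin n → Bool) :
    ((Gate.had i).matrix *ᵥ v) x =
      (v (Function.update x i false) + sgn (x i) * v (Function.update x i true)) /
        ((Real.sqrt 2 : ℝ) : ℂ) := by
  simp only [mulVec, dotProduct, Gate.had_apply]
  rw [sum_eq_update i x _ (fun y hy => by rw [if_neg hy, zero_mul]),
    if_pos (fun j hj => by simp [hj]), if_pos (fun j hj => by simp [hj])]
  simp
  ring

theorem had_vecMul {n : ℕ} (i : Fin n) (v : (Fin n → Bool) → ℂ) (x : Fin n → Bool) :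
    (v ᵥ* (Gate.had i).matrix) x =
      (v (Function.update x i false) + sgn (x i) * v (Function.update x i true)) /
        ((Real.sqrt 2 : ℝ) : ℂ) := by
  simp only [vecMul, dotProduct, Gate.had_apply]
  rw [sum_eq_update i x _ (fun y hy => by
      rw [if_neg (fun h => hy fun j hj => (h j hj).symm), mul_zero]),
    if_pos (fun j hj => by simp [hj]), if_pos (fun j hj => by simp [hj])]
  simp
  ring

/-- The action of a Toffoli gate on basis states. -/
def tofMap {n : ℕ} (a b c : Fin n) (y : Fin n → Bool) : Fin n → Bool :=
  Function.update y c (xor (y c) (y a && y b))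

theorem tofMap_tofMap {n : ℕ} {a b c : Fin n} (hac : a ≠ c) (hbc : b ≠ c) (y : Fin n → Bool) :
    tofMap a b c (tofMap a b c y) = y := by
  funext j
  by_cases hj : j = c
  · subst hj; simp [tofMap, hac, hbc]
  · simp [tofMap, hj]

theorem tof_vecMul {n : ℕ} {a b c : Fin n} (hab : a ≠ b) (hac : a ≠ c) (hbc : b ≠ c)
    (v : (Fin n → Bool) → ℂ) (x : Fin n → Bool) :
    (v ᵥ* (Gate.tof a b c hab hac hbc).matrix) x = v (tofMap a b c x) := by
  simp [vecMul, dotProduct, Gate.matrix, tofMap]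

theorem tof_mulVec {n : ℕ} {a b c : Fin n} (hab : a ≠ b) (hac : a ≠ c) (hbc : b ≠ c)
    (v : (Fin n → Bool) → ℂ) (x : Fin n → Bool) :
    ((Gate.tof a b c hab hac hbc).matrix *ᵥ v) x = v (tofMap a b c x) := by
  simp only [mulVec, dotProduct, Gate.matrix, Matrix.of_apply]
  rw [Finset.sum_eq_single (tofMap a b c x)]
  · rw [if_pos (by exact (tofMap_tofMap hac hbc x).symm), one_mul]
  · intro y _ hy
    rw [if_neg, zero_mul]
    rintro rfl
    exact hy (tofMap_tofMap hac hbc y).symm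
  · simp

theorem Circuit.matrix_append {n : ℕ} (C D : Circuit n) :
    Circuit.matrix (C ++ D) = Circuit.matrix D * Circuit.matrix C := by
  induction C with
  | nil => simp [Circuit.matrix]
  | cons g C ih =>
    rw [List.cons_append, Circuit.matrix, ih, Circuit.matrix, Matrix.mul_assoc]

theorem sqrt_two_mul_self : ((Real.sqrt 2 : ℝ) : ℂ) * ((Real.sqrt 2 : ℝ) : ℂ) = 2 := by
  rw [← Complex.ofReal_mul, Real.mul_self_sqrt (by norm_num)]; simp

theorem sqrt_two_ne_zero : ((Real.sqrt 2 : ℝ) : ℂ) ≠ 0 := by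
  simp

theorem sqrt_two_pow_sq (k : ℕ) : ((Real.sqrt 2 : ℝ) : ℂ) ^ k * ((Real.sqrt 2 : ℝ) : ℂ) ^ k = 2 ^ k := by
  rw [← mul_pow, sqrt_two_mul_self]

/-- A Toffoli gate between Hadamard gates on its target is a doubly controlled phase flip. -/
theorem ccz_matrix {n : ℕ} {a b c : Fin n} (hab : a ≠ b) (hac : a ≠ c) (hbc : b ≠ c) :
    Circuit.matrix [.had c, .tof a b c hab hac hbc, .had c] =
      diagonal fun z => (sgn (z a && z b && z c) : ℂ) := by
  -- The reason is HXH = Z on the target if both controls are set and HH = 1 otherwise; on an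
  -- arbitrary vector this becomes a case distinction over the three bits.
  refine Matrix.ext_iff_mulVec.2 fun v => ?_
  funext x
  simp only [Circuit.matrix, Matrix.one_mul, ← Matrix.mulVec_mulVec, mulVec_diagonal]
  rw [had_mulVec, tof_mulVec, tof_mulVec, had_mulVec, had_mulVec]
  have h2 := sqrt_two_mul_self
  have h0 := sqrt_two_ne_zero
  have hx : Function.update x c (x c) = x := Function.update_eq_self c x
  set s := ((Real.sqrt 2 : ℝ) : ℂ)
  simp only [tofMap, Function.update_idem, Function.update_self, Function.update_of_ne hac,
    Function.update_of_ne hbc]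
  rw [← hx]
  simp only [Function.update_idem, Function.update_self, Function.update_of_ne hac,
    Function.update_of_ne hbc]
  rw [div_add' _ _ _ h0, div_div, h2]
  cases x a <;> cases x b <;> cases x c <;> simp <;> field_simp <;> ring

/-- The uniform superposition over the basis states that vanish outside `l` (not normalized). -/
def plusState {n : ℕ} (l : List (Fin n)) (z : Fin n → Bool) : ℂ :=
  if ∀ i, i ∉ l → z i = false then 1 else 0

/-- Qubit `i` is still in the state zero, so the term with value `true` vanishes and the other one
no longer depends on `x i`. -/
theorem plusState_had {n : ℕ} {l : List (Fin n)} {i : Fin n} (hi : i ∉ l) (x : Fin n → Bool) :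
    plusState l (Function.update x i false) + sgn (x i) * plusState l (Function.update x i true) =
      plusState (i :: l) x := by
  have h1 : plusState l (Function.update x i true) = 0 := if_neg fun h => by
    simpa using h i hi
  rw [h1, mul_zero, add_zero]
  unfold plusState
  congr 1
  refine propext ⟨fun h j hj => ?_, fun h j hj => ?_⟩
  · simp only [List.mem_cons, not_or] at hj
    simpa [hj.1] using h j hj.2
  · by_cases hji : j = i
    · subst hji; simp
    · simpa [hji] using h j (by simp [hji, hj])

theorem plusState_nil {n : ℕ} : plusState ([] : List (Fin n)) = Pi.single (fun _ => false) 1 := by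
  funext z
  simp only [plusState, List.not_mem_nil, not_false_eq_true, forall_const, Pi.single_apply]
  congr 1
  exact propext ⟨fun h => funext h, fun h i => congrFun h i⟩

/-- The general initial state `m` is what the induction needs: every gate moves one fresh qubit into
superposition. -/
theorem layer_mulVec {n : ℕ} (l m : List (Fin n)) (hl : (l.reverse ++ m).Nodup) :
    Circuit.matrix (l.map Gate.had) *ᵥ plusState m =
      (((Real.sqrt 2 : ℝ) : ℂ) ^ l.length)⁻¹ • plusState (l.reverse ++ m) := by
  induction l generalizing m with
  | nil => simp [Circuit.matrix]
  | cons i l ih =>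
    have hl' : (l.reverse ++ (i :: m)).Nodup := by simpa using hl
    have hi : i ∉ m := by
      have := (List.nodup_append.1 hl').2.1
      exact (List.nodup_cons.1 this).1
    have h1 : (Gate.had i).matrix *ᵥ plusState m =
        (((Real.sqrt 2 : ℝ) : ℂ))⁻¹ • plusState (i :: m) := by
      funext x
      rw [had_mulVec, plusState_had hi, Pi.smul_apply, smul_eq_mul, div_eq_inv_mul]
    rw [List.map_cons, Circuit.matrix, ← Matrix.mulVec_mulVec, h1, Matrix.mulVec_smul, ih _ hl',
      smul_smul]
    simp [pow_succ, mul_comm]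

theorem layer_vecMul {n : ℕ} (l : List (Fin n)) (hl : l.Nodup) :
    plusState [] ᵥ* Circuit.matrix (l.map Gate.had) =
      (((Real.sqrt 2 : ℝ) : ℂ) ^ l.length)⁻¹ • plusState l := by
  induction l with
  | nil => simp [Circuit.matrix]
  | cons i l ih =>
    have h1 : plusState l ᵥ* (Gate.had i).matrix =
        (((Real.sqrt 2 : ℝ) : ℂ))⁻¹ • plusState (i :: l) := by
      funext x
      rw [had_vecMul, plusState_had (List.nodup_cons.1 hl).1, Pi.smul_apply, smul_eq_mul,
        div_eq_inv_mul]
    rw [List.map_cons, Circuit.matrix, ← Matrix.vecMul_vecMul, ih (List.nodup_cons.1 hl).2,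
      Matrix.smul_vecMul, h1, smul_smul]
    simp [pow_succ, mul_comm]

/-- The extension of an assignment by `false`. -/
def extend {N : ℕ} (z : Fin N → Bool) (i : ℕ) : Bool := if h : i < N then z ⟨i, h⟩ else false

/-- The phase that a list of cubic monomials gives to an assignment. -/
def phase (L : List (ℕ × ℕ × ℕ)) (z : ℕ → Bool) : ℤ :=
  (L.map fun m => sgn (z m.1 && z m.2.1 && z m.2.2)).prod

/-- The exponential sum of a cubic polynomial in `N` variables, given by its monomials. -/
def cubicSum (N : ℕ) (L : List (ℕ × ℕ × ℕ)) : ℤ := ∑ z : Fin N → Bool, phase L (extend z)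

/-- Three distinct numbers below `N`. -/
def IsMono (N : ℕ) (m : ℕ × ℕ × ℕ) : Prop :=
  (m.1 < N ∧ m.2.1 < N ∧ m.2.2 < N) ∧ m.1 ≠ m.2.1 ∧ m.1 ≠ m.2.2 ∧ m.2.1 ≠ m.2.2

/-- Gates with unbounded qubit numbers. -/
inductive RawGate : Type
  | had (i : ℕ)
  | tof (a b c : ℕ)

/-- The code of a gate. -/
def RawGate.encode : RawGate → List Bool
  | .had i => false :: encodeUnary i
  | .tof a b c => true :: (encodeUnary a ++ encodeUnary b ++ encodeUnary c)

/-- The gates of a doubly controlled phase flip. -/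
def cczGates (m : ℕ × ℕ × ℕ) : List RawGate := [.had m.2.2, .tof m.1 m.2.1 m.2.2, .had m.2.2]

/-- Hadamard gates on the first `N` qubits. -/
def hadLayer (N : ℕ) : List RawGate := (List.range N).map RawGate.had

/-- Diagonal matrices multiply entrywise, so the phases of the monomials multiply. Existence is
stated together with length and code in terms of `RawGate`, so that later parts never meet indices
in `Fin n`. -/
theorem exists_ccz_circuit {n : ℕ} (L : List (ℕ × ℕ × ℕ)) (hL : ∀ m ∈ L, IsMono n m) :
    ∃ C : Circuit n, C.length = (L.flatMap cczGates).length ∧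
      C.flatMap Gate.encode = (L.flatMap cczGates).flatMap RawGate.encode ∧
      Circuit.matrix C = diagonal fun z => (phase L (extend z) : ℂ) := by
  induction L with
  | nil => exact ⟨[], rfl, rfl, by simp [Circuit.matrix, phase]⟩
  | cons m L ih =>
    obtain ⟨C, h1, h2, h3⟩ := ih fun m' hm' => hL m' (List.mem_cons_of_mem _ hm')
    obtain ⟨⟨ha, hb, hc⟩, hab, hac, hbc⟩ := hL m List.mem_cons_self
    refine ⟨[.had ⟨_, hc⟩, .tof ⟨_, ha⟩ ⟨_, hb⟩ ⟨_, hc⟩ (by simpa) (by simpa) (by simpa),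
      .had ⟨_, hc⟩] ++ C, ?_, ?_, ?_⟩
    · simp [h1, cczGates]
    · simp only [List.flatMap_append, h2, List.flatMap_cons]
      simp [cczGates, RawGate.encode, Gate.encode]
    · rw [Circuit.matrix_append, ccz_matrix, h3, diagonal_mul_diagonal]
      congr 1
      funext z
      simp [phase, extend, ha, hb, hc, mul_comm]

theorem exists_layer {n N : ℕ} (hN : N ≤ n) :
    ∃ l : List (Fin n), l.Nodup ∧ l.length = N ∧ (∀ i, i ∈ l ↔ i.1 < N) ∧
      (l.map Gate.had).flatMap Gate.encode = (hadLayer N).flatMap RawGate.encode := by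
  refine ⟨(List.finRange N).map (Fin.castLE hN), ?_, by simp, ?_, ?_⟩
  · exact (List.nodup_finRange N).map (Fin.castLE_injective hN)
  · intro i
    simp only [List.mem_map, List.mem_finRange, true_and]
    exact ⟨fun ⟨j, hj⟩ => hj ▸ j.2, fun h => ⟨⟨i, h⟩, rfl⟩⟩
  · have : (hadLayer N) = (List.finRange N).map fun i => RawGate.had i.1 := by
      rw [hadLayer, ← List.map_coe_finRange_eq_range, List.map_map]; rfl
    rw [this, List.map_map]
    simp only [List.flatMap_map]
    rfl

/-- The circuit that samples the exponential sum of a cubic polynomial. -/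
theorem exists_cubic_circuit {n N : ℕ} (hN : N ≤ n) (L : List (ℕ × ℕ × ℕ))
    (hL : ∀ m ∈ L, IsMono N m) :
    ∃ C : Circuit n,
      C.length = (hadLayer N ++ L.flatMap cczGates ++ hadLayer N).length ∧
      C.flatMap Gate.encode =
        (hadLayer N ++ L.flatMap cczGates ++
          hadLayer N).flatMap RawGate.encode ∧
      C.zeroProb = ((cubicSum N L : ℝ) / 2 ^ N) ^ 2 := by
  obtain ⟨l, hnd, hlen, hmem, henc⟩ := exists_layer hN
  obtain ⟨D, hD1, hD2, hD3⟩ := exists_ccz_circuit (n := n) L fun m hm => by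
    obtain ⟨⟨h1, h2, h3⟩, h⟩ := hL m hm
    exact ⟨⟨h1.trans_le hN, h2.trans_le hN, h3.trans_le hN⟩, h⟩
  refine ⟨l.map Gate.had ++ D ++ l.map Gate.had, ?_, ?_, ?_⟩
  · simp [hD1, hlen, hadLayer]
  · simp only [List.flatMap_append, henc, hD2]
  -- The amplitude is the mean of the phase over the uniform superposition of the first `N` qubits.
  -- The other `n - N` qubits stay at zero; they serve only to make `n` large.
  · have key : Circuit.matrix (l.map Gate.had ++ D ++ l.map Gate.had) (fun _ => false)
        (fun _ => false) = (cubicSum N L : ℂ) / 2 ^ N := by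
      have h1 : ∀ A : Matrix (Fin n → Bool) (Fin n → Bool) ℂ, A (fun _ => false) (fun _ => false) =
          plusState [] ⬝ᵥ (A *ᵥ plusState []) := by
        intro A
        rw [plusState_nil]
        simp
      have hr : ∀ z, plusState l.reverse z = plusState l z := fun z => by
        simp [plusState]
      have h2 : ∀ z : Fin n → Bool, plusState l z * plusState l z = plusState l z := fun z => by
        unfold plusState; split_ifs <;> simp
      refine (h1 (Circuit.matrix _)).trans ?_
      rw [Circuit.matrix_append, Circuit.matrix_append, hD3, ← Matrix.mulVec_mulVec,
        ← Matrix.mulVec_mulVec, Matrix.dotProduct_mulVec, layer_vecMul l hnd,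
        layer_mulVec l [] (by simpa using hnd)]
      have h3 : ∑ z : Fin n → Bool, plusState l z * (phase L (extend z) : ℂ) =
          (cubicSum N L : ℂ) := by
        rw [cubicSum, Int.cast_sum]
        symm
        refine Fintype.sum_of_injective (fun (w : Fin N → Bool) (i : Fin n) => extend w i) ?_ _ _
          ?_ ?_
        · intro w w' h
          funext i
          simpa [extend] using congrFun h (Fin.castLE hN i)
        · intro z hz
          rw [plusState, if_neg, zero_mul]
          intro h
          refine hz ⟨fun i => z (Fin.castLE hN i), ?_⟩
          funext i
          simp only [extend]
          split_ifs with hi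
          · rfl
          · exact (h i fun h' => hi ((hmem i).1 h')).symm
        · intro w
          have : extend (fun i : Fin n => extend w i) = extend w := by
            funext i
            simp only [extend]
            split_ifs <;> first | rfl | omega
          rw [this, plusState, if_pos, one_mul]
          intro i hi
          rw [hmem] at hi
          simp [extend, hi]
      -- Each of the two layers contributes the inverse of the `N`-th power of √2.
      rw [← h3, ← hlen, ← sqrt_two_pow_sq, Finset.sum_div]
      simp only [dotProduct, mulVec_diagonal, Pi.smul_apply, smul_eq_mul,
        List.append_nil, hr]
      refine Finset.sum_congr rfl fun z _ => ?_
      conv_rhs => rw [← h2 z]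
      field_simp
    rw [Circuit.zeroProb, key]
    have : ((cubicSum N L : ℂ) / 2 ^ N) = (((cubicSum N L : ℝ) / 2 ^ N : ℝ) : ℂ) := by push_cast; rfl
    rw [this, Complex.norm_real, Real.norm_eq_abs, sq_abs]

/-! ### Local checks of a computation -/

/-- A reference to a variable: a global one, or one at a fixed distance from the current position in
the previous or in the current row. -/
inductive Ref : Type
  | glob (o : ℕ)
  | prev (o : ℕ)
  | cur (o : ℕ)

/-- The number of the variable, for positions `a` and `d` in the previous and the current row. -/
def Ref.val (a d : ℕ) : Ref → ℕ
  | glob o => o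
  | prev o => a + o
  | cur o => d + o

@[simp] theorem Ref.val_glob (a d o : ℕ) : (Ref.glob o).val a d = o := rfl

@[simp] theorem Ref.val_prev (a d o : ℕ) : (Ref.prev o).val a d = a + o := rfl

@[simp] theorem Ref.val_cur (a d o : ℕ) : (Ref.cur o).val a d = d + o := rfl

/-- The first of the two variables that hold the constant `true`. -/
abbrev one₁ : Ref := .glob 6

/-- The second of the two variables that hold the constant `true`. -/
abbrev one₂ : Ref := .glob 7

/-- A sum of products of two variables, modulo two. -/
def quadSum (z : ℕ → Bool) (a d : ℕ) (ps : List (Ref × Ref)) : Bool :=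
  ps.foldr (fun p b => xor (z (p.1.val a d) && z (p.2.val a d)) b) false

section quadSum

variable {z : ℕ → Bool} {a d : ℕ}

@[simp] theorem quadSum_nil : quadSum z a d [] = false := rfl

@[simp] theorem quadSum_cons (p : Ref × Ref) (ps : List (Ref × Ref)) :
    quadSum z a d (p :: ps) = xor (z (p.1.val a d) && z (p.2.val a d)) (quadSum z a d ps) := rfl

@[simp] theorem quadSum_append (ps qs : List (Ref × Ref)) :
    quadSum z a d (ps ++ qs) = xor (quadSum z a d ps) (quadSum z a d qs) := by
  induction ps with
  | nil => simp
  | cons p ps ih => simp [ih]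

theorem quadSum_flatMap_eq_false {f : ℕ → List (Ref × Ref)} (l : List ℕ)
    (h : ∀ j ∈ l, quadSum z a d (f j) = false) : quadSum z a d (l.flatMap f) = false := by
  induction l with
  | nil => rfl
  | cons j l ih =>
    rw [List.flatMap_cons, quadSum_append, h j List.mem_cons_self,
      ih fun j' hj' => h j' (List.mem_cons_of_mem _ hj')]
    rfl

/-- Meant for sums over all values of the program counter, of which exactly one is marked by a true
variable. -/
theorem quadSum_flatMap_range {f : ℕ → List (Ref × Ref)} {n j₀ : ℕ} (hj : j₀ < n)
    (h : ∀ j < n, j ≠ j₀ → quadSum z a d (f j) = false) :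
    quadSum z a d ((List.range n).flatMap f) = quadSum z a d (f j₀) := by
  obtain ⟨m, rfl⟩ : ∃ m, n = j₀ + (m + 1) := ⟨n - j₀ - 1, by omega⟩
  rw [List.range_add, List.flatMap_append, quadSum_append, List.range_succ_eq_map, List.map_cons,
    List.flatMap_cons, quadSum_append, quadSum_flatMap_eq_false, quadSum_flatMap_eq_false]
  · simp
  · intro j hj
    simp only [List.map_map, List.mem_map] at hj
    obtain ⟨k, hk, rfl⟩ := hj
    have := List.mem_range.1 hk
    exact h (j₀ + (k + 1)) (by omega) (by omega)
  · intro j hj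
    have := List.mem_range.1 hj
    exact h j (by omega) (by omega)

end quadSum

/-- A check: the variable that carries it, and the sum that has to vanish. -/
abbrev Check : Type := Ref × List (Ref × Ref)

/-- The three kinds of columns of the tableau. -/
inductive Col : Type
  | first
  | mid
  | last

/-- The distance of a column from the reference position. -/
def Col.self : Col → ℕ
  | first => 0
  | mid => 1
  | last => 1

/-- The kinds of the rows of the tableau: empty stacks, a given bit pushed on the first stack, an
arbitrary bit pushed on the second stack, a step of the machine. -/
inductive Row : Type
  | zero
  | load (b : Bool)
  | free
  | step

/-- The position of the variable that says that there is the bit `s` on stack `r`. -/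
def cellIx (r : ℕ) (s : Bool) : ℕ := 2 * r + s.toNat

/-! ### Quadratic equations for one row of the tableau -/

section Tableau

variable (M : Machine) (R : ℕ)

/-- The position of the variable that says that the program counter is `j`. -/
def pcIx (j : ℕ) : ℕ := 2 * R + j

/-- The number of variables that describe a column. -/
def nk : ℕ := 2 * R + M.length + 1

/-- The number of variables of a column, with those of the checks. -/
def bw : ℕ := 2 * nk M R

/-- The new bits of stack `r` after an instruction. -/
def cellTerms (c : Col) (coef : Ref) (i : Option Instr) (r : ℕ) (s : Bool) : List (Ref × Ref) :=
  let keep := [(coef, Ref.prev (c.self * bw M R + cellIx r s))]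
  match i with
  | some (.push r' b) =>
    if r' = r then
      match c with
      | .first => if s = b then [(coef, one₁)] else []
      | _ => [(coef, Ref.prev (cellIx r s))]
    else keep
  | some (.pop r' _ _ _) =>
    if r' = r then
      match c with
      | .last => []
      | _ => [(coef, Ref.prev ((c.self + 1) * bw M R + cellIx r s))]
    else keep
  | some .ask => if r = 2 ∨ r = 3 then [] else keep
  | none => keep

/-- The contribution of the instruction at `j` to the new program counter. -/
def pcTerms (j : ℕ) (i : Option Instr) (j' : ℕ) : List (Ref × Ref) :=
  let coef := Ref.prev (pcIx R j)
  match i with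
  | some (.push _ _) => if min (j + 1) M.length = j' then [(coef, one₁)] else []
  | some .ask => if min (j + 1) M.length = j' then [(coef, one₁)] else []
  | some (.pop r e z o) =>
    (if min e M.length = j' then
      [(coef, one₁), (coef, Ref.prev (cellIx r false)), (coef, Ref.prev (cellIx r true))]
      else []) ++
    ((if min z M.length = j' then [(coef, Ref.prev (cellIx r false))] else []) ++
    (if min o M.length = j' then [(coef, Ref.prev (cellIx r true))] else []))
  | none => if M.length = j' then [(coef, one₁)] else []

/-- The value that a bit on a stack has to take. -/
def cellSum : Row → Col → ℕ → Bool → List (Ref × Ref)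
  | .zero, _, _, _ => []
  | .load b, c, r, s => cellTerms M R c one₂ (some (.push 0 b)) r s
  | .free, c, r, s =>
    match c with
    | .first =>
      if r = 1 then [(one₂, one₁), (one₂, .cur (cellIx 1 true))]
      else cellTerms M R c one₂ (some (.push 1 true)) r s
    | _ => cellTerms M R c one₂ (some (.push 1 true)) r s
  | .step, c, r, s => (List.range (M.length + 1)).flatMap fun j =>
      cellTerms M R c (.prev (c.self * bw M R + pcIx R j)) M[j]? r s

/-- The value that a bit of the program counter has to take. -/
def pcSum : Row → Col → ℕ → List (Ref × Ref)
  | .step, .first, j' => (List.range (M.length + 1)).flatMap fun j => pcTerms M R j M[j]? j'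
  | .step, _, j' => [(one₂, .cur (pcIx R j'))]
  | _, _, j' => if j' = 0 then [(one₂, one₁)] else []

/-- The check that the variable `k` of a column is equal to a sum. -/
def mkCheck (c : Col) (k : ℕ) (ps : List (Ref × Ref)) : Check :=
  (.cur (c.self * bw M R + (nk M R + k)), (one₁, .cur (c.self * bw M R + k)) :: ps)

/-- Whether a bit on a stack is not determined by the previous row. -/
def isFree : Row → Col → ℕ → Bool → Bool
  | .free, .first, 1, true => true
  | _, _, _, _ => false

/-- The checks of a column. -/
def colChecks (w : Row) (c : Col) : List Check :=
  ((List.range R).flatMap fun r => [false, true].flatMap fun s =>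
    if isFree w c r s then [] else [mkCheck M R c (cellIx r s) (cellSum M R w c r s)]) ++
  (List.range (M.length + 1)).map fun j => mkCheck M R c (pcIx R j) (pcSum M R w c j)

/-- The check is passed. -/
def Check.Holds (z : ℕ → Bool) (a d : ℕ) (c : Check) : Prop := quadSum z a d c.2 = false

/-- The kind of the column `i` of a row of length `H`. -/
def colOf (H i : ℕ) : Col := if i = 0 then .first else if i + 1 = H then .last else .mid

/-- All checks of a row are passed; `a` and `d` are the positions of the previous and of the current
row. -/
def RowSat (z : ℕ → Bool) (H a d : ℕ) (w : Row) : Prop :=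
  ∀ i < H, ∀ c ∈ colChecks M R w (colOf H i),
    c.Holds z (a + (i - 1) * bw M R) (d + (i - 1) * bw M R)

/-- The row at the position `a` describes the configuration `c`. -/
def RowIs (z : ℕ → Bool) (H a : ℕ) (c : Config) : Prop :=
  ∀ i < H, (∀ r < R, ∀ s, z (a + i * bw M R + cellIx r s) = decide ((c.stk r)[i]? = some s)) ∧
    ∀ j ≤ M.length, z (a + i * bw M R + pcIx R j) = decide (min c.pc M.length = j)

/-- The effect of an instruction on the stacks. -/
def effect (S : ℕ → List Bool) : Option Instr → ℕ → List Bool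
  | some (.push r b) => Function.update S r (b :: S r)
  | some (.pop r _ _ _) => Function.update S r (S r).tail
  | some .ask => Function.update (Function.update S 3 []) 2 []
  | none => S

/-- The configuration after a row; `b` is the bit that is pushed if the row does not fix it. -/
def nextConf (b : Bool) (c : Config) : Row → Config
  | .zero => ⟨0, fun _ => []⟩
  | .load b' => ⟨0, effect c.stk (some (.push 0 b'))⟩
  | .free => ⟨0, effect c.stk (some (.push 1 b))⟩
  | .step => QGap.step noOracle M c

variable {M R}

theorem step_stk (c : Config) : (step noOracle M c).stk = effect c.stk M[c.pc]? := by
  unfold step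
  cases h : M[c.pc]? with
  | none => rfl
  | some i =>
    cases i with
    | push r b => rfl
    | ask => rfl
    | pop r e z o =>
      simp only [Instr.exec, effect]
      split
      · next h => simp [h]
      · next h => simp [h]
      · next h => simp [h]

theorem RowIs.cell {z : ℕ → Bool} {H a : ℕ} {c : Config} (h : RowIs M R z H a c) {i r : ℕ}
    (hi : i < H) (hr : r < R) (s : Bool) {k : ℕ} (hk : k = a + i * bw M R + cellIx r s) :
    z k = decide ((c.stk r)[i]? = some s) := hk ▸ (h i hi).1 r hr s

/-- Below the top, a push copies from the column on the left; a pop copies from the column on the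
right. In the last column a pop would look beyond the row, but by `hlen` nothing is stored there, so
the empty sum is right. An oracle call empties the stacks 2 and 3, as the trivial oracle answers
with the empty list. -/
theorem cellTerms_spec {z : ℕ → Bool} {H a d i r : ℕ} {c : Config} (h : RowIs M R z H a c)
    (hH : 2 ≤ H) (hi : i < H) (hr : r < R) (hlen : (c.stk r).length ≤ H)
    (h1 : z 6 = true) (coef : Ref) (ins : Option Instr) (s : Bool) :
    quadSum z (a + (i - 1) * bw M R) d (cellTerms M R (colOf H i) coef ins r s) =
      (z (coef.val (a + (i - 1) * bw M R) d) &&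
        decide ((effect c.stk ins r)[i]? = some s)) := by
  have hself : a + (i - 1) * bw M R + ((colOf H i).self * bw M R + cellIx r s) =
      a + i * bw M R + cellIx r s := by
    rcases i with _ | i
    · simp [colOf, Col.self]
    · have : (colOf H (i + 1)).self = 1 := by
        simp only [colOf]; split_ifs <;> simp_all [Col.self]
      rw [this]; simp; ring
  have hkeep : z (a + (i - 1) * bw M R + ((colOf H i).self * bw M R + cellIx r s)) =
      decide ((c.stk r)[i]? = some s) := h.cell hi hr s hself
  unfold cellTerms
  rcases ins with _ | (⟨r', b⟩ | ⟨r', e, zz, o⟩ | _)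
  · simp only [quadSum_cons, quadSum_nil, Ref.val_prev, hkeep, effect, Bool.xor_false]
    rfl
  · by_cases hr' : r' = r
    · subst hr'
      rcases i with _ | i
      · simp only [colOf, ↓reduceIte, effect, Function.update_self]
        by_cases hs : s = b
        · subst hs; simp [h1]
        · simp [hs, Ne.symm hs]
      · have hk := h.cell (show i < H by omega) hr s rfl
        have : (colOf H (i + 1)) = .mid ∨ (colOf H (i + 1)) = .last := by
          simp only [colOf]; split_ifs <;> simp_all
        rcases this with this | this <;>
        simp [this, effect, hk]
    · simp [hr', hkeep, effect, Ne.symm hr']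
  · by_cases hr' : r' = r
    · subst hr'
      by_cases hl : i + 1 = H
      · have : colOf H i = .last := by
          simp only [colOf]; split_ifs <;> first | omega | rfl
        have hn : (c.stk r').tail[i]? = none := by
          rw [List.getElem?_eq_none]; simp; omega
        simp [this, effect, hn]
      · have hk := h.cell (show i + 1 < H by omega) hr s
          (k := a + (i - 1) * bw M R + (((colOf H i).self + 1) * bw M R + cellIx r' s)) (by
            linarith [hself])
        have : (colOf H i) = .first ∨ (colOf H i) = .mid := by
          simp only [colOf]; split_ifs <;> simp_all
        rcases this with this | this <;>
        · rw [this] at hk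
          simp [this, effect, hk]
    · simp [hr', hkeep, effect, Ne.symm hr']
  · by_cases hr2 : r = 2
    · subst hr2; simp [effect]
    · by_cases hr3 : r = 3
      · subst hr3; simp [effect]
      · simp [hr2, hr3, hkeep, effect]


/-- The reference position of column `i` is column `i - 1`, and column 0 itself if `i = 0`, by
truncated subtraction. Thus both neighbours of a column are reached by nonnegative offsets, and
`Col.self` leads back to the column. -/
theorem pos_self (a i k : ℕ) (H : ℕ) :
    a + (i - 1) * bw M R + ((colOf H i).self * bw M R + k) = a + i * bw M R + k := by
  rcases i with _ | i
  · simp [colOf, Col.self]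
  · have : (colOf H (i + 1)).self = 1 := by
      simp only [colOf]; split_ifs <;> simp_all [Col.self]
    rw [this]; simp; ring

/-- The tableau stores the program counter cut off at `M.length`; all halted counters share this
value, at which no instruction is found. -/
theorem getElem?_min_length (j : ℕ) : M[min j M.length]? = M[j]? := by
  rcases le_total j M.length with h | h
  · rw [min_eq_left h]
  · rw [min_eq_right h, List.getElem?_eq_none le_rfl, List.getElem?_eq_none h]

/-- The stacks that an instruction pops are below `R`. -/
def Instr.Below (R : ℕ) : Instr → Prop
  | .pop r _ _ _ => r < R
  | _ => True

/-- The variable itself enters the sum multiplied by the constant one; a sum modulo two of two bits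
vanishes exactly if they are equal. -/
theorem mkCheck_holds {z : ℕ → Bool} (h1 : z 6 = true) (H a d i k : ℕ) (ps : List (Ref × Ref)) :
    (mkCheck M R (colOf H i) k ps).Holds z (a + (i - 1) * bw M R) (d + (i - 1) * bw M R) ↔
      z (d + i * bw M R + k) = quadSum z (a + (i - 1) * bw M R) (d + (i - 1) * bw M R) ps := by
  simp [mkCheck, Check.Holds, pos_self, h1]

/-- Only the terms of the current instruction have a nonzero coefficient. For a pop, with indicators
a and b of the two possible top bits, 1 + a + b indicates an empty stack, because a and b are never
both one. Exactly one of the three cases occurs, so the sum stays correct if some of the targets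
coincide. -/
theorem pcTerms_spec {z : ℕ → Bool} {H a d : ℕ} {c : Config} (h : RowIs M R z H a c)
    (hM : ∀ i ∈ M, i.Below R) (hH : 2 ≤ H) (h1 : z 6 = true) (j' : ℕ) :
    quadSum z a d ((List.range (M.length + 1)).flatMap fun j => pcTerms M R j M[j]? j') =
      decide (min (step noOracle M c).pc M.length = j') := by
  have hpc : ∀ j ≤ M.length, z (a + pcIx R j) = decide (min c.pc M.length = j) := fun j hj => by
    simpa using (h 0 (by omega)).2 j hj
  rw [quadSum_flatMap_range (j₀ := min c.pc M.length) (by omega)]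
  · have hpc' := hpc _ (min_le_right c.pc M.length)
    rw [decide_eq_true rfl] at hpc'
    rw [getElem?_min_length]
    cases hi : M[c.pc]? with
    | none =>
      have : M.length ≤ c.pc := by simpa using hi
      simp only [pcTerms, step, hi, min_eq_right this]
      rw [min_eq_right this] at hpc'
      split_ifs with hj
      · simp [hpc', h1, ← hj]
      · simp [hj]
    | some i =>
      have hlt : c.pc < M.length := by
        by_contra hcon
        rw [List.getElem?_eq_none (by omega)] at hi
        cases hi
      rw [min_eq_left hlt.le] at hpc' ⊢
      cases i with
      | push r b =>
        simp only [pcTerms, step, hi, Instr.exec]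
        split_ifs with hj
        · simp [hpc', h1, hj]
        · simp [hj]
      | ask =>
        simp only [pcTerms, step, hi, Instr.exec]
        split_ifs with hj
        · simp [hpc', h1, hj]
        · simp [hj]
      | pop r e zz o =>
        have hr : r < R := hM _ (List.mem_of_getElem? hi)
        have hf : z (a + cellIx r false) = decide ((c.stk r)[0]? = some false) :=
          h.cell (show 0 < H by omega) hr false (by simp)
        have ht : z (a + cellIx r true) = decide ((c.stk r)[0]? = some true) :=
          h.cell (show 0 < H by omega) hr true (by simp)
        simp only [pcTerms, step, hi, Instr.exec, quadSum_append]
        rcases hs : c.stk r with _ | ⟨b, l⟩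
        · rw [hs] at hf ht
          simp at hf ht
          split_ifs <;> simp_all
        · rw [hs] at hf ht
          cases b <;> simp at hf ht <;> split_ifs <;> simp_all
  · intro j hjn hj
    have hz := hpc j (by omega)
    rw [decide_eq_false (by omega)] at hz
    unfold pcTerms
    rcases M[j]? with _ | (⟨r', b⟩ | ⟨r', e, zz, o⟩ | _)
    · dsimp only; split_ifs <;> simp [hz]
    · dsimp only; split_ifs <;> simp [hz]
    · dsimp only; split_ifs <;> simp [hz]
    · dsimp only; split_ifs <;> simp [hz]

theorem quadSum_cellTerms_of_false {z : ℕ → Bool} {a d : ℕ} {coef : Ref}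
    (hz : z (coef.val a d) = false) (c : Col) (i : Option Instr) (r : ℕ) (s : Bool) :
    quadSum z a d (cellTerms M R c coef i r s) = false := by
  unfold cellTerms
  rcases i with _ | (⟨r', b⟩ | ⟨r', e, zz, o⟩ | _) <;> dsimp only <;>
    cases c <;> (try dsimp only) <;> (try split_ifs) <;> simp [hz]

theorem nextConf_pc {b : Bool} {c : Config} {w : Row} (hw : w ≠ .step) :
    (nextConf (M := M) b c w).pc = 0 := by
  cases w <;> first | rfl | exact absurd rfl hw

/-- A row of kind `zero` does not refer to its predecessor, which is why `h` may leave that case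
out. In a free row the new top bit is whatever the tableau contains; only the indicator of `false`
is tied to it, as the complement of the indicator of `true`. -/
theorem cellSum_spec {z : ℕ → Bool} {H a d i r : ℕ} {c : Config} {w : Row} {s : Bool}
    (h : w ≠ .zero → RowIs M R z H a c)
    (hH : 2 ≤ H) (hi : i < H) (hr : r < R) (hlen : (c.stk r).length ≤ H)
    (h1 : z 6 = true) (h2 : z 7 = true) (hf : isFree w (colOf H i) r s = false) :
    quadSum z (a + (i - 1) * bw M R) (d + (i - 1) * bw M R)
        (cellSum M R w (colOf H i) r s) =
      decide (((nextConf (M := M) (z (d + cellIx 1 true)) c w).stk r)[i]? = some s) := by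
  cases w with
  | zero => simp [cellSum, nextConf]
  | load b =>
    simp only [cellSum, nextConf]
    rw [cellTerms_spec (h (by simp)) hH hi hr hlen h1]
    simp only [Ref.val_glob, h2, Bool.true_and]
    rfl
  | free =>
    simp only [cellSum, nextConf]
    -- Except for the new top bit, the effect of a push does not depend on the pushed bit; the
    -- equations use `push 1 true` as a representative.
    have hspec := fun b => cellTerms_spec (d := d + (i - 1) * bw M R) (h (by simp)) hH hi hr hlen h1
      one₂ (some (.push 1 b)) s
    simp only [Ref.val_glob, h2, Bool.true_and] at hspec
    rcases i with _ | i
    · by_cases hr1 : r = 1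
      · subst hr1
        cases s
        · simp [colOf, effect, h1, h2]
        · simp [colOf, isFree] at hf
      · have := hspec true
        simp only [colOf, ↓reduceIte, hr1] at this ⊢
        rw [this]
        simp [effect, hr1]
    · have hc : colOf H (i + 1) = .mid ∨ colOf H (i + 1) = .last := by
        simp only [colOf]; split_ifs <;> simp_all
      have := hspec true
      rcases hc with hc | hc <;>
      · rw [hc] at this ⊢
        dsimp only
        rw [this]
        by_cases hr1 : r = 1
        · subst hr1; simp [effect]
        · simp [effect, hr1]
  | step =>
    simp only [cellSum, nextConf, step_stk]
    have hrow := h (by simp)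
    have hpc : ∀ j ≤ M.length, z (a + i * bw M R + pcIx R j) = decide (min c.pc M.length = j) :=
      fun j hj => (hrow i hi).2 j hj
    rw [quadSum_flatMap_range (j₀ := min c.pc M.length) (by omega)]
    · rw [cellTerms_spec hrow hH hi hr hlen h1, getElem?_min_length, Ref.val_prev, pos_self,
        hpc _ (min_le_right _ _)]
      simp
    · intro j hjn hj
      apply quadSum_cellTerms_of_false
      rw [Ref.val_prev, pos_self, hpc j (by omega), decide_eq_false (Ne.symm hj)]

/-- Only column 0 computes the new counter in a step; the others copy it from their left neighbour
in the same row. Single equations therefore do not determine the values, and the equivalence is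
proved for the whole row by induction on the column. -/
theorem pcSum_spec {z : ℕ → Bool} {H a d : ℕ} {c : Config} {w : Row} (b : Bool)
    (h : w ≠ .zero → RowIs M R z H a c) (hM : ∀ i ∈ M, i.Below R)
    (hH : 2 ≤ H) (h1 : z 6 = true) (h2 : z 7 = true) :
    (∀ i < H, ∀ j ≤ M.length, z (d + i * bw M R + pcIx R j) =
      quadSum z (a + (i - 1) * bw M R) (d + (i - 1) * bw M R) (pcSum M R w (colOf H i) j)) ↔
    (∀ i < H, ∀ j ≤ M.length, z (d + i * bw M R + pcIx R j) =
      decide (min (nextConf (M := M) b c w).pc M.length = j)) := by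
  by_cases hw : w = .step
  · subst hw
    have hrow := h (by simp)
    have hfirst : ∀ j, quadSum z (a + (0 - 1) * bw M R) (d + (0 - 1) * bw M R)
        (pcSum M R .step (colOf H 0) j) = decide (min (step noOracle M c).pc M.length = j) := by
      intro j
      simpa [colOf, pcSum] using pcTerms_spec (d := d) hrow hM hH h1 j
    have hnext : ∀ i j, quadSum z (a + (i + 1 - 1) * bw M R) (d + (i + 1 - 1) * bw M R)
        (pcSum M R .step (colOf H (i + 1)) j) = z (d + i * bw M R + pcIx R j) := by
      intro i j
      have hc : colOf H (i + 1) = .mid ∨ colOf H (i + 1) = .last := by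
        simp only [colOf]; split_ifs <;> simp_all
      rcases hc with hc | hc <;> simp [hc, pcSum, h2]
    simp only [nextConf]
    constructor
    · intro hs i hi
      induction i with
      | zero => intro j hj; rw [hs 0 hi j hj, hfirst]; rfl
      | succ i ih => intro j hj; rw [hs _ hi j hj, hnext, ih (by omega) j hj]
    · intro hs i hi j hj
      rcases i with _ | i
      · rw [hs 0 hi j hj, hfirst]; rfl
      · rw [hs _ hi j hj, hnext, hs i (by omega) j hj]
  · have hp : ∀ i j, quadSum z (a + (i - 1) * bw M R) (d + (i - 1) * bw M R)
        (pcSum M R w (colOf H i) j) =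
          decide (min (nextConf (M := M) b c w).pc M.length = j) := by
      intro i j
      rw [nextConf_pc hw]
      have : pcSum M R w (colOf H i) j = if j = 0 then [(one₂, one₁)] else [] := by
        cases w <;> first | rfl | exact absurd rfl hw
      rw [this]
      split_ifs with hj
      · simp [hj, h1, h2]
      · simp [Ne.symm hj]
    simp only [hp]

/-- The checks of a row are passed if and only if the row describes the next configuration. -/
theorem rowSat_iff {z : ℕ → Bool} {H a d : ℕ} {c : Config} {w : Row}
    (h : w ≠ .zero → RowIs M R z H a c) (hM : ∀ i ∈ M, i.Below R)
    (hH : 2 ≤ H) (h1 : z 6 = true) (h2 : z 7 = true) (hlen : ∀ r, (c.stk r).length ≤ H) :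
    RowSat M R z H a d w ↔
      RowIs M R z H d (nextConf (M := M) (z (d + cellIx 1 true)) c w) := by
  have hP := pcSum_spec (d := d) (z (d + cellIx 1 true)) h hM hH h1 h2
  have hC := fun i (hi : i < H) r (hr : r < R) s
    (hf : isFree w (colOf H i) r s = false) => cellSum_spec (d := d) h hH hi hr (hlen r) h1 h2 hf
  have hsat : RowSat M R z H a d w ↔
      (∀ i < H, ∀ r < R, ∀ s, isFree w (colOf H i) r s = false →
        z (d + i * bw M R + cellIx r s) =
          decide (((nextConf (M := M) (z (d + cellIx 1 true)) c w).stk r)[i]? = some s)) ∧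
      (∀ i < H, ∀ j ≤ M.length, z (d + i * bw M R + pcIx R j) =
        decide (min (nextConf (M := M) (z (d + cellIx 1 true)) c w).pc M.length = j)) := by
    rw [← hP]
    constructor
    · intro hs
      refine ⟨fun i hi r hr s hf => ?_, fun i hi j hj => ?_⟩
      · rw [← hC i hi r hr s hf, ← mkCheck_holds h1 H]
        refine hs i hi _ (List.mem_append_left _ (List.mem_flatMap.2 ⟨r, List.mem_range.2 hr, ?_⟩))
        exact List.mem_flatMap.2 ⟨s, by cases s <;> simp, by simp [hf]⟩
      · rw [← mkCheck_holds h1 H]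
        refine hs i hi _ (List.mem_append_right _ (List.mem_map.2 ⟨j, ?_, rfl⟩))
        exact List.mem_range.2 (by omega)
    · rintro ⟨hc, hp⟩ i hi k hk
      rcases List.mem_append.1 hk with hk | hk
      · obtain ⟨r, hr, hk⟩ := List.mem_flatMap.1 hk
        obtain ⟨s, -, hk⟩ := List.mem_flatMap.1 hk
        cases hf : isFree w (colOf H i) r s with
        | true => simp [hf] at hk
        | false =>
          simp only [hf, Bool.false_eq_true, ↓reduceIte, List.mem_singleton] at hk
          rw [hk, mkCheck_holds h1, hC i hi r (List.mem_range.1 hr) s hf]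
          exact hc i hi r (List.mem_range.1 hr) s hf
      · obtain ⟨j, hj, rfl⟩ := List.mem_map.1 hk
        rw [mkCheck_holds h1]
        exact hp i hi j (by have := List.mem_range.1 hj; omega)
  rw [hsat]
  constructor
  · rintro ⟨hc, hp⟩ i hi
    refine ⟨fun r hr s => ?_, hp i hi⟩
    cases hf : isFree w (colOf H i) r s with
    | false => exact hc i hi r hr s hf
    | true =>
      -- The one cell without a check is the cell from which the next configuration takes its pushed
      -- bit, so its value is right by definition.
      obtain ⟨rfl, rfl, rfl, rfl⟩ : w = .free ∧ i = 0 ∧ r = 1 ∧ s = true := by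
        revert hf
        simp only [colOf]
        unfold isFree
        split
        · next hcol =>
          intro _
          by_cases hi0 : i = 0
          · simp [hi0]
          · rw [if_neg hi0] at hcol; split_ifs at hcol
        · intro h; cases h
      simp [nextConf, effect]
  · intro hs
    exact ⟨fun i hi r hr s _ => (hs i hi).1 r hr s, fun i hi j hj => (hs i hi).2 j hj⟩

end Tableau

/-! ### Summation over the variables of the checks -/

theorem phase_append (L L' : List (ℕ × ℕ × ℕ)) (z : ℕ → Bool) :
    phase (L ++ L') z = phase L z * phase L' z := by simp [phase]

theorem phase_congr {L : List (ℕ × ℕ × ℕ)} {z z' : ℕ → Bool}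
    (h : ∀ m ∈ L, z m.1 = z' m.1 ∧ z m.2.1 = z' m.2.1 ∧ z m.2.2 = z' m.2.2) :
    phase L z = phase L z' := by
  unfold phase
  congr 1
  refine List.map_congr_left fun m hm => ?_
  obtain ⟨h1, h2, h3⟩ := h m hm
  rw [h1, h2, h3]

/-- A check at a place: the positions in the previous and in the current row, and the check. -/
abbrev PlacedCheck : Type := ℕ × ℕ × Check

namespace PlacedCheck

/-- The number of the variable that carries the check. -/
def var (c : PlacedCheck) : ℕ := c.2.2.1.val c.1 c.2.1

/-- The monomials of a check. -/
def monos (c : PlacedCheck) : List (ℕ × ℕ × ℕ) :=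
  c.2.2.2.map fun p => (c.var, p.1.val c.1 c.2.1, p.2.val c.1 c.2.1)

/-- The check is passed. -/
def Holds (z : ℕ → Bool) (c : PlacedCheck) : Prop := c.2.2.Holds z c.1 c.2.1

/-- All monomials of a check contain its variable w, so their exponents add up to w times the
quadratic sum. -/
theorem phase_monos (c : PlacedCheck) (z : ℕ → Bool) :
    phase c.monos z = sgn (z c.var && quadSum z c.1 c.2.1 c.2.2.2) := by
  obtain ⟨a, d, w, ps⟩ := c
  simp only [phase, monos, List.map_map]
  generalize hv : var (a, d, w, ps) = v
  clear hv
  induction ps with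
  | nil => simp
  | cons p ps ih =>
    simp only [List.map_cons, List.prod_cons, ih, Function.comp_apply, quadSum_cons]
    cases z v <;> cases z (p.1.val a d) <;> cases z (p.2.val a d) <;>
      cases quadSum z a d ps <;> rfl

theorem quadSum_congr {z z' : ℕ → Bool} {a d : ℕ} {ps : List (Ref × Ref)}
    (h : ∀ p ∈ ps, z (p.1.val a d) = z' (p.1.val a d) ∧ z (p.2.val a d) = z' (p.2.val a d)) :
    quadSum z a d ps = quadSum z' a d ps := by
  induction ps with
  | nil => rfl
  | cons p ps ih =>
    rw [quadSum_cons, quadSum_cons, (h p List.mem_cons_self).1, (h p List.mem_cons_self).2,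
      ih fun q hq => h q (List.mem_cons_of_mem _ hq)]

end PlacedCheck

theorem extend_update {N : ℕ} (z : Fin N → Bool) {w : ℕ} (hw : w < N) (b : Bool) :
    extend (Function.update z ⟨w, hw⟩ b) = Function.update (extend z) w b := by
  funext i
  by_cases hi : i = w
  · subst hi; simp [extend, hw]
  · simp only [extend, Function.update_of_ne hi]
    split_ifs with h
    · rw [Function.update_of_ne (by simpa using hi)]
    · rfl

theorem sum_flip {N : ℕ} (w : Fin N) (f : (Fin N → Bool) → ℤ) :
    ∑ z, f (Function.update z w (!z w)) = ∑ z, f z := by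
  refine Fintype.sum_equiv (Function.Involutive.toPerm
    (fun z : Fin N → Bool => Function.update z w (!z w)) fun z => ?_) _ _ fun z => rfl
  simp

open Classical in
/-- Summation over the variable of a check. -/
theorem sum_check {N : ℕ} (c : PlacedCheck) (G : (ℕ → Bool) → ℤ) (hN : c.var < N)
    (hc : ∀ p ∈ c.2.2.2, p.1.val c.1 c.2.1 ≠ c.var ∧ p.2.val c.1 c.2.1 ≠ c.var)
    (hG : ∀ z b, G (Function.update z c.var b) = G z) :
    ∑ z : Fin N → Bool, phase c.monos (extend z) * G (extend z) =
      ∑ z : Fin N → Bool, (if c.Holds (extend z) then 1 else 0) * G (extend z) := by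
  -- An assignment is paired with the one in which w is flipped. On the left a pair contributes 1 +
  -- (-1)^Q, on the right twice the indicator of Q = 0. As both sides still range over w, no power
  -- of two appears.
  have h2 : ∀ f : (Fin N → Bool) → ℤ,
      2 * ∑ z, f z = ∑ z, (f z + f (Function.update z ⟨c.var, hN⟩ (!z ⟨c.var, hN⟩))) := by
    intro f
    rw [Finset.sum_add_distrib, sum_flip, two_mul]
  have hq : ∀ z b, quadSum (Function.update z c.var b) c.1 c.2.1 c.2.2.2 =
      quadSum z c.1 c.2.1 c.2.2.2 := fun z b => PlacedCheck.quadSum_congr fun p hp => by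
    rw [Function.update_of_ne (hc p hp).1, Function.update_of_ne (hc p hp).2]
    exact ⟨rfl, rfl⟩
  have hmul : (2 : ℤ) ≠ 0 := by norm_num
  apply mul_left_cancel₀ hmul
  rw [h2, h2]
  refine Finset.sum_congr rfl fun z _ => ?_
  simp only [extend_update, PlacedCheck.phase_monos, PlacedCheck.Holds, Check.Holds, hq, hG,
    Function.update_self]
  have : extend z c.var = z ⟨c.var, hN⟩ := by simp [extend, hN]
  rw [this]
  rcases Bool.eq_false_or_eq_true (quadSum (extend z) c.1 c.2.1 c.2.2.2) with hh | hh <;>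
    cases z ⟨c.var, hN⟩ <;> simp [hh]

open Classical in
/-- Summation over the variables of a list of checks. -/
theorem sum_checks {N : ℕ} (cs : List PlacedCheck) (F : (ℕ → Bool) → ℤ)
    (hnd : (cs.map PlacedCheck.var).Nodup) (hN : ∀ c ∈ cs, c.var < N)
    (hc : ∀ c ∈ cs, ∀ c' ∈ cs, ∀ p ∈ c.2.2.2,
      p.1.val c.1 c.2.1 ≠ c'.var ∧ p.2.val c.1 c.2.1 ≠ c'.var)
    (hF : ∀ c ∈ cs, ∀ z b, F (Function.update z c.var b) = F z) :
    ∑ z : Fin N → Bool, phase (cs.flatMap PlacedCheck.monos) (extend z) * F (extend z) =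
      ∑ z : Fin N → Bool, (if ∀ c ∈ cs, c.Holds (extend z) then 1 else 0) * F (extend z) := by
  induction cs generalizing F with
  | nil => simp [phase]
  | cons c cs ih =>
    simp only [List.map_cons, List.nodup_cons] at hnd
    have hne : ∀ c' ∈ cs, c'.var ≠ c.var := fun c' hc' h =>
      hnd.1 (List.mem_map.2 ⟨c', hc', h⟩)
    -- The variable of `c` occurs neither in `F` nor in the other checks: it differs from their
    -- variables and lies outside all sums. So it can be summed first.
    have h1 := sum_check (N := N) c (fun z => phase (cs.flatMap PlacedCheck.monos) z * F z)
      (hN c List.mem_cons_self)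
      (fun p hp => hc c List.mem_cons_self c List.mem_cons_self p hp) (fun z b => by
        rw [hF c List.mem_cons_self]
        congr 1
        refine phase_congr fun m hm => ?_
        obtain ⟨c', hc', hm⟩ := List.mem_flatMap.1 hm
        obtain ⟨p, hp, rfl⟩ := List.mem_map.1 hm
        have := hc c' (List.mem_cons_of_mem _ hc') c List.mem_cons_self p hp
        simp only [Function.update_of_ne (hne c' hc'), Function.update_of_ne this.1,
          Function.update_of_ne this.2, and_self])
    have h2 := ih (fun z => (if c.Holds z then 1 else 0) * F z) hnd.2
      (fun c' hc' => hN c' (List.mem_cons_of_mem _ hc'))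
      (fun c' hc' c'' hc'' => hc c' (List.mem_cons_of_mem _ hc') c'' (List.mem_cons_of_mem _ hc''))
      (fun c' hc' z b => by
        rw [hF c' (List.mem_cons_of_mem _ hc')]
        have : c.Holds (Function.update z c'.var b) ↔ c.Holds z := by
          unfold PlacedCheck.Holds Check.Holds
          rw [PlacedCheck.quadSum_congr (z' := z) fun p hp => ?_]
          have := hc c List.mem_cons_self c' (List.mem_cons_of_mem _ hc') p hp
          simp only [Function.update_of_ne this.1, Function.update_of_ne this.2, and_self]
        rw [if_congr this rfl rfl])
    calc _ = ∑ z : Fin N → Bool, phase c.monos (extend z) *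
          (phase (cs.flatMap PlacedCheck.monos) (extend z) * F (extend z)) := by
          refine Finset.sum_congr rfl fun z _ => ?_
          rw [List.flatMap_cons, phase_append, mul_assoc]
      _ = ∑ z : Fin N → Bool, phase (cs.flatMap PlacedCheck.monos) (extend z) *
          ((if c.Holds (extend z) then 1 else 0) * F (extend z)) := by
          rw [h1]
          exact Finset.sum_congr rfl fun z _ => by ring
      _ = _ := by
          rw [h2]
          refine Finset.sum_congr rfl fun z _ => ?_
          by_cases hz : c.Holds (extend z) <;> simp [hz]

/-- A sum over all assignments of a function that depends on few variables. -/
theorem sum_restrict {ι A : Type*} [Fintype ι] [DecidableEq ι] [Fintype A] [DecidableEq A]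
    (κ : A → ι) (hκ : Function.Injective κ) (Φ : (A → Bool) → ℤ) :
    ∑ z : ι → Bool, Φ (z ∘ κ) =
      2 ^ (Fintype.card ι - Fintype.card A) * ∑ a : A → Bool, Φ a := by
  classical
  let e : A ⊕ ((Set.range κ)ᶜ : Set ι) ≃ ι :=
    (Equiv.sumCongr (Equiv.ofInjective κ hκ) (Equiv.refl _)).trans (Equiv.Set.sumCompl _)
  have he : ∀ a, e (Sum.inl a) = κ a := fun a => by simp [e]
  rw [← (Equiv.arrowCongr e (Equiv.refl Bool)).sum_comp, ← (Equiv.sumArrowEquivProdArrow A _ Bool).symm.sum_comp,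
    Fintype.sum_prod_type_right]
  have : ∀ (b : ((Set.range κ)ᶜ : Set ι) → Bool) (a : A → Bool),
      ((Equiv.arrowCongr e (Equiv.refl Bool))
        ((Equiv.sumArrowEquivProdArrow A _ Bool).symm (a, b))) ∘ κ = a := by
    intro b a
    funext x
    have : e.symm (κ x) = Sum.inl x := by rw [← he, Equiv.symm_apply_apply]
    simp [Equiv.arrowCongr, this, Equiv.sumArrowEquivProdArrow]
  simp only [this, Finset.sum_const, Finset.card_univ, nsmul_eq_mul]
  congr 1
  have hc : Fintype.card ι = Fintype.card A + Fintype.card ((Set.range κ)ᶜ : Set ι) := by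
    rw [← Fintype.card_sum]; exact (Fintype.card_congr e).symm
  simp [hc]

/-- The same for functions of all variables. -/
theorem sum_extend {N : ℕ} {A : Type*} [Fintype A] [DecidableEq A]
    (κ : A → ℕ) (hκ : Function.Injective κ) (hN : ∀ a, κ a < N) (Ψ : (ℕ → Bool) → ℤ)
    (hΨ : ∀ z z' : ℕ → Bool, (∀ a, z (κ a) = z' (κ a)) → Ψ z = Ψ z') :
    ∑ z : Fin N → Bool, Ψ (extend z) =
      2 ^ (N - Fintype.card A) *
        ∑ a : A → Bool, Ψ (Function.extend κ a fun _ => false) := by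
  have := sum_restrict (fun a => (⟨κ a, hN a⟩ : Fin N))
    (fun a b h => hκ (by simpa using h)) (fun a => Ψ (Function.extend κ a fun _ => false))
  rw [Fintype.card_fin] at this
  rw [← this]
  refine Finset.sum_congr rfl fun z _ => hΨ _ _ fun a => ?_
  rw [hκ.extend_apply]
  simp [extend, hN]

/-! ### A gadget that fixes two variables -/

/-- The monomials of a cubic form in six variables whose exponential sum vanishes, and a term that
couples it to the variables `6` and `7`. -/
def gadget : List (ℕ × ℕ × ℕ) :=
  [(0, 1, 2), (0, 1, 3), (0, 1, 5), (0, 2, 4), (0, 2, 5), (0, 3, 4), (0, 3, 5), (1, 2, 3),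
    (1, 2, 4), (1, 3, 4), (1, 4, 5), (2, 3, 5), (2, 4, 5), (3, 4, 5), (6, 7, 0)]

/-- Brings the sum into a form that the kernel can evaluate. -/
theorem sum_bool_six (f : Bool → Bool → Bool → Bool → Bool → Bool → ℤ) :
    ∑ x : Fin 6 → Bool, f (x 0) (x 1) (x 2) (x 3) (x 4) (x 5) =
      ∑ b₀, ∑ b₁, ∑ b₂, ∑ b₃, ∑ b₄, ∑ b₅, f b₀ b₁ b₂ b₃ b₄ b₅ := by
  have h : ∀ (n : ℕ) (g : (Fin (n + 1) → Bool) → ℤ),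
      ∑ x : Fin (n + 1) → Bool, g x = ∑ b, ∑ y : Fin n → Bool, g (Fin.cons b y) := by
    intro n g
    rw [← (Fin.consEquiv fun _ : Fin (n + 1) => Bool).sum_comp, Fintype.sum_prod_type]
    rfl
  rw [h]
  refine Finset.sum_congr rfl fun b₀ _ => ?_
  rw [h]
  refine Finset.sum_congr rfl fun b₁ _ => ?_
  rw [h]
  refine Finset.sum_congr rfl fun b₂ _ => ?_
  rw [h]
  refine Finset.sum_congr rfl fun b₃ _ => ?_
  rw [h]
  refine Finset.sum_congr rfl fun b₄ _ => ?_
  rw [h]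
  refine Finset.sum_congr rfl fun b₅ _ => ?_
  rw [Fintype.sum_unique]
  rfl

/-- The sum over the six variables of the gadget. -/
theorem sum_gadget (z : (Fin 6 → Bool) → ℕ → Bool) (u₁ u₂ : Bool)
    (hz : ∀ x (i : Fin 6), z x i = x i) (h6 : ∀ x, z x 6 = u₁) (h7 : ∀ x, z x 7 = u₂) :
    ∑ x : Fin 6 → Bool, phase gadget (z x) = if u₁ && u₂ then 16 else 0 := by
  have h0 : ∀ x, z x 0 = x 0 := fun x => hz x 0
  have h1 : ∀ x, z x 1 = x 1 := fun x => hz x 1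
  have h2 : ∀ x, z x 2 = x 2 := fun x => hz x 2
  have h3 : ∀ x, z x 3 = x 3 := fun x => hz x 3
  have h4 : ∀ x, z x 4 = x 4 := fun x => hz x 4
  have h5 : ∀ x, z x 5 = x 5 := fun x => hz x 5
  have key : ∀ x, phase gadget (z x) =
      (fun b₀ b₁ b₂ b₃ b₄ b₅ => phase gadget fun i =>
        [b₀, b₁, b₂, b₃, b₄, b₅, u₁, u₂].getD i false) (x 0) (x 1) (x 2) (x 3) (x 4) (x 5) := by
    intro x
    simp [phase, gadget, h0, h1, h2, h3, h4, h5, h6, h7]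
  simp only [key]
  rw [sum_bool_six fun b₀ b₁ b₂ b₃ b₄ b₅ => phase gadget fun i =>
        [b₀, b₁, b₂, b₃, b₄, b₅, u₁, u₂].getD i false]
  clear key hz h0 h1 h2 h3 h4 h5 h6 h7 z
  revert u₁ u₂
  -- Four choices of the two constants with 64 signs each. The coupling term is present only if both
  -- constants are one; without it the signs cancel, with it they add up to 16.
  decide +kernel

/-! ### The variables of the tableau -/

theorem eq_of_mul_add_eq {m a a' k k' : ℕ} (hk : k < m) (hk' : k' < m)
    (h : a * m + k = a' * m + k') : a = a' ∧ k = k' := by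
  have h1 : (a * m + k) / m = a := by
    rw [mul_comm, Nat.mul_add_div (by omega), Nat.div_eq_of_lt hk, add_zero]
  have h2 : (a' * m + k') / m = a' := by
    rw [mul_comm, Nat.mul_add_div (by omega), Nat.div_eq_of_lt hk', add_zero]
  have : a = a' := by rw [← h1, h, h2]
  subst this
  exact ⟨rfl, by omega⟩

section Variables

variable (M : Machine) (R H : ℕ)

/-- The position of a row. -/
def base (t : ℕ) : ℕ := 10 + t * (H * bw M R)

/-- The number of a variable in the tableau. -/
def idx (t i k : ℕ) : ℕ := base M R H t + i * bw M R + k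

/-- The checks of a row. -/
def rowChecks (a d : ℕ) (w : Row) : List PlacedCheck :=
  (List.range H).flatMap fun i =>
    (colChecks M R w (colOf H i)).map fun c => (a + (i - 1) * bw M R, d + (i - 1) * bw M R, c)

/-- The checks of the tableau. -/
def gridChecks (ws : List Row) : List PlacedCheck :=
  (List.range ws.length).flatMap fun t =>
    rowChecks M R H (base M R H (t - 1)) (base M R H t) (ws.getD t .step)

variable {M R H}

theorem idx_eq (t i k : ℕ) : idx M R H t i k = 10 + ((t * H + i) * bw M R + k) := by
  simp only [idx, base]; ring

theorem idx_injective {t i k t' i' k' : ℕ} (hi : i < H) (hi' : i' < H) (hk : k < bw M R)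
    (hk' : k' < bw M R) (h : idx M R H t i k = idx M R H t' i' k') : t = t' ∧ i = i' ∧ k = k' := by
  rw [idx_eq, idx_eq] at h
  obtain ⟨h1, h2⟩ := eq_of_mul_add_eq hk hk' (Nat.add_left_cancel h)
  obtain ⟨h3, h4⟩ := eq_of_mul_add_eq hi hi' h1
  exact ⟨h3, h4, h2⟩

theorem ten_le_idx (t i k : ℕ) : 10 ≤ idx M R H t i k := by rw [idx_eq]; omega

theorem idx_lt_base {n t i k : ℕ} (ht : t < n) (hi : i < H) (hk : k < bw M R) :
    idx M R H t i k < base M R H n := by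
  rw [idx_eq, base]
  have h1 : (t * H + i) * bw M R + k < (t * H + i + 1) * bw M R := by rw [Nat.add_mul (_ + _)]; omega
  have h2 : t * H + i + 1 ≤ n * H := by
    calc t * H + i + 1 ≤ (t + 1) * H := by rw [Nat.add_mul]; omega
      _ ≤ n * H := Nat.mul_le_mul_right _ ht
  have h3 := Nat.mul_le_mul_right (bw M R) h2
  rw [Nat.mul_assoc n] at h3
  omega

theorem nk_le_bw : nk M R ≤ bw M R := by unfold bw; omega

theorem cellIx_lt_two_mul {r : ℕ} (hr : r < R) (s : Bool) : cellIx r s < 2 * R := by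
  unfold cellIx; cases s <;> simp <;> omega

theorem cellIx_lt {r : ℕ} (hr : r < R) (s : Bool) : cellIx r s < nk M R := by
  have := cellIx_lt_two_mul hr s
  unfold nk; omega

theorem pcIx_lt {j : ℕ} (hj : j ≤ M.length) : pcIx R j < nk M R := by unfold pcIx nk; omega

/-- A reference to a bit of a stack at a distance of `δ` columns. -/
def IsCellRef (c : Col) (ρ : Ref) : Prop :=
  ∃ δ k, ρ = .prev (δ * bw M R + k) ∧ k < 2 * R ∧ δ ≤ c.self + 1 ∧ (c = .last → δ ≤ 1)

theorem cellTerms_mem {c : Col} {coef : Ref} {ins : Option Instr} {r : ℕ} (hr : r < R) {s : Bool}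
    {p : Ref × Ref} (hp : p ∈ cellTerms M R c coef ins r s) :
    p.1 = coef ∧ (p.2 = one₁ ∨ IsCellRef (M := M) (R := R) c p.2) := by
  have hk := cellIx_lt_two_mul hr s
  have h0 : IsCellRef (M := M) (R := R) c (.prev (cellIx r s)) :=
    ⟨0, _, by simp, hk, by omega, by omega⟩
  have h1 : IsCellRef (M := M) (R := R) c (.prev (c.self * bw M R + cellIx r s)) :=
    ⟨_, _, rfl, hk, by omega, fun h => by subst h; simp [Col.self]⟩
  have h2 : c ≠ .last →
      IsCellRef (M := M) (R := R) c (.prev ((c.self + 1) * bw M R + cellIx r s)) :=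
    fun hc => ⟨_, _, rfl, hk, le_rfl, fun h => absurd h hc⟩
  unfold cellTerms at hp
  rcases ins with _ | (⟨r', b⟩ | ⟨r', e, zz, o⟩ | _) <;> cases c <;> (try dsimp only at hp) <;>
    (try split_ifs at hp) <;> simp only [List.mem_singleton, List.not_mem_nil] at hp <;>
    subst hp <;> simp_all

theorem pcTerms_mem (hM : ∀ i ∈ M, i.Below R) {j j' : ℕ} {p : Ref × Ref}
    (hp : p ∈ pcTerms M R j M[j]? j') :
    p.1 = .prev (pcIx R j) ∧ (p.2 = one₁ ∨ IsCellRef (M := M) (R := R) .first p.2) := by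
  have h0 : ∀ k < 2 * R, IsCellRef (M := M) (R := R) .first (.prev k) :=
    fun k hk => ⟨0, k, by simp, hk, by omega, by omega⟩
  unfold pcTerms at hp
  rcases hins : M[j]? with _ | (⟨r', b⟩ | ⟨r', e, zz, o⟩ | _) <;> rw [hins] at hp <;>
    dsimp only at hp
  · split_ifs at hp <;> simp_all
  · split_ifs at hp <;> simp_all
  · have hr : r' < R := hM _ (List.mem_of_getElem? hins)
    have hf := h0 _ (cellIx_lt_two_mul hr false)
    have ht := h0 _ (cellIx_lt_two_mul hr true)
    simp only [List.mem_append] at hp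
    rcases hp with hp | hp | hp <;> split_ifs at hp <;>
      simp only [List.mem_cons, List.not_mem_nil, or_false] at hp
    · rcases hp with rfl | rfl | rfl <;> simp_all
    · subst hp; simp_all
    · subst hp; simp_all
  · split_ifs at hp <;> simp_all

/-- The pairs of variables that occur in a check. -/
inductive GoodPair (w : Row) (c : Col) : Ref × Ref → Prop
  | one : GoodPair w c (one₂, one₁)
  | cur (ρ : Ref) (hρ : ρ = one₁ ∨ ρ = one₂) (δ k : ℕ) (hδ : δ ≤ c.self) (hk : k < nk M R) :
    GoodPair w c (ρ, .cur (δ * bw M R + k))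
  | prev (hw : w ≠ .zero) (ρ : Ref) (hρ : IsCellRef (M := M) (R := R) c ρ) : GoodPair w c (one₂, ρ)
  | pc (hw : w ≠ .zero) (j : ℕ) (hj : j ≤ M.length) (ρ : Ref)
    (hρ : ρ = one₁ ∨ IsCellRef (M := M) (R := R) c ρ) :
    GoodPair w c (.prev (c.self * bw M R + pcIx R j), ρ)

theorem goodPair_of_cellTerms {w : Row} (hw : w ≠ .zero) {c : Col} {ins : Option Instr} {r : ℕ}
    (hr : r < R) {s : Bool} {p : Ref × Ref} (hp : p ∈ cellTerms M R c one₂ ins r s) :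
    GoodPair (M := M) (R := R) w c p := by
  obtain ⟨p₁, p₂⟩ := p
  obtain ⟨rfl, h | h⟩ := cellTerms_mem hr hp
  · subst h; exact .one
  · exact .prev hw _ h

/-- The block of a column has two halves: values, and variables that carry checks. A sum uses only
values and the two constants, so a check variable never occurs in a sum; this is the independence
needed to sum over the checks. -/
theorem colChecks_mem (hM : ∀ i ∈ M, i.Below R) (hR : 2 ≤ R) {w : Row} {c : Col} {ck : Check}
    (h : ck ∈ colChecks M R w c) :
    ∃ k < nk M R, ck.1 = .cur (c.self * bw M R + (nk M R + k)) ∧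
      ∀ p ∈ ck.2, GoodPair (M := M) (R := R) w c p := by
  have hcons : ∀ k < nk M R, ∀ ps, (∀ p ∈ ps, GoodPair (M := M) (R := R) w c p) →
      ∀ p ∈ (mkCheck M R c k ps).2, GoodPair (M := M) (R := R) w c p := by
    intro k hk ps hps p hp
    rcases List.mem_cons.1 hp with rfl | hp
    · exact .cur _ (Or.inl rfl) _ _ le_rfl hk
    · exact hps p hp
  rcases List.mem_append.1 h with h | h
  · obtain ⟨r, hr, h⟩ := List.mem_flatMap.1 h
    obtain ⟨s, -, h⟩ := List.mem_flatMap.1 h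
    have hr := List.mem_range.1 hr
    split_ifs at h
    · simp at h
    · rw [List.mem_singleton] at h
      subst h
      refine ⟨_, cellIx_lt hr s, rfl, hcons _ (cellIx_lt hr s) _ fun p hp => ?_⟩
      cases w with
      | zero => simp [cellSum] at hp
      | load b =>
        simp only [cellSum] at hp
        exact goodPair_of_cellTerms (by simp) hr hp
      | free =>
        cases c <;> simp only [cellSum] at hp
        · split_ifs at hp
          · simp only [List.mem_cons, List.not_mem_nil, or_false] at hp
            rcases hp with rfl | rfl
            · exact .one
            · have := GoodPair.cur (M := M) (R := R) (w := .free) (c := .first) one₂ (Or.inr rfl)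
                0 (cellIx 1 true) (by simp) (cellIx_lt (by omega) true)
              simpa using this
          · exact goodPair_of_cellTerms (by simp) hr hp
        · exact goodPair_of_cellTerms (by simp) hr hp
        · exact goodPair_of_cellTerms (by simp) hr hp
      | step =>
        obtain ⟨j, hj, hp⟩ := List.mem_flatMap.1 hp
        obtain ⟨p₁, p₂⟩ := p
        obtain ⟨h1, h2⟩ := cellTerms_mem hr hp
        dsimp only at h1 h2
        subst h1
        exact .pc (by simp) j (by have := List.mem_range.1 hj; omega) _ h2
  · obtain ⟨j, hj, rfl⟩ := List.mem_map.1 h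
    have hj : j ≤ M.length := by have := List.mem_range.1 hj; omega
    refine ⟨_, pcIx_lt hj, rfl, hcons _ (pcIx_lt hj) _ fun p hp => ?_⟩
    by_cases hw : w = .step
    · subst hw
      cases c with
      | first =>
        obtain ⟨j, hj, hp⟩ := List.mem_flatMap.1 hp
        obtain ⟨p₁, p₂⟩ := p
        obtain ⟨h1, h2⟩ := pcTerms_mem hM hp
        dsimp only at h1 h2
        subst h1
        have := GoodPair.pc (M := M) (R := R) (w := .step) (c := .first) (by simp) j
          (by have := List.mem_range.1 hj; omega) _ h2
        simpa [Col.self] using this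
      | mid =>
        have hp := List.mem_singleton.1 hp
        subst hp
        have := GoodPair.cur (M := M) (R := R) (w := .step) (c := .mid) one₂ (Or.inr rfl)
          0 _ (by simp) (pcIx_lt hj)
        simpa using this
      | last =>
        have hp := List.mem_singleton.1 hp
        subst hp
        have := GoodPair.cur (M := M) (R := R) (w := .step) (c := .last) one₂ (Or.inr rfl)
          0 _ (by simp) (pcIx_lt hj)
        simpa using this
    · have : pcSum M R w c j = if j = 0 then [(one₂, one₁)] else [] := by
        cases w <;> first | rfl | exact absurd rfl hw
      rw [this] at hp
      split_ifs at hp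
      · rw [List.mem_singleton.1 hp]; exact .one
      · simp at hp

/-- The variables that occur in the sums of the checks of a tableau with `n` rows. -/
def IsGridVar (n v : ℕ) : Prop :=
  v = 6 ∨ v = 7 ∨ ∃ t < n, ∃ i < H, ∃ k < nk M R, v = idx M R H t i k

/-- Distinctness matters because a doubly controlled phase flip needs three different qubits. A
product of a counter and a cell involves different variables since cells have offsets below `2 * R`
and counters from there on. A reference from the last column never points beyond the row. -/
theorem goodPair_val {n t i : ℕ} {w : Row} (hH : 2 ≤ H) (ht : t < n) (hi : i < H)
    {p : Ref × Ref} (hp : GoodPair (M := M) (R := R) w (colOf H i) p) {a d : ℕ}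
    (ha : a = base M R H (t - 1) + (i - 1) * bw M R) (hd : d = base M R H t + (i - 1) * bw M R) :
    IsGridVar (M := M) (R := R) (H := H) n (p.1.val a d) ∧
      IsGridVar (M := M) (R := R) (H := H) n (p.2.val a d) ∧ p.1.val a d ≠ p.2.val a d := by
  subst ha hd
  have hself : (colOf H i).self = 0 ∧ i = 0 ∨ (colOf H i).self = 1 ∧ i ≠ 0 := by
    simp only [colOf]; split_ifs <;> simp_all [Col.self]
  have hbw := nk_le_bw (M := M) (R := R)
  have hone : IsGridVar (M := M) (R := R) (H := H) n 6 := Or.inl rfl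
  have htwo : IsGridVar (M := M) (R := R) (H := H) n 7 := Or.inr (Or.inl rfl)
  have hcell : w ≠ .zero → ∀ ρ, IsCellRef (M := M) (R := R) (colOf H i) ρ → ∃ i' < H, ∃ k < 2 * R,
      ρ.val (base M R H (t - 1) + (i - 1) * bw M R) (base M R H t + (i - 1) * bw M R) =
        idx M R H (t - 1) i' k := by
    rintro hwz ρ ⟨δ, k, rfl, hk, hδ, hlast⟩
    refine ⟨i - 1 + δ, ?_, k, hk, ?_⟩
    · by_cases hl : i + 1 = H ∧ i ≠ 0
      · have : colOf H i = .last := by simp [colOf, hl]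
        have := hlast this
        omega
      · omega
    · simp only [Ref.val_prev, idx]; ring
  have hk2 : ∀ k < 2 * R, k < nk M R := fun k hk => by unfold nk; omega
  have hvar : ∀ t' i' k', t' < n → i' < H → k' < nk M R →
      IsGridVar (M := M) (R := R) (H := H) n (idx M R H t' i' k') :=
    fun t' i' k' h1 h2 h3 => Or.inr (Or.inr ⟨t', h1, i', h2, k', h3, rfl⟩)
  cases hp with
  | one => exact ⟨htwo, hone, by simp⟩
  | cur ρ hρ δ k hδ hk =>
    have hv : (Ref.cur (δ * bw M R + k)).val (base M R H (t - 1) + (i - 1) * bw M R)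
        (base M R H t + (i - 1) * bw M R) = idx M R H t (i - 1 + δ) k := by
      simp only [Ref.val_cur, idx]; ring
    have h10 := ten_le_idx (M := M) (R := R) (H := H) t (i - 1 + δ) k
    dsimp only
    rw [hv]
    refine ⟨?_, hvar _ _ _ ht (by omega) hk, ?_⟩
    · rcases hρ with rfl | rfl
      · exact hone
      · exact htwo
    · rcases hρ with rfl | rfl <;> simp only [Ref.val_glob] <;> omega
  | prev hw' ρ hρ =>
    obtain ⟨i', hi', k, hk, hv⟩ := hcell hw' ρ hρ
    have h10 := ten_le_idx (M := M) (R := R) (H := H) (t - 1) i' k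
    dsimp only
    rw [hv]
    exact ⟨htwo, hvar _ _ _ (by omega) hi' (hk2 _ hk), by simp only [Ref.val_glob]; omega⟩
  | pc hw' j hj ρ hρ =>
    have hv : (Ref.prev ((colOf H i).self * bw M R + pcIx R j)).val
        (base M R H (t - 1) + (i - 1) * bw M R) (base M R H t + (i - 1) * bw M R) =
        idx M R H (t - 1) i (pcIx R j) := by
      have : i - 1 + (colOf H i).self = i := by omega
      rw [Ref.val_prev, idx, ← this, Nat.add_mul, this]; ring
    have h10 := ten_le_idx (M := M) (R := R) (H := H) (t - 1) i (pcIx R j)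
    have hj' := pcIx_lt (R := R) hj
    dsimp only
    rw [hv]
    refine ⟨hvar _ _ _ (by omega) hi hj', ?_⟩
    rcases hρ with rfl | hρ
    · exact ⟨hone, by simp only [Ref.val_glob]; omega⟩
    · obtain ⟨i', hi', k, hk, hv'⟩ := hcell hw' ρ hρ
      rw [hv']
      refine ⟨hvar _ _ _ (by omega) hi' (hk2 _ hk), fun h => ?_⟩
      have := (idx_injective hi hi' (hj'.trans_le hbw) ((hk2 _ hk).trans_le hbw) h).2.2
      unfold pcIx at this
      omega

end Variables

/-! ### From the rows to the whole tableau -/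

section Grid

variable {M : Machine} {R H : ℕ}

theorem rowChecks_mem {t : ℕ} {w : Row} {c : PlacedCheck}
    (h : c ∈ rowChecks M R H (base M R H (t - 1)) (base M R H t) w) :
    ∃ i < H, c.1 = base M R H (t - 1) + (i - 1) * bw M R ∧
      c.2.1 = base M R H t + (i - 1) * bw M R ∧ c.2.2 ∈ colChecks M R w (colOf H i) := by
  obtain ⟨i, hi, h⟩ := List.mem_flatMap.1 h
  obtain ⟨c, hc, rfl⟩ := List.mem_map.1 h
  exact ⟨i, List.mem_range.1 hi, rfl, rfl, hc⟩

theorem gridChecks_mem {ws : List Row} {c : PlacedCheck} (h : c ∈ gridChecks M R H ws) :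
    ∃ t < ws.length, ∃ i < H, c.1 = base M R H (t - 1) + (i - 1) * bw M R ∧
      c.2.1 = base M R H t + (i - 1) * bw M R ∧
      c.2.2 ∈ colChecks M R (ws.getD t .step) (colOf H i) := by
  obtain ⟨t, ht, h⟩ := List.mem_flatMap.1 h
  exact ⟨t, List.mem_range.1 ht, rowChecks_mem h⟩

theorem gridChecks_pair (hM : ∀ i ∈ M, i.Below R) (hR : 2 ≤ R) (hH : 2 ≤ H) {ws : List Row}
    {c : PlacedCheck} (h : c ∈ gridChecks M R H ws) :
    (∃ t < ws.length, ∃ i < H, ∃ k < nk M R, c.var = idx M R H t i (nk M R + k)) ∧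
    ∀ p ∈ c.2.2.2, IsGridVar (M := M) (R := R) (H := H) ws.length (p.1.val c.1 c.2.1) ∧
      IsGridVar (M := M) (R := R) (H := H) ws.length (p.2.val c.1 c.2.1) ∧
      p.1.val c.1 c.2.1 ≠ p.2.val c.1 c.2.1 := by
  obtain ⟨t, ht, i, hi, ha, hd, hc⟩ := gridChecks_mem h
  obtain ⟨k, hk, hv, hp⟩ := colChecks_mem hM hR hc
  refine ⟨⟨t, ht, i, hi, k, hk, ?_⟩, fun p hp' => goodPair_val hH ht hi (hp p hp') ha hd⟩
  rw [PlacedCheck.var, hv, Ref.val_cur, hd, pos_self, idx]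

theorem nodup_kinds (M : Machine) (R : ℕ) (w : Row) (c : Col) (H i t : ℕ)
    (hc : c = colOf H i) :
    (((colChecks M R w c).map fun k => (base M R H (t - 1) + (i - 1) * bw M R,
      base M R H t + (i - 1) * bw M R, k)).map PlacedCheck.var).Nodup := by
  subst hc
  have hinj : ∀ k k', base M R H t + (i - 1) * bw M R + ((colOf H i).self * bw M R +
      (nk M R + k)) = base M R H t + (i - 1) * bw M R + ((colOf H i).self * bw M R +
      (nk M R + k')) → k = k' := fun k k' h => by omega
  rw [List.map_map, colChecks, List.map_append, List.nodup_append]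
  refine ⟨?_, ?_, ?_⟩
  · rw [List.map_flatMap, List.nodup_flatMap]
    constructor
    · intro r _
      rw [List.map_flatMap]
      simp only [List.flatMap_cons, List.flatMap_nil, List.append_nil]
      split_ifs <;> simp [PlacedCheck.var, mkCheck, cellIx]
    · refine List.nodup_range.imp fun {r r'} hrr => ?_
      refine List.disjoint_left.2 fun v hv hv' => hrr ?_
      obtain ⟨c, hc, rfl⟩ := List.mem_map.1 hv
      obtain ⟨c', hc', hcc⟩ := List.mem_map.1 hv'
      obtain ⟨s, _, hc⟩ := List.mem_flatMap.1 hc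
      obtain ⟨s', _, hc'⟩ := List.mem_flatMap.1 hc'
      split_ifs at hc <;> split_ifs at hc' <;>
        simp only [List.mem_singleton, List.not_mem_nil] at hc hc'
      subst hc hc'
      have := hinj _ _ hcc
      unfold cellIx at this
      cases s <;> cases s' <;> simp at this <;> omega
  · rw [List.map_map]
    refine List.nodup_range.map fun j j' h => ?_
    have := hinj _ _ h
    unfold pcIx at this
    omega
  · intro v hv v' hv' hvv
    subst hvv
    obtain ⟨c, hc, rfl⟩ := List.mem_map.1 hv
    obtain ⟨r, hr, hc⟩ := List.mem_flatMap.1 hc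
    obtain ⟨s, _, hc⟩ := List.mem_flatMap.1 hc
    rw [List.map_map] at hv'
    obtain ⟨j, hj, hjv⟩ := List.mem_map.1 hv'
    split_ifs at hc
    · simp at hc
    · rw [List.mem_singleton] at hc
      subst hc
      have := hinj _ _ hjv
      have := cellIx_lt_two_mul (List.mem_range.1 hr) s
      unfold pcIx at *
      omega

theorem nodup_gridChecks (hM : ∀ i ∈ M, i.Below R) (hR : 2 ≤ R) (ws : List Row) :
    ((gridChecks M R H ws).map PlacedCheck.var).Nodup := by
  have hvar : ∀ t i w, i < H → ∀ v ∈ (((colChecks M R w (colOf H i)).map fun k =>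
      (base M R H (t - 1) + (i - 1) * bw M R, base M R H t + (i - 1) * bw M R, k)).map
        PlacedCheck.var), ∃ k, nk M R + k < bw M R ∧ v = idx M R H t i (nk M R + k) := by
    intro t i w hi v hv
    rw [List.map_map] at hv
    obtain ⟨c, hc, rfl⟩ := List.mem_map.1 hv
    obtain ⟨k, hk, hv, -⟩ := colChecks_mem hM hR hc
    refine ⟨k, by unfold bw; omega, ?_⟩
    simp only [Function.comp_apply, PlacedCheck.var]
    rw [hv, Ref.val_cur, pos_self, idx]
  rw [gridChecks, List.map_flatMap, List.nodup_flatMap]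
  constructor
  · intro t _
    rw [rowChecks, List.map_flatMap, List.nodup_flatMap]
    constructor
    · intro i _
      exact nodup_kinds M R _ _ H i t rfl
    · refine List.nodup_range.imp_of_mem fun {i i'} hi hi' hne => ?_
      refine List.disjoint_left.2 fun v hv hv' => hne ?_
      obtain ⟨k, hk, h1⟩ := hvar t i _ (List.mem_range.1 hi) v hv
      obtain ⟨k', hk', h2⟩ := hvar t i' _ (List.mem_range.1 hi') v hv'
      exact (idx_injective (List.mem_range.1 hi) (List.mem_range.1 hi') hk hk' (h1 ▸ h2)).2.1
  · refine List.nodup_range.imp fun {t t'} hne => ?_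
    refine List.disjoint_left.2 fun v hv hv' => hne ?_
    simp only [rowChecks, List.map_flatMap] at hv hv'
    obtain ⟨i, hi, hv⟩ := List.mem_flatMap.1 hv
    obtain ⟨i', hi', hv'⟩ := List.mem_flatMap.1 hv'
    obtain ⟨k, hk, h1⟩ := hvar t i _ (List.mem_range.1 hi) v hv
    obtain ⟨k', hk', h2⟩ := hvar t' i' _ (List.mem_range.1 hi') v hv'
    exact (idx_injective (List.mem_range.1 hi) (List.mem_range.1 hi') hk hk' (h1 ▸ h2)).1

/-- The configurations that the rows describe; `y t` is the bit that the row `t` pushes if it is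
free. -/
def confAt (M : Machine) (y : ℕ → Bool) (ws : List Row) : ℕ → Config
  | 0 => nextConf (M := M) (y 0) ⟨0, fun _ => []⟩ (ws.getD 0 .step)
  | t + 1 => nextConf (M := M) (y (t + 1)) (confAt M y ws t) (ws.getD (t + 1) .step)

theorem length_effect_le (S : ℕ → List Bool) (i : Option Instr) (r : ℕ) :
    (effect S i r).length ≤ (S r).length + 1 := by
  rcases i with _ | (⟨r', b⟩ | ⟨r', e, z, o⟩ | _) <;>
    simp only [effect, Function.update_apply] <;> (try split_ifs) <;> simp_all <;> omega

theorem length_nextConf_le (b : Bool) (c : Config) (w : Row) (r : ℕ) :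
    ((nextConf (M := M) b c w).stk r).length ≤ (c.stk r).length + 1 := by
  cases w <;> simp only [nextConf, step_stk, length_effect_le]
  simp

/-- A row adds at most one bit to a stack. A tableau that is at least as wide as it has rows is
therefore never too narrow for the stacks. -/
theorem length_confAt_le (y : ℕ → Bool) (ws : List Row) (t r : ℕ) :
    ((confAt M y ws t).stk r).length ≤ t + 1 := by
  induction t with
  | zero => exact (length_nextConf_le _ _ _ r).trans (by simp)
  | succ t ih => exact (length_nextConf_le _ _ _ r).trans (by omega)

/-- The checks of the tableau are passed if and only if the tableau describes the computation. -/
theorem gridChecks_iff {z : ℕ → Bool} (hM : ∀ i ∈ M, i.Below R) (hH : 2 ≤ H) {ws : List Row}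
    (hw : ws.getD 0 .step = .zero) (hws : ws.length ≤ H) (h1 : z 6 = true) (h2 : z 7 = true) :
    (∀ c ∈ gridChecks M R H ws, c.Holds z) ↔
      ∀ t < ws.length, RowIs M R z H (base M R H t)
        (confAt M (fun t => z (base M R H t + cellIx 1 true)) ws t) := by
  set y := fun t => z (base M R H t + cellIx 1 true) with hy
  have hsat : (∀ c ∈ gridChecks M R H ws, c.Holds z) ↔ ∀ t < ws.length,
      RowSat M R z H (base M R H (t - 1)) (base M R H t) (ws.getD t .step) := by
    constructor
    · intro h t ht i hi c hc
      exact h _ (List.mem_flatMap.2 ⟨t, List.mem_range.2 ht, List.mem_flatMap.2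
        ⟨i, List.mem_range.2 hi, List.mem_map.2 ⟨c, hc, rfl⟩⟩⟩)
    · intro h c hc
      obtain ⟨t, ht, i, hi, ha, hd, hc⟩ := gridChecks_mem hc
      have := h t ht i hi _ hc
      rw [← ha, ← hd] at this
      exact this
  rw [hsat]
  -- Row 0 has itself as a formal predecessor; this is harmless because it is of kind `zero`, and it
  -- starts the induction.
  have hiff : ∀ t < ws.length, (t ≠ 0 → RowIs M R z H (base M R H (t - 1)) (confAt M y ws (t - 1))) →
      (RowSat M R z H (base M R H (t - 1)) (base M R H t) (ws.getD t .step) ↔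
        RowIs M R z H (base M R H t) (confAt M y ws t)) := by
    intro t ht hp
    rcases t with _ | t
    · exact rowSat_iff (fun h => absurd hw h) hM hH h1 h2 (by simp)
    · exact rowSat_iff (fun _ => hp (by simp)) hM hH h1 h2 fun r =>
        (length_confAt_le y ws t r).trans (by omega)
  constructor
  · intro h t
    induction t with
    | zero => intro ht; exact (hiff 0 ht (by simp)).1 (h 0 ht)
    | succ t ih => intro ht; exact (hiff _ ht fun _ => ih (by omega)).1 (h _ ht)
  · intro h t ht
    exact (hiff t ht fun h0 => h _ (by omega)).2 (h t ht)

end Grid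

/-! ### Comparison with a binary number -/

/-- The value of a list of bits, least significant bit first. -/
def bval : List Bool → ℕ
  | [] => 0
  | b :: l => b.toNat + 2 * bval l

/-- One step of the comparison of two numbers. -/
def ltStep (b v l : Bool) : Bool := if b then xor true (xor v (v && l)) else xor l (v && l)

/-- The result of the comparison of the first `j` bits of `v` with those of `ch`. -/
def ltSeq (ch : List Bool) (v : ℕ → Bool) : ℕ → Bool
  | 0 => false
  | j + 1 => ltStep (ch.getD j false) (v j) (ltSeq ch v j)

/-- The check that the comparison starts with `false`. -/
def cmpInit : Check := (.cur 1, [(one₁, .cur 0)])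

/-- The check of a step of the comparison. -/
def cmpCheck (b : Bool) : Check :=
  (.cur 5, [(one₁, .cur 4), (.cur 2, .cur 0)] ++
    if b then [(one₂, one₁), (one₁, .cur 2)] else [(one₁, .cur 0)])

/-- The checks of the steps of the comparison. -/
def cmpRest (a d : ℕ) : List Bool → List PlacedCheck
  | [] => []
  | b :: ch => (a, d, cmpCheck b) :: cmpRest a (d + 4) ch

/-- The checks of the comparison. -/
def cmpChecks (a d : ℕ) (ch : List Bool) : List PlacedCheck := (a, d, cmpInit) :: cmpRest a d ch

theorem cmpRest_mem {a d : ℕ} {ch : List Bool} {c : PlacedCheck} (h : c ∈ cmpRest a d ch) :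
    ∃ j < ch.length, c = (a, d + 4 * j, cmpCheck (ch.getD j false)) := by
  induction ch generalizing d with
  | nil => simp [cmpRest] at h
  | cons b ch ih =>
    rcases List.mem_cons.1 h with rfl | h
    · exact ⟨0, by simp, by simp⟩
    · obtain ⟨j, hj, rfl⟩ := ih h
      exact ⟨j + 1, by simpa using hj, by simp; omega⟩

theorem mem_cmpRest {a d j : ℕ} {ch : List Bool} (hj : j < ch.length) :
    (a, d + 4 * j, cmpCheck (ch.getD j false)) ∈ cmpRest a d ch := by
  induction ch generalizing d j with
  | nil => simp at hj
  | cons b ch ih =>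
    rcases j with _ | j
    · simp [cmpRest]
    · refine List.mem_cons_of_mem _ ?_
      have := ih (d := d + 4) (j := j) (by simpa using hj)
      rw [show d + 4 * (j + 1) = d + 4 + 4 * j by ring]
      simpa using this

theorem cmpChecks_iff {z : ℕ → Bool} (h1 : z 6 = true) (h2 : z 7 = true) (a d : ℕ)
    (ch : List Bool) :
    (∀ c ∈ cmpChecks a d ch, c.Holds z) ↔
      ∀ j ≤ ch.length, z (d + 4 * j) = ltSeq ch (fun j => z (d + 4 * j + 2)) j := by
  have h0 : PlacedCheck.Holds z (a, d, cmpInit) ↔ z d = false := by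
    simp [PlacedCheck.Holds, Check.Holds, cmpInit, h1]
  have hs : ∀ d b, PlacedCheck.Holds z (a, d, cmpCheck b) ↔
      z (d + 4) = ltStep b (z (d + 2)) (z d) := by
    intro d b
    simp only [PlacedCheck.Holds, Check.Holds, cmpCheck, ltStep]
    cases b <;> simp [h1, h2] <;> cases z (d + 4) <;> cases z (d + 2) <;> cases z d <;> simp
  have : (∀ c ∈ cmpChecks a d ch, c.Holds z) ↔ z d = false ∧ ∀ j < ch.length,
      z (d + 4 * (j + 1)) = ltStep (ch.getD j false) (z (d + 4 * j + 2)) (z (d + 4 * j)) := by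
    rw [cmpChecks, List.forall_mem_cons, h0]
    refine and_congr_right fun _ => ⟨fun h j hj => ?_, fun h c hc => ?_⟩
    · have := (hs _ _).1 (h _ (mem_cmpRest hj))
      rwa [add_assoc, ← mul_add_one] at this
    · obtain ⟨j, hj, rfl⟩ := cmpRest_mem hc
      rw [hs, add_assoc, ← mul_add_one]
      exact h j hj
  rw [this]
  constructor
  · rintro ⟨h0, h⟩ j
    induction j with
    | zero => intro _; simpa [ltSeq] using h0
    | succ j ih => intro hj; rw [h j hj, ltSeq, ih (by omega)]
  · intro h
    refine ⟨by simpa [ltSeq] using h 0 (by omega), fun j hj => ?_⟩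
    rw [h _ hj, ltSeq, h j (by omega)]

theorem ltSeq_congr {ch : List Bool} {v v' : ℕ → Bool} {n : ℕ} (h : ∀ j < n, v j = v' j) :
    ltSeq ch v n = ltSeq ch v' n := by
  induction n with
  | zero => rfl
  | succ n ih => rw [ltSeq, ltSeq, h n (by omega), ih fun j hj => h j (by omega)]

theorem bval_take_succ (ch : List Bool) (n : ℕ) :
    bval (ch.take (n + 1)) = bval (ch.take n) + 2 ^ n * (ch.getD n false).toNat := by
  induction ch generalizing n with
  | nil => simp [bval]
  | cons b ch ih =>
    rcases n with _ | n
    · simp [bval]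
    · have := ih n
      simp only [List.take_succ_cons, bval, this, List.getD_cons_succ, pow_succ]
      ring

/-- `ltSeq` decides v < ch, least significant bit first: at each position, different bits decide and
equal bits keep the previous result. Of all v, as many are smaller as the value of ch says. In the
induction a top bit one of ch adds all v with top bit zero, and a top bit zero excludes all v with
top bit one. -/
theorem sum_ltSeq (ch : List Bool) (n : ℕ) :
    ∑ v : Fin n → Bool, sgn (ltSeq ch (extend v) n) = 2 ^ n - 2 * (bval (ch.take n) : ℤ) := by
  induction n with
  | zero => simp [ltSeq, bval]
  | succ n ih =>
    rw [← (Fin.snocEquiv fun _ : Fin (n + 1) => Bool).sum_comp, Fintype.sum_prod_type]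
    have h1 : ∀ (b : Bool) (v : Fin n → Bool),
        ltSeq ch (extend (Fin.snocEquiv (fun _ : Fin (n + 1) => Bool) (b, v))) (n + 1) =
          ltStep (ch.getD n false) b (ltSeq ch (extend v) n) := by
      intro b v
      rw [ltSeq]
      congr 1
      · simp [extend, Fin.snocEquiv, Fin.snoc]
      · refine ltSeq_congr fun j hj => ?_
        have hj' : j < n + 1 := by omega
        simp [extend, Fin.snocEquiv, Fin.snoc, hj, hj']
    simp only [h1, Fintype.sum_bool, ltStep, bval_take_succ]
    cases hb : ch.getD n false
    · simp [ih]
      ring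
    · simp [ih]
      have : ∀ b, sgn (!b) = - sgn b := by decide
      ring

/-- The phase that compares the number of accepting computations with a number. -/
def finalTerms : List (Ref × Ref × Ref) :=
  [(one₁, one₂, .prev 1), (one₁, .prev 1, .glob 9), (one₁, .glob 8, .prev 1),
    (.glob 8, .glob 9, .prev 1), (one₁, one₂, .glob 8), (one₁, .glob 8, .cur 0)]

/-- The monomials of a list of terms at a given place. -/
def evalTerms (a d : ℕ) (ts : List (Ref × Ref × Ref)) : List (ℕ × ℕ × ℕ) :=
  ts.map fun m => (m.1.val a d, m.2.1.val a d, m.2.2.val a d)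

/-! ### The complete cubic polynomial and its variables -/

section Total

variable (M : Machine) (R H : ℕ) (ws : List Row) (ch : List Bool)

/-- All checks: those of the tableau and those of the comparison. -/
def allChecks : List PlacedCheck :=
  gridChecks M R H ws ++
    cmpChecks (base M R H (ws.length - 1)) (base M R H ws.length) ch

/-- The monomials of the final phase. -/
def finalMonos : List (ℕ × ℕ × ℕ) :=
  evalTerms (base M R H (ws.length - 1)) (base M R H ws.length + 4 * ch.length) finalTerms

/-- All monomials. -/
def allMonos : List (ℕ × ℕ × ℕ) :=
  gadget ++ (allChecks M R H ws ch).flatMap PlacedCheck.monos ++ finalMonos M R H ws ch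

/-- The number of variables. -/
def numVars : ℕ := base M R H ws.length + 4 * (ch.length + 1)

/-- The number of a variable that does not carry a check. -/
def varIx : (Fin 6 ⊕ Fin 4) ⊕ ((Fin ws.length × Fin H × Fin (nk M R)) ⊕
    (Fin (ch.length + 1) ⊕ Fin ch.length)) → ℕ
  | .inl (.inl i) => i
  | .inl (.inr i) => 6 + i
  | .inr (.inl (t, i, k)) => idx M R H t i k
  | .inr (.inr (.inl j)) => base M R H ws.length + 4 * j
  | .inr (.inr (.inr j)) => base M R H ws.length + 4 * j + 2

/-- The variables that the checks and the final phase depend on. -/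
def IsVar (v : ℕ) : Prop :=
  (6 ≤ v ∧ v < 10) ∨ (∃ t < ws.length, ∃ i < H, ∃ k < nk M R, v = idx M R H t i k) ∨
    (∃ j ≤ ch.length, v = base M R H ws.length + 4 * j) ∨
    ∃ j < ch.length, v = base M R H ws.length + 4 * j + 2

/-- The variables that carry the checks. -/
def IsCheckVar (v : ℕ) : Prop :=
  (∃ t < ws.length, ∃ i < H, ∃ k < nk M R, v = idx M R H t i (nk M R + k)) ∨
    ∃ j ≤ ch.length, v = base M R H ws.length + 4 * j + 1

variable {M R H ws ch}

theorem idx_lt_base' {t i k : ℕ} (ht : t < ws.length) (hi : i < H) (hk : k < nk M R) :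
    idx M R H t i k < base M R H ws.length := idx_lt_base ht hi (hk.trans_le nk_le_bw)

theorem ten_le_base (t : ℕ) : 10 ≤ base M R H t := by unfold base; omega

theorem IsVar.exists {v : ℕ} (h : IsVar M R H ws ch v) :
    (∃ i : Fin 4, v = varIx M R H ws ch (.inl (.inr i))) ∨
      ∃ a, v = varIx M R H ws ch (.inr a) := by
  rcases h with h | ⟨t, ht, i, hi, k, hk, rfl⟩ | ⟨j, hj, rfl⟩ | ⟨j, hj, rfl⟩
  · exact Or.inl ⟨⟨v - 6, by omega⟩, by simp [varIx]; omega⟩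
  · exact Or.inr ⟨.inl (⟨t, ht⟩, ⟨i, hi⟩, ⟨k, hk⟩), rfl⟩
  · exact Or.inr ⟨.inr (.inl ⟨j, by omega⟩), rfl⟩
  · exact Or.inr ⟨.inr (.inr ⟨j, hj⟩), rfl⟩

/-- In the tableau the two kinds of variables lie in different halves of a column; in the
comparison, check variables have offset 1 modulo 4, the others 0 or 2. Offset 3 is not used and only
doubles the sum. -/
theorem IsVar.ne {v w : ℕ} (hv : IsVar M R H ws ch v) (hw : IsCheckVar M R H ws ch w) : v ≠ w := by
  rintro rfl
  have h10 := ten_le_base (M := M) (R := R) (H := H) ws.length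
  rcases hw with ⟨t, ht, i, hi, k, hk, rfl⟩ | ⟨j, hj, rfl⟩
  · have h10' := ten_le_idx (M := M) (R := R) (H := H) t i (nk M R + k)
    have hlt := idx_lt_base (M := M) (R := R) ht hi (k := nk M R + k) (by unfold bw; omega)
    rcases hv with h | ⟨t', ht', i', hi', k', hk', h⟩ | ⟨j, hj, h⟩ | ⟨j, hj, h⟩
    · omega
    · have := (idx_injective hi hi' (by unfold bw; omega) (hk'.trans_le nk_le_bw) h).2.2
      omega
    · omega
    · omega
  · rcases hv with h | ⟨t', ht', i', hi', k', hk', h⟩ | ⟨j', hj', h⟩ | ⟨j', hj', h⟩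
    · omega
    · have := idx_lt_base' ht' hi' hk'; omega
    · omega
    · omega

theorem IsVar.lt {v : ℕ} (h : IsVar M R H ws ch v) : v < numVars M R H ws ch := by
  have h10 := ten_le_base (M := M) (R := R) (H := H) ws.length
  unfold numVars
  rcases h with h | ⟨t', ht', i', hi', k', hk', h⟩ | ⟨j', hj', h⟩ | ⟨j', hj', h⟩
  · omega
  · have := idx_lt_base' ht' hi' hk'; omega
  · omega
  · omega

theorem IsCheckVar.lt {v : ℕ} (h : IsCheckVar M R H ws ch v) :
    10 ≤ v ∧ v < numVars M R H ws ch := by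
  have h10 := ten_le_base (M := M) (R := R) (H := H) ws.length
  unfold numVars
  rcases h with ⟨t, ht, i, hi, k, hk, rfl⟩ | ⟨j, hj, rfl⟩
  · have := ten_le_idx (M := M) (R := R) (H := H) t i (nk M R + k)
    have hlt := idx_lt_base (M := M) (R := R) ht hi (k := nk M R + k) (by unfold bw; omega)
    omega
  · omega

theorem varIx_injective : Function.Injective (varIx M R H ws ch) := by
  have h10 := ten_le_base (M := M) (R := R) (H := H) ws.length
  have hidx : ∀ (t : Fin ws.length) (i : Fin H) (k : Fin (nk M R)),
      10 ≤ idx M R H t i k ∧ idx M R H t i k < base M R H ws.length :=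
    fun t i k => ⟨ten_le_idx _ _ _, idx_lt_base' t.2 i.2 k.2⟩
  rintro ((a | a) | (⟨t, i, k⟩ | (a | a))) ((b | b) | (⟨t', i', k'⟩ | (b | b))) h <;>
    simp only [varIx] at h
  case inr.inl.inr.inl =>
    obtain ⟨h1, h2, h3⟩ := idx_injective i.2 i'.2 (k.2.trans_le nk_le_bw) (k'.2.trans_le nk_le_bw) h
    rw [Fin.ext h1, Fin.ext h2, Fin.ext h3]
  all_goals first
    | (have := hidx t i k; omega)
    | (have := hidx t' i' k'; omega)
    | (exfalso; omega)
    | (congr; omega)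

theorem varIx_lt (a) : varIx M R H ws ch a < numVars M R H ws ch := by
  have h10 := ten_le_base (M := M) (R := R) (H := H) ws.length
  rcases a with (a | a) | (⟨t, i, k⟩ | (a | a)) <;> simp only [varIx, numVars]
  · omega
  · omega
  · have := idx_lt_base' t.2 i.2 k.2; omega
  · omega
  · omega

theorem cmpChecks_pair {c : PlacedCheck}
    (h : c ∈ cmpChecks (base M R H (ws.length - 1)) (base M R H ws.length) ch) :
    IsCheckVar M R H ws ch c.var ∧ ∀ p ∈ c.2.2.2, IsVar M R H ws ch (p.1.val c.1 c.2.1) ∧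
      IsVar M R H ws ch (p.2.val c.1 c.2.1) ∧ p.1.val c.1 c.2.1 ≠ p.2.val c.1 c.2.1 := by
  have h10 := ten_le_base (M := M) (R := R) (H := H) ws.length
  have h6 : IsVar M R H ws ch 6 := Or.inl (by omega)
  have h7 : IsVar M R H ws ch 7 := Or.inl (by omega)
  have hl : ∀ j ≤ ch.length, IsVar M R H ws ch (base M R H ws.length + 4 * j) :=
    fun j hj => Or.inr (Or.inr (Or.inl ⟨j, hj, rfl⟩))
  have hv : ∀ j < ch.length, IsVar M R H ws ch (base M R H ws.length + 4 * j + 2) :=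
    fun j hj => Or.inr (Or.inr (Or.inr ⟨j, hj, rfl⟩))
  rcases List.mem_cons.1 h with rfl | h
  · refine ⟨Or.inr ⟨0, by omega, rfl⟩, fun p hp => ?_⟩
    rw [List.mem_singleton.1 hp]
    exact ⟨h6, hl 0 (by omega), by simp only [Ref.val_glob, Ref.val_cur]; omega⟩
  · obtain ⟨j, hj, rfl⟩ := cmpRest_mem h
    refine ⟨Or.inr ⟨j + 1, by omega, ?_⟩, fun p hp => ?_⟩
    · simp only [PlacedCheck.var, cmpCheck, Ref.val_cur]; ring
    · have hl' := hl (j + 1) (by omega)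
      have hlj := hl j (by omega)
      have hvj := hv j hj
      dsimp only at hp ⊢
      unfold cmpCheck at hp
      split_ifs at hp <;> simp only [List.mem_append, List.mem_cons, List.not_mem_nil, or_false] at hp
      · rcases hp with (rfl | rfl) | (rfl | rfl)
        · exact ⟨h6, hl', by simp only [Ref.val_glob, Ref.val_cur]; omega⟩
        · exact ⟨hvj, hlj, by simp only [Ref.val_cur]; omega⟩
        · exact ⟨h7, h6, by simp⟩
        · exact ⟨h6, hvj, by simp only [Ref.val_glob, Ref.val_cur]; omega⟩
      · rcases hp with (rfl | rfl) | rfl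
        · exact ⟨h6, hl', by simp only [Ref.val_glob, Ref.val_cur]; omega⟩
        · exact ⟨hvj, hlj, by simp only [Ref.val_cur]; omega⟩
        · exact ⟨h6, hlj, by simp only [Ref.val_glob, Ref.val_cur]; omega⟩

theorem allChecks_pair (hM : ∀ i ∈ M, i.Below R) (hR : 2 ≤ R) (hH : 2 ≤ H) {c : PlacedCheck}
    (h : c ∈ allChecks M R H ws ch) :
    IsCheckVar M R H ws ch c.var ∧ ∀ p ∈ c.2.2.2, IsVar M R H ws ch (p.1.val c.1 c.2.1) ∧
      IsVar M R H ws ch (p.2.val c.1 c.2.1) ∧ p.1.val c.1 c.2.1 ≠ p.2.val c.1 c.2.1 := by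
  rcases List.mem_append.1 h with h | h
  · obtain ⟨⟨t, ht, i, hi, k, hk, hv⟩, hp⟩ := gridChecks_pair hM hR hH h
    have hg : ∀ v, IsGridVar (M := M) (R := R) (H := H) ws.length v → IsVar M R H ws ch v := by
      rintro v (rfl | rfl | h)
      · exact Or.inl (by omega)
      · exact Or.inl (by omega)
      · exact Or.inr (Or.inl h)
    exact ⟨Or.inl ⟨t, ht, i, hi, k, hk, hv⟩, fun p hp' =>
      ⟨hg _ (hp p hp').1, hg _ (hp p hp').2.1, (hp p hp').2.2⟩⟩
  · exact cmpChecks_pair h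

theorem nodup_allChecks (hM : ∀ i ∈ M, i.Below R) (hR : 2 ≤ R) (hH : 2 ≤ H) :
    ((allChecks M R H ws ch).map PlacedCheck.var).Nodup := by
  rw [allChecks, List.map_append, List.nodup_append]
  refine ⟨nodup_gridChecks hM hR ws, ?_, ?_⟩
  · have hrest : ∀ a d (ch : List Bool), (∀ v ∈ (cmpRest a d ch).map PlacedCheck.var, d + 5 ≤ v) ∧
        ((cmpRest a d ch).map PlacedCheck.var).Nodup := by
      intro a d ch
      induction ch generalizing d with
      | nil => simp [cmpRest]
      | cons b ch ih =>
        obtain ⟨h1, h2⟩ := ih (d + 4)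
        have hv : PlacedCheck.var (a, d, cmpCheck b) = d + 5 := rfl
        simp only [cmpRest, List.map_cons, List.nodup_cons, List.forall_mem_cons, hv]
        refine ⟨⟨le_rfl, fun v hv => ?_⟩, fun hmem => ?_, h2⟩
        · have := h1 v hv; omega
        · have := h1 _ hmem; omega
    obtain ⟨h1, h2⟩ := hrest (base M R H (ws.length - 1)) (base M R H ws.length) ch
    rw [cmpChecks, List.map_cons, List.nodup_cons]
    refine ⟨fun hmem => ?_, h2⟩
    have := h1 _ hmem
    simp only [PlacedCheck.var, cmpInit, Ref.val_cur] at this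
    omega
  · intro v hv v' hv' hvv
    subst hvv
    obtain ⟨c, hc, rfl⟩ := List.mem_map.1 hv
    obtain ⟨c', hc', hcc⟩ := List.mem_map.1 hv'
    obtain ⟨⟨t, ht, i, hi, k, hk, hv⟩, -⟩ := gridChecks_pair hM hR hH hc
    have hlt := idx_lt_base (M := M) (R := R) ht hi (k := nk M R + k) (by unfold bw; omega)
    have : base M R H ws.length ≤ c'.var := by
      rcases List.mem_cons.1 hc' with rfl | hc'
      · simp [PlacedCheck.var, cmpInit]
      · obtain ⟨j, hj, rfl⟩ := cmpRest_mem hc'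
        simp only [PlacedCheck.var, cmpCheck, Ref.val_cur]; omega
    omega

theorem finalMonos_mem (hH : 2 ≤ H) (hR : 2 ≤ R) (hws : ws ≠ []) {m : ℕ × ℕ × ℕ}
    (h : m ∈ finalMonos M R H ws ch) :
    (IsVar M R H ws ch m.1 ∧ IsVar M R H ws ch m.2.1 ∧ IsVar M R H ws ch m.2.2) ∧
      m.1 ≠ m.2.1 ∧ m.1 ≠ m.2.2 ∧ m.2.1 ≠ m.2.2 := by
  have hn : 0 < ws.length := List.length_pos_iff.2 hws
  have h10 := ten_le_base (M := M) (R := R) (H := H) ws.length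
  have h10' := ten_le_base (M := M) (R := R) (H := H) (ws.length - 1)
  have h6 : ∀ v, 6 ≤ v → v < 10 → IsVar M R H ws ch v := fun v h h' => Or.inl ⟨h, h'⟩
  have ha : IsVar M R H ws ch (base M R H (ws.length - 1) + 1) :=
    Or.inr (Or.inl ⟨ws.length - 1, by omega, 0, by omega, 1, by unfold nk; omega, by simp [idx]⟩)
  have hl : IsVar M R H ws ch (base M R H ws.length + 4 * ch.length) :=
    Or.inr (Or.inr (Or.inl ⟨_, le_rfl, rfl⟩))
  have ht : ∀ m ∈ finalMonos M R H ws ch, m ∈ [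
      (6, 7, base M R H (ws.length - 1) + 1), (6, base M R H (ws.length - 1) + 1, 9),
      (6, 8, base M R H (ws.length - 1) + 1), (8, 9, base M R H (ws.length - 1) + 1), (6, 7, 8),
      (6, 8, base M R H ws.length + 4 * ch.length)] := fun m hm => hm
  have := ht m h
  simp only [List.mem_cons, List.not_mem_nil, or_false] at this
  rcases this with rfl | rfl | rfl | rfl | rfl | rfl <;> dsimp only <;>
    refine ⟨⟨?_, ?_, ?_⟩, ?_, ?_, ?_⟩ <;> first | assumption | (apply h6 <;> omega) | omega

/-- For a check: its variable is not among the values and constants, and the two factors of a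
product are distinct by `allChecks_pair`. -/
theorem allMonos_isMono (hM : ∀ i ∈ M, i.Below R) (hR : 2 ≤ R) (hH : 2 ≤ H) (hws : ws ≠ [])
    {m : ℕ × ℕ × ℕ} (h : m ∈ allMonos M R H ws ch) : IsMono (numVars M R H ws ch) m := by
  have h10 := ten_le_base (M := M) (R := R) (H := H) ws.length
  rcases List.mem_append.1 h with h | h
  · rcases List.mem_append.1 h with h | h
    · have : ∀ m ∈ gadget, (m.1 < 10 ∧ m.2.1 < 10 ∧ m.2.2 < 10) ∧
          m.1 ≠ m.2.1 ∧ m.1 ≠ m.2.2 ∧ m.2.1 ≠ m.2.2 := by decide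
      obtain ⟨⟨h1, h2, h3⟩, h4⟩ := this m h
      refine ⟨⟨?_, ?_, ?_⟩, h4⟩ <;> unfold numVars <;> omega
    · obtain ⟨c, hc, h⟩ := List.mem_flatMap.1 h
      obtain ⟨p, hp, rfl⟩ := List.mem_map.1 h
      obtain ⟨hv, hps⟩ := allChecks_pair hM hR hH hc
      obtain ⟨h1, h2, h3⟩ := hps p hp
      exact ⟨⟨hv.lt.2, h1.lt, h2.lt⟩, (h1.ne hv).symm, (h2.ne hv).symm, h3⟩
  · obtain ⟨⟨h1, h2, h3⟩, h4⟩ := finalMonos_mem hH hR hws h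
    exact ⟨⟨h1.lt, h2.lt, h3.lt⟩, h4⟩

end Total

theorem sum_sumElim {X Y : Type*} [Fintype X] [Fintype Y] [DecidableEq X] [DecidableEq Y]
    (F : (X ⊕ Y → Bool) → ℤ) :
    ∑ a : X ⊕ Y → Bool, F a = ∑ x : X → Bool, ∑ y : Y → Bool, F (Sum.elim x y) := by
  rw [← (Equiv.sumArrowEquivProdArrow X Y Bool).symm.sum_comp, Fintype.sum_prod_type]
  rfl

theorem sum_bool_four (f : (Fin 4 → Bool) → ℤ)
    (h : ∀ u, (u 0 && u 1) = false → f u = 0) :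
    ∑ u : Fin 4 → Bool, f u = ∑ d, ∑ e, f ![true, true, d, e] := by
  rw [← Fintype.sum_prod_type']
  symm
  refine Fintype.sum_of_injective (fun p : Bool × Bool => ![true, true, p.1, p.2]) ?_ _ _ ?_ fun _ => rfl
  · rintro ⟨d, e⟩ ⟨d', e'⟩ hh
    have h2 := congrFun hh 2
    have h3 := congrFun hh 3
    simp_all
  · intro u hu
    refine h u (Bool.eq_false_iff.2 fun hc => hu ⟨(u 2, u 3), ?_⟩)
    rw [Bool.and_eq_true] at hc
    funext i
    fin_cases i <;> simp [hc]

section Total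

variable {M : Machine} {R H : ℕ} {ws : List Row} {ch : List Bool}

/-- Only the bits at free rows matter. Hence a tableau, whose other rows also have a cell at the
place of the pushed bit, determines the same run as its free bits alone. -/
theorem confAt_congr {y y' : ℕ → Bool} {t : ℕ}
    (h : ∀ t' ≤ t, ws.getD t' .step = .free → y t' = y' t') :
    confAt M y ws t = confAt M y' ws t := by
  have hn : ∀ (b b' : Bool) (c : Config) (w : Row), (w = .free → b = b') →
      nextConf (M := M) b c w = nextConf (M := M) b' c w := by
    intro b b' c w hb
    cases w <;> first | rfl | rw [hb rfl]
  induction t with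
  | zero => exact hn _ _ _ _ (h 0 le_rfl)
  | succ t ih =>
    rw [confAt, confAt, ih fun t' ht' => h t' (by omega)]
    exact hn _ _ _ _ (h _ le_rfl)

/-- The bits that describe a column of a configuration. -/
def tabBit (M : Machine) (R : ℕ) (c : Config) (i k : ℕ) : Bool :=
  if k < 2 * R then decide ((c.stk (k / 2))[i]? = some (k % 2 == 1))
  else decide (min c.pc M.length = k - 2 * R)

theorem tabBit_cellIx {c : Config} {i r : ℕ} (hr : r < R) (s : Bool) :
    tabBit M R c i (cellIx r s) = decide ((c.stk r)[i]? = some s) := by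
  rw [tabBit, if_pos (cellIx_lt_two_mul hr s)]
  have h1 : cellIx r s / 2 = r := by unfold cellIx; cases s <;> simp <;> omega
  have h2 : (cellIx r s % 2 == 1) = s := by unfold cellIx; cases s <;> simp
  rw [h1, h2]

theorem tabBit_pcIx {c : Config} {i j : ℕ} :
    tabBit M R c i (pcIx R j) = decide (min c.pc M.length = j) := by
  rw [tabBit, if_neg (by unfold pcIx; omega)]
  simp [pcIx]

theorem rowIs_iff {z : ℕ → Bool} {t : ℕ} {c : Config} :
    RowIs M R z H (base M R H t) c ↔
      ∀ i < H, ∀ k < nk M R, z (idx M R H t i k) = tabBit M R c i k := by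
  refine forall₂_congr fun i _ => ⟨fun h k hk => ?_, fun h => ⟨fun r hr s => ?_, fun j hj => ?_⟩⟩
  · by_cases hk2 : k < 2 * R
    · have := h.1 (k / 2) (by omega) (k % 2 == 1)
      have hc : cellIx (k / 2) (k % 2 == 1) = k := by
        unfold cellIx
        rcases Nat.mod_two_eq_zero_or_one k with h | h <;> simp [h] <;> omega
      rw [hc] at this
      rw [idx, this, tabBit, if_pos hk2]
    · have := h.2 (k - 2 * R) (by unfold nk at hk; omega)
      rw [pcIx, Nat.add_sub_cancel' (by omega)] at this
      rw [idx, this, tabBit, if_neg hk2]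
  · rw [← tabBit_cellIx (M := M) hr, ← h _ (cellIx_lt hr s), idx]
  · rw [← tabBit_pcIx (R := R) (i := i), ← h _ (pcIx_lt hj), idx]

theorem allChecks_holds_congr (hM : ∀ i ∈ M, i.Below R) (hR : 2 ≤ R) (hH : 2 ≤ H)
    {z z' : ℕ → Bool} (h : ∀ v, IsVar M R H ws ch v → z v = z' v) :
    (∀ c ∈ allChecks M R H ws ch, c.Holds z) ↔ ∀ c ∈ allChecks M R H ws ch, c.Holds z' := by
  refine forall₂_congr fun c hc => ?_
  unfold PlacedCheck.Holds Check.Holds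
  rw [PlacedCheck.quadSum_congr (z' := z') fun p hp => ?_]
  have := (allChecks_pair hM hR hH hc).2 p hp
  exact ⟨h _ this.1, h _ this.2.1⟩

theorem finalMonos_congr (hR : 2 ≤ R) (hH : 2 ≤ H) (hws : ws ≠ [])
    {z z' : ℕ → Bool} (h : ∀ v, IsVar M R H ws ch v → z v = z' v) :
    phase (finalMonos M R H ws ch) z = phase (finalMonos M R H ws ch) z' := by
  refine phase_congr fun m hm => ?_
  have := (finalMonos_mem hH hR hws hm).1
  exact ⟨h _ this.1, h _ this.2.1, h _ this.2.2⟩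

theorem gadget_congr {z z' : ℕ → Bool} (h : ∀ v < 8, z v = z' v) :
    phase gadget z = phase gadget z' := by
  refine phase_congr fun m hm => ?_
  have : ∀ m ∈ gadget, m.1 < 8 ∧ m.2.1 < 8 ∧ m.2.2 < 8 := by decide
  have := this m hm
  exact ⟨h _ this.1, h _ this.2.1, h _ this.2.2⟩

-- Summation over the check variables turns phases into an indicator. What is left depends only on
-- the variables listed by `varIx`; all others, the check variables and the unused ones, contribute
-- the power of two.
open Classical in
theorem cubicSum_allMonos (hM : ∀ i ∈ M, i.Below R) (hR : 2 ≤ R) (hH : 2 ≤ H) (hws : ws ≠ []) :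
    cubicSum (numVars M R H ws ch) (allMonos M R H ws ch) =
      2 ^ (numVars M R H ws ch - (10 + (ws.length * (H * nk M R) + (2 * ch.length + 1)))) *
      ∑ a, (fun z : ℕ → Bool => (if ∀ c ∈ allChecks M R H ws ch, c.Holds z then 1 else 0) *
        (phase gadget z * phase (finalMonos M R H ws ch) z))
          (Function.extend (varIx M R H ws ch) a fun _ => false) := by
  have hcard : Fintype.card ((Fin 6 ⊕ Fin 4) ⊕ ((Fin ws.length × Fin H × Fin (nk M R)) ⊕
      (Fin (ch.length + 1) ⊕ Fin ch.length))) =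
      10 + (ws.length * (H * nk M R) + (2 * ch.length + 1)) := by
    simp; ring
  rw [← hcard, ← sum_extend (varIx M R H ws ch) varIx_injective varIx_lt
    (fun z : ℕ → Bool => (if ∀ c ∈ allChecks M R H ws ch, c.Holds z then 1 else 0) *
        (phase gadget z * phase (finalMonos M R H ws ch) z))]
  · rw [cubicSum, ← sum_checks (allChecks M R H ws ch)
      (fun z => phase gadget z * phase (finalMonos M R H ws ch) z) (nodup_allChecks hM hR hH)]
    · refine Finset.sum_congr rfl fun z _ => ?_
      rw [allMonos, phase_append, phase_append]; ring
    · exact fun c hc => (allChecks_pair hM hR hH hc).1.lt.2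
    · intro c hc c' hc' p hp
      have h1 := (allChecks_pair hM hR hH hc).2 p hp
      have h2 := (allChecks_pair hM hR hH hc').1
      exact ⟨h1.1.ne h2, h1.2.1.ne h2⟩
    · intro c hc z b
      have h2 := (allChecks_pair hM hR hH hc).1
      rw [gadget_congr (z' := z), finalMonos_congr hR hH hws (z' := z)]
      · exact fun v hv => Function.update_of_ne (hv.ne h2) _ _
      · intro v hv
        refine Function.update_of_ne ?_ _ _
        have := h2.lt.1
        omega
  · intro z z' h
    have hv : ∀ v, IsVar M R H ws ch v → z v = z' v := by
      intro v hv
      rcases hv.exists with ⟨i, rfl⟩ | ⟨a, rfl⟩ <;> exact h _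
    rw [if_congr (allChecks_holds_congr hM hR hH hv) rfl rfl, finalMonos_congr hR hH hws hv,
      gadget_congr (z' := z')]
    intro v hv
    by_cases h6 : v < 6
    · exact h (.inl (.inl ⟨v, h6⟩))
    · have := h (.inl (.inr ⟨v - 6, by omega⟩))
      simp only [varIx] at this
      rwa [show 6 + (v - 6) = v by omega] at this

/-- The final phase. -/
def finalBit (d e a l : Bool) : Bool := xor (!d && a && !e) (d && !l)

/-- Modulo two the final terms are a(1 + d)(1 + e) + d(1 + l), where the factors one are the two
constants. -/
theorem phase_finalMonos {z : ℕ → Bool} (h1 : z 6 = true) (h2 : z 7 = true) :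
    phase (finalMonos M R H ws ch) z = sgn (finalBit (z 8) (z 9)
      (z (base M R H (ws.length - 1) + 1)) (z (base M R H ws.length + 4 * ch.length))) := by
  simp only [phase, finalMonos, evalTerms, finalTerms, List.map_cons, List.map_nil, List.prod_cons,
    List.prod_nil, Ref.val_glob, Ref.val_prev, Ref.val_cur, h1, h2, add_zero]
  generalize z 8 = d
  generalize z 9 = e
  generalize z (base M R H (ws.length - 1) + 1) = a
  generalize z (base M R H ws.length + 4 * ch.length) = l
  revert d e a l
  decide

/-- The bits pushed by the free rows, which are those from `s` on. -/
def freeBits (s : ℕ) {q : ℕ} (y : Fin q → Bool) (t : ℕ) : Bool :=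
  if s ≤ t then extend y (t - s) else false

/-- Whether the final configuration accepts. -/
def accepts (M : Machine) (ws : List Row) (s : ℕ) {q : ℕ} (y : Fin q → Bool) : Bool :=
  decide (((confAt M (freeBits s y) ws (ws.length - 1)).stk 0)[0]? = some true)

theorem getElem?_zero_nextConf_free {b : Bool} {c : Config} :
    ((nextConf (M := M) b c .free).stk 1)[0]? = some b := by simp [nextConf, effect]

theorem confAt_free {y : ℕ → Bool} {t : ℕ} (h : ws.getD t .step = .free) :
    ((confAt M y ws t).stk 1)[0]? = some (y t) := by
  rcases t with _ | t <;> rw [confAt, h, getElem?_zero_nextConf_free]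

open Classical in
/-- The tableaux that describe a computation correspond to the choices of the free bits. -/
theorem sum_tableau (hR : 2 ≤ R) (hH : 2 ≤ H) (hws : ws ≠ []) {s q : ℕ} (hsq : s + q ≤ ws.length)
    (hfree : ∀ t, ws.getD t .step = .free ↔ s ≤ t ∧ t < s + q)
    (P : (Fin ws.length × Fin H × Fin (nk M R) → Bool) → Prop)
    (hP : ∀ G, P G ↔ ∀ t : Fin ws.length, ∀ i : Fin H, ∀ k : Fin (nk M R), G (t, i, k) =
      tabBit M R (confAt M (fun t => if h : t < ws.length then
        G (⟨t, h⟩, ⟨0, by omega⟩, ⟨3, by unfold nk; omega⟩) else false) ws t) i k)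
    (f : Bool → ℤ) :
    ∑ G, (if P G then f (G (⟨ws.length - 1, by have := List.length_pos_iff.2 hws; omega⟩,
      ⟨0, by omega⟩, ⟨1, by unfold nk; omega⟩)) else 0) =
      ∑ y : Fin q → Bool, f (accepts M ws s y) := by
  have hn := List.length_pos_iff.2 hws
  have hlast : ∀ c : Config, tabBit M R c 0 1 = decide ((c.stk 0)[0]? = some true) := fun c =>
    tabBit_cellIx (M := M) (R := R) (r := 0) (by omega) true
  have hfst : ∀ c : Config, tabBit M R c 0 3 = decide ((c.stk 1)[0]? = some true) := fun c =>
    tabBit_cellIx (M := M) (R := R) (r := 1) (by omega) true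
  have hy : ∀ (y : Fin q → Bool) (t : ℕ), ws.getD t .step = .free →
      tabBit M R (confAt M (freeBits s y) ws t) 0 3 = freeBits s y t := by
    intro y t ht
    rw [hfst, confAt_free ht]
    cases freeBits s y t <;> simp
  symm
  -- Free bits are mapped to the tableau of their run. They can be read off again at offset 3, the
  -- indicator of `true` on stack 1, which gives injectivity. Conversely, a tableau that satisfies
  -- `P` is the image of the free bits it contains.
  refine Fintype.sum_of_injective (fun y : Fin q → Bool => fun x =>
    tabBit M R (confAt M (freeBits s y) ws x.1) x.2.1 x.2.2) ?_ _ _ ?_ ?_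
  · intro y y' h
    funext j
    have hf : ws.getD (s + j) .step = .free := (hfree _).2 ⟨by omega, by omega⟩
    have := congrFun h (⟨s + j, by omega⟩, ⟨0, by omega⟩, ⟨3, by unfold nk; omega⟩)
    dsimp only at this
    rw [hy y _ hf, hy y' _ hf] at this
    simpa [freeBits, extend] using this
  · intro G hG
    rw [if_neg]
    intro hPG
    rw [hP] at hPG
    refine hG ⟨fun j => G (⟨s + j, by omega⟩, ⟨0, by omega⟩, ⟨3, by unfold nk; omega⟩), ?_⟩
    funext ⟨t, i, k⟩
    rw [hPG t i k]
    dsimp only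
    congr 1
    refine confAt_congr fun t' ht' hf => ?_
    obtain ⟨h1, h2⟩ := (hfree t').1 hf
    have h3 : t' < ws.length := by omega
    have h4 : t' - s < q := by omega
    simp only [freeBits, h1, if_true, extend, h4, dif_pos, h3]
    congr 3
    omega
  · intro y
    dsimp only
    rw [if_pos]
    · rw [hlast]; rfl
    · rw [hP]
      intro t i k
      dsimp only
      congr 1
      refine confAt_congr fun t' ht' hf => ?_
      rw [dif_pos (by omega), hy y t' hf]

end Total

section Total

variable {M : Machine} {R H : ℕ} {ws : List Row} {ch : List Bool}

/-- The variable d selects one of two quantities. For d = 0 the sum over e is 2 - 2a; for d = 1 it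
is -2 times the sign of the comparison, and the sum of these signs over v is given by `sum_ltSeq`.
The terms free of a and of the value of ch cancel. -/
theorem sum_finalBit (a : Bool) (ch : List Bool) :
    ∑ v : Fin ch.length → Bool, ∑ d, ∑ e, sgn (finalBit d e a (ltSeq ch (extend v) ch.length)) =
      4 * (bval ch : ℤ) - 2 * 2 ^ ch.length * (a.toNat : ℤ) := by
  have h : ∀ l, ∑ d, ∑ e, sgn (finalBit d e a l) = 2 - 2 * (a.toNat : ℤ) - 2 * sgn l := by
    revert a; decide
  simp only [h, Finset.sum_sub_distrib, ← Finset.mul_sum, sum_ltSeq, Finset.sum_const,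
    Finset.card_univ, Fintype.card_fun, Fintype.card_bool, Fintype.card_fin, List.take_length,
    nsmul_eq_mul]
  push_cast
  ring

-- The variables are summed group by group. The six variables of the gadget give 16 and force both
-- constants to be one; the results of the comparison are determined by the checks; d, e and v give
-- `sum_finalBit`; and the tableaux become a sum over certificates. The factor 32 is 16 times a
-- common factor 2 of the two terms.
open Classical in
theorem sum_varIx (hM : ∀ i ∈ M, i.Below R) (hR : 2 ≤ R) (hH : 2 ≤ H) (hws : ws ≠ [])
    (hw : ws.getD 0 .step = .zero) (hlen : ws.length ≤ H) {s q : ℕ} (hsq : s + q ≤ ws.length)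
    (hfree : ∀ t, ws.getD t .step = .free ↔ s ≤ t ∧ t < s + q) :
    ∑ a, (fun z : ℕ → Bool => (if ∀ c ∈ allChecks M R H ws ch, c.Holds z then (1 : ℤ) else 0) *
        (phase gadget z * phase (finalMonos M R H ws ch) z))
          (Function.extend (varIx M R H ws ch) a fun _ => false) =
      32 * (2 ^ (q + 1) * (bval ch : ℤ) - 2 ^ ch.length *
        ((Finset.univ.filter fun y : Fin q → Bool => accepts M ws s y = true).card : ℤ)) := by
  have hn := List.length_pos_iff.2 hws
  have hk3 : 3 < nk M R := by unfold nk; omega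
  have hk1 : 1 < nk M R := by omega
  set Z := fun (g : Fin 6 → Bool) (u : Fin 4 → Bool)
    (G : Fin ws.length × Fin H × Fin (nk M R) → Bool) (l : Fin (ch.length + 1) → Bool)
    (v : Fin ch.length → Bool) => Function.extend (varIx M R H ws ch)
      (Sum.elim (Sum.elim g u) (Sum.elim G (Sum.elim l v))) fun _ => false with hZ
  have hz : ∀ g u G l v a, Z g u G l v (varIx M R H ws ch a) =
      Sum.elim (Sum.elim g u) (Sum.elim G (Sum.elim l v)) a := fun g u G l v a =>
    varIx_injective.extend_apply _ _ _
  have hzu : ∀ g u G l v (i : Fin 4), Z g u G l v (6 + i) = u i := fun g u G l v i =>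
    hz g u G l v (.inl (.inr i))
  have hzG : ∀ g u G l v (t : Fin ws.length) (i : Fin H) (k : Fin (nk M R)),
      Z g u G l v (idx M R H t i k) = G (t, i, k) := fun g u G l v t i k =>
    hz g u G l v (.inr (.inl (t, i, k)))
  have hzl : ∀ g u G l v (j : Fin (ch.length + 1)),
      Z g u G l v (base M R H ws.length + 4 * j) = l j := fun g u G l v j =>
    hz g u G l v (.inr (.inr (.inl j)))
  have hzv : ∀ g u G l v (j : Fin ch.length),
      Z g u G l v (base M R H ws.length + 4 * j + 2) = v j := fun g u G l v j =>
    hz g u G l v (.inr (.inr (.inr j)))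
  have hindep : ∀ g u G l v w, IsVar M R H ws ch w →
      Z g u G l v w = Z (fun _ => false) u G l v w := by
    intro g u G l v w hw
    rcases hw.exists with ⟨i, rfl⟩ | ⟨a, rfl⟩ <;> rw [hz, hz] <;> rfl
  set X := fun u G l v => (if ∀ c ∈ allChecks M R H ws ch, c.Holds (Z (fun _ => false) u G l v)
    then (1 : ℤ) else 0) * phase (finalMonos M R H ws ch) (Z (fun _ => false) u G l v) with hX
  have hsplit : ∀ g u G l v, (if ∀ c ∈ allChecks M R H ws ch, c.Holds (Z g u G l v)
      then (1 : ℤ) else 0) * (phase gadget (Z g u G l v) *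
        phase (finalMonos M R H ws ch) (Z g u G l v)) =
      phase gadget (Z g u G l v) * X u G l v := by
    intro g u G l v
    rw [hX, if_congr (allChecks_holds_congr hM hR hH (hindep g u G l v)) rfl rfl,
      finalMonos_congr hR hH hws (hindep g u G l v)]
    ring
  have hgad : ∀ u G l v, ∑ g, phase gadget (Z g u G l v) = if u 0 && u 1 then 16 else 0 := by
    intro u G l v
    exact sum_gadget _ _ _ (fun x i => hz x u G l v (.inl (.inl i)))
      (fun x => hzu x u G l v 0) fun x => hzu x u G l v 1
  obtain ⟨P, hP⟩ : ∃ P : (Fin ws.length × Fin H × Fin (nk M R) → Bool) → Prop, ∀ G, P G ↔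
    ∀ t : Fin ws.length, ∀ i : Fin H, ∀ k : Fin (nk M R), G (t, i, k) =
      tabBit M R (confAt M (fun t => if h : t < ws.length then
        G (⟨t, h⟩, ⟨0, by omega⟩, ⟨3, hk3⟩) else false) ws t) i k := ⟨_, fun _ => Iff.rfl⟩
  have hchecks : ∀ d e G l v, (∀ c ∈ allChecks M R H ws ch,
      c.Holds (Z (fun _ => false) ![true, true, d, e] G l v)) ↔
      P G ∧ l = fun j : Fin (ch.length + 1) => ltSeq ch (extend v) j := by
    intro d e G l v
    have h1 : Z (fun _ => false) ![true, true, d, e] G l v 6 = true := hzu _ _ _ _ _ 0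
    have h2 : Z (fun _ => false) ![true, true, d, e] G l v 7 = true := hzu _ _ _ _ _ 1
    have hconf : ∀ t < ws.length, confAt M (fun t =>
        Z (fun _ => false) ![true, true, d, e] G l v (base M R H t + cellIx 1 true)) ws t =
        confAt M (fun t => if h : t < ws.length then
          G (⟨t, h⟩, ⟨0, by omega⟩, ⟨3, hk3⟩) else false) ws t := by
      intro t ht
      refine confAt_congr fun t' ht' _ => ?_
      rw [dif_pos (by omega)]
      have := hzG (fun _ => false) ![true, true, d, e] G l v ⟨t', by omega⟩ ⟨0, by omega⟩
        ⟨3, hk3⟩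
      simpa [idx, cellIx] using this
    rw [hP, allChecks, List.forall_mem_append, gridChecks_iff hM hH hw hlen h1 h2,
      cmpChecks_iff h1 h2]
    refine and_congr ?_ ?_
    · constructor
      · intro h t i k
        have := rowIs_iff.1 (h t t.2) i i.2 k k.2
        rw [hzG, hconf t t.2] at this
        exact this
      · intro h t ht
        refine rowIs_iff.2 fun i hi k hk => ?_
        rw [hconf t ht, ← h ⟨t, ht⟩ ⟨i, hi⟩ ⟨k, hk⟩]
        exact hzG _ _ _ _ _ ⟨t, ht⟩ ⟨i, hi⟩ ⟨k, hk⟩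
    · have hv : ∀ j ≤ ch.length, ltSeq ch (fun j => Z (fun _ => false) ![true, true, d, e] G l v
          (base M R H ws.length + 4 * j + 2)) j = ltSeq ch (extend v) j := by
        intro j hj
        refine ltSeq_congr fun j' hj' => ?_
        rw [extend, dif_pos (by omega)]
        exact hzv _ _ _ _ _ ⟨j', by omega⟩
      constructor
      · intro h
        funext j
        rw [← hv j (by omega), ← h j (by omega), hzl]
      · intro h j hj
        rw [hv j hj]
        exact (hzl _ _ _ _ _ ⟨j, by omega⟩).trans (congrFun h ⟨j, by omega⟩)
  have hXv : ∀ d e G v, ∑ l, X ![true, true, d, e] G l v = if P G then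
      sgn (finalBit d e (G (⟨ws.length - 1, by omega⟩, ⟨0, by omega⟩, ⟨1, hk1⟩))
        (ltSeq ch (extend v) ch.length)) else 0 := by
    intro d e G v
    rw [Finset.sum_eq_single fun j : Fin (ch.length + 1) => ltSeq ch (extend v) j]
    · rw [hX]
      dsimp only
      rw [if_congr (hchecks d e G _ v) rfl rfl]
      by_cases hPG : P G
      · rw [if_pos ⟨hPG, rfl⟩, if_pos hPG, one_mul, phase_finalMonos (hzu _ _ _ _ _ 0)
          (hzu _ _ _ _ _ 1)]
        congr 2
        · exact hzu _ _ _ _ _ 2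
        · exact hzu _ _ _ _ _ 3
        · have := hzG (fun _ => false) ![true, true, d, e] G (fun j => ltSeq ch (extend v) j) v
            ⟨ws.length - 1, by omega⟩ ⟨0, by omega⟩ ⟨1, hk1⟩
          simpa [idx] using this
        · exact hzl _ _ _ _ _ (Fin.last _)
      · rw [if_neg fun h => hPG h.1, if_neg hPG, zero_mul]
    · intro l _ hl
      rw [hX]
      dsimp only
      rw [if_congr (hchecks d e G _ v) rfl rfl, if_neg fun h => hl h.2, zero_mul]
    · simp
  calc _ = ∑ g, ∑ u, ∑ G, ∑ l, ∑ v, phase gadget (Z g u G l v) * X u G l v := by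
        simp only [sum_sumElim, ← hsplit]
        rfl
    _ = ∑ u, ∑ G, ∑ l, ∑ v, (if u 0 && u 1 then 16 else 0) * X u G l v := by
        rw [Finset.sum_comm]
        refine Finset.sum_congr rfl fun u _ => ?_
        rw [Finset.sum_comm]
        refine Finset.sum_congr rfl fun G _ => ?_
        rw [Finset.sum_comm]
        refine Finset.sum_congr rfl fun l _ => ?_
        rw [Finset.sum_comm]
        refine Finset.sum_congr rfl fun v _ => ?_
        rw [← Finset.sum_mul, hgad]
    _ = ∑ d, ∑ e, ∑ G, ∑ v, 16 * ∑ l, X ![true, true, d, e] G l v := by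
        rw [sum_bool_four]
        · refine Finset.sum_congr rfl fun d _ => Finset.sum_congr rfl fun e _ =>
            Finset.sum_congr rfl fun G _ => ?_
          rw [Finset.sum_comm]
          simp [Finset.mul_sum]
        · intro u hu
          simp [hu]
    _ = 16 * ∑ G, if P G then (fun a => ∑ v : Fin ch.length → Bool, ∑ d, ∑ e,
          sgn (finalBit d e a (ltSeq ch (extend v) ch.length)))
          (G (⟨ws.length - 1, by omega⟩, ⟨0, by omega⟩, ⟨1, hk1⟩)) else 0 := by
        simp only [hXv, ← Finset.mul_sum]
        congr 1
        have : ∀ F : Bool → Bool → (Fin ws.length × Fin H × Fin (nk M R) → Bool) →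
            (Fin ch.length → Bool) → ℤ, ∑ d, ∑ e, ∑ G, ∑ v, F d e G v =
            ∑ G, ∑ v, ∑ d, ∑ e, F d e G v := by
          intro F
          calc _ = ∑ d, ∑ G, ∑ e, ∑ v, F d e G v :=
                Finset.sum_congr rfl fun d _ => Finset.sum_comm
            _ = ∑ G, ∑ d, ∑ e, ∑ v, F d e G v := Finset.sum_comm
            _ = ∑ G, ∑ d, ∑ v, ∑ e, F d e G v := Finset.sum_congr rfl fun G _ =>
                Finset.sum_congr rfl fun d _ => Finset.sum_comm
            _ = _ := Finset.sum_congr rfl fun G _ => Finset.sum_comm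
        rw [this]
        refine Finset.sum_congr rfl fun G _ => ?_
        by_cases hPG : P G <;> simp [hPG]
    _ = _ := by
        refine (congrArg (16 * ·) (sum_tableau hR hH hws hsq hfree P hP
          fun a => ∑ v : Fin ch.length → Bool, ∑ d, ∑ e,
            sgn (finalBit d e a (ltSeq ch (extend v) ch.length)))).trans ?_
        simp only [sum_finalBit, Finset.sum_sub_distrib, ← Finset.mul_sum, Finset.sum_const,
          Finset.card_univ, Fintype.card_fun, Fintype.card_bool, Fintype.card_fin, nsmul_eq_mul]
        have : ∑ y : Fin q → Bool, ((accepts M ws s y).toNat : ℤ) =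
            ((Finset.univ.filter fun y : Fin q → Bool => accepts M ws s y = true).card : ℤ) := by
          rw [Finset.card_filter, Nat.cast_sum]
          refine Finset.sum_congr rfl fun y _ => ?_
          cases accepts M ws s y <;> rfl
        rw [this]
        push_cast
        ring

/-- The exponential sum of all monomials compares a number with the number of accepting
computations. -/
theorem cubicSum_allMonos_eq (hM : ∀ i ∈ M, i.Below R) (hR : 2 ≤ R) (hH : 2 ≤ H) (hws : ws ≠ [])
    (hw : ws.getD 0 .step = .zero) (hlen : ws.length ≤ H) {s q : ℕ} (hsq : s + q ≤ ws.length)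
    (hfree : ∀ t, ws.getD t .step = .free ↔ s ≤ t ∧ t < s + q) :
    cubicSum (numVars M R H ws ch) (allMonos M R H ws ch) =
      2 ^ (ws.length * (H * nk M R) + 2 * ch.length + 8) *
      (2 ^ (q + 1) * (bval ch : ℤ) - 2 ^ ch.length *
        ((Finset.univ.filter fun y : Fin q → Bool => accepts M ws s y = true).card : ℤ)) := by
  rw [cubicSum_allMonos hM hR hH hws, sum_varIx hM hR hH hws hw hlen hsq hfree, ← mul_assoc]
  congr 1
  -- The summand 5 is the exponent of the factor 32 from `sum_varIx`.
  have : numVars M R H ws ch - (10 + (ws.length * (H * nk M R) + (2 * ch.length + 1))) + 5 =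
      ws.length * (H * nk M R) + 2 * ch.length + 8 := by
    have : ws.length * (H * bw M R) = 2 * (ws.length * (H * nk M R)) := by unfold bw; ring
    unfold numVars base
    rw [this]
    omega
  rw [← this, pow_add]
  norm_num

end Total

/-! ### The tableau of a verifier -/

/-- The rows for an input of the verifier, `q` bits of the certificate and `T` steps. -/
def rowsOf (x : List Bool) (q T : ℕ) : List Row :=
  .zero :: (x.reverse.map Row.load ++ (List.replicate q .free ++ List.replicate T .step))

section Rows

variable {M : Machine} {x : List Bool} {q T : ℕ}

@[simp] theorem length_rowsOf : (rowsOf x q T).length = x.length + q + T + 1 := by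
  simp [rowsOf]; omega

theorem rowsOf_load {j : ℕ} (hj : j < x.length) :
    (rowsOf x q T).getD (j + 1) .step = .load (x.reverse[j]'(by simpa)) := by
  simp only [rowsOf, List.getD_eq_getElem?_getD, List.getElem?_cons_succ]
  rw [List.getElem?_append_left (by simpa), List.getElem?_map, List.getElem?_eq_getElem (by simpa)]
  rfl

theorem rowsOf_free {j : ℕ} (hj : j < q) :
    (rowsOf x q T).getD (x.length + j + 1) .step = .free := by
  simp only [rowsOf, List.getD_eq_getElem?_getD, List.getElem?_cons_succ]
  rw [List.getElem?_append_right (by simp), List.getElem?_append_left (by simpa)]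
  simp [hj]

theorem rowsOf_step {j : ℕ} : (rowsOf x q T).getD (x.length + q + j + 1) .step = .step := by
  simp only [rowsOf, List.getD_eq_getElem?_getD, List.getElem?_cons_succ]
  rw [List.getElem?_append_right (by simp; omega), List.getElem?_append_right (by simp; omega),
    List.getElem?_replicate]
  split_ifs <;> rfl

theorem rowsOf_eq_free_iff (t : ℕ) :
    (rowsOf x q T).getD t .step = .free ↔ x.length + 1 ≤ t ∧ t < x.length + 1 + q := by
  rcases t with _ | t
  · simp [rowsOf]
  · by_cases h1 : t < x.length
    · rw [rowsOf_load h1]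
      simp; omega
    · by_cases h2 : t < x.length + q
      · obtain ⟨j, rfl⟩ : ∃ j, t = x.length + j := ⟨t - x.length, by omega⟩
        rw [rowsOf_free (by omega)]
        simp; omega
      · obtain ⟨j, rfl⟩ : ∃ j, t = x.length + q + j := ⟨t - x.length - q, by omega⟩
        rw [rowsOf_step]
        simp; omega

/-- The input is pushed starting with its last bit, so that its first bit ends up on top. -/
theorem confAt_load (y : ℕ → Bool) {j : ℕ} (hj : j ≤ x.length) :
    confAt M y (rowsOf x q T) j = start [(x.reverse.take j).reverse] := by
  induction j with
  | zero =>
    simp only [confAt, rowsOf, List.getD_cons_zero, nextConf, start, Config.mk.injEq, true_and]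
    funext r
    rcases r with _ | r <;> rfl
  | succ j ih =>
    rw [confAt, ih (by omega), rowsOf_load (by omega)]
    simp only [nextConf, effect, start, Config.mk.injEq, true_and]
    funext r
    rcases r with _ | r
    · rw [List.take_add_one, List.getElem?_eq_getElem (by simpa using hj)]
      simp
    · rw [Function.update_of_ne (by simp)]
      rfl

/-- The list of the first `j` values of `y` from `s` on, the last one first. -/
def pushed (y : ℕ → Bool) (s j : ℕ) : List Bool := ((List.range j).map fun i => y (s + i)).reverse

theorem confAt_free_rows (y : ℕ → Bool) {j : ℕ} (hj : j ≤ q) :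
    confAt M y (rowsOf x q T) (x.length + j) = start [x, pushed y (x.length + 1) j] := by
  induction j with
  | zero =>
    rw [Nat.add_zero, confAt_load y le_rfl]
    simp only [start, Config.mk.injEq, true_and]
    funext r
    rcases r with _ | _ | r <;> simp [pushed, List.take_of_length_le]
  | succ j ih =>
    rw [← Nat.add_assoc, confAt, ih (by omega), rowsOf_free (by omega)]
    simp only [nextConf, effect, start, Config.mk.injEq, true_and]
    funext r
    rcases r with _ | _ | r
    · rfl
    · simp [pushed, List.range_succ, Nat.add_right_comm]
    · rw [Function.update_of_ne (by simp)]
      rfl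

theorem confAt_step_rows (y : ℕ → Bool) (j : ℕ) :
    confAt M y (rowsOf x q T) (x.length + q + j) =
      (step noOracle M)^[j] (start [x, pushed y (x.length + 1) q]) := by
  induction j with
  | zero => exact confAt_free_rows y le_rfl
  | succ j ih =>
    rw [← Nat.add_assoc, confAt, ih, rowsOf_step, Function.iterate_succ_apply']
    rfl

/-- The certificate bit that was pushed last is on top, so the verifier sees the free bits in
reverse order. For the count this makes no difference. -/
theorem accepts_rowsOf {V : List Bool → List Bool → Bool} (y : Fin q → Bool)
    (hV : OutputsWithin noOracle M [x, List.ofFn (y ∘ Fin.rev)] T [V x (List.ofFn (y ∘ Fin.rev))]) :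
    accepts M (rowsOf x q T) (x.length + 1) y = V x (List.ofFn (y ∘ Fin.rev)) := by
  have hp : pushed (freeBits (x.length + 1) y) (x.length + 1) q = List.ofFn (y ∘ Fin.rev) := by
    refine List.ext_getElem (by simp [pushed]) fun i h1 h2 => ?_
    simp only [pushed, List.length_reverse, List.length_map, List.length_range] at h1
    have : q - 1 - i < q := by omega
    simp only [pushed, List.getElem_reverse, List.getElem_map, List.length_map, List.length_range,
      List.getElem_range, freeBits, extend, List.getElem_ofFn, Function.comp_apply]
    rw [if_pos (by omega), dif_pos (by omega)]
    congr 1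
    ext
    simp only [Fin.val_rev]
    omega
  rw [accepts, length_rowsOf, Nat.add_sub_cancel, confAt_step_rows, hp, hV.2]
  simp

theorem card_accepts {V : List Bool → List Bool → Bool}
    (hV : ∀ y : Fin q → Bool, OutputsWithin noOracle M [x, List.ofFn y] T [V x (List.ofFn y)]) :
    (Finset.univ.filter fun y : Fin q → Bool =>
      accepts M (rowsOf x q T) (x.length + 1) y = true).card =
    (Finset.univ.filter fun y : Fin q → Bool => V x (List.ofFn y) = true).card := by
  refine Finset.card_equiv (Equiv.arrowCongr Fin.revPerm (Equiv.refl Bool)) fun y => ?_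
  simp only [Finset.mem_filter, Finset.mem_univ, true_and]
  rw [accepts_rowsOf y (hV _)]
  rfl

/-- The height of the tableau. -/
abbrev hgt (x : List Bool) (q T : ℕ) : ℕ := x.length + q + T + 2

/-- The gates of a circuit without its length. -/
def gateCode (N : ℕ) (L : List (ℕ × ℕ × ℕ)) : List Bool :=
  (hadLayer N ++ L.flatMap cczGates ++ hadLayer N).flatMap RawGate.encode

theorem length_le_flatMap_encode (l : List RawGate) : l.length ≤ (l.flatMap RawGate.encode).length := by
  induction l with
  | nil => simp
  | cons g l ih =>
    have hg : 1 ≤ g.encode.length := by cases g <;> simp [RawGate.encode]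
    rw [List.flatMap_cons, List.length_append, List.length_cons]
    omega

/-- Programs write the code of a circuit on a stack, that is from its end, which reverses the order
of the monomials; signs commute. -/
theorem cubicSum_reverse (N : ℕ) (L : List (ℕ × ℕ × ℕ)) : cubicSum N L.reverse = cubicSum N L := by
  unfold cubicSum phase
  simp only [List.map_reverse, List.prod_reverse]

/-- The circuit that compares a number with the number of accepted certificates. -/
theorem exists_comparison_circuit {R : ℕ} (hM : ∀ i ∈ M, i.Below R) (hR : 2 ≤ R)
    {V : List Bool → List Bool → Bool} (ch : List Bool)
    (hV : ∀ y : Fin q → Bool, OutputsWithin noOracle M [x, List.ofFn y] T [V x (List.ofFn y)])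
    {N : ℕ} (hN : N = numVars M R (hgt x q T) (rowsOf x q T) ch)
    {G : List Bool} (hG : G = gateCode N (allMonos M R (hgt x q T) (rowsOf x q T) ch).reverse) :
    ∃ C : Circuit G.length, C.length ≤ G.length ∧ Circuit.encode C = encodeUnary G.length ++ G ∧
      N ≤ G.length ∧
      C.zeroProb * 2 ^ N = 4 * ((2 ^ (q + 1) * (bval ch : ℤ) - 2 ^ ch.length *
        ((Finset.univ.filter fun y : Fin q → Bool => V x (List.ofFn y) = true).card : ℤ) : ℤ) : ℝ) ^ 2 := by
  -- Every gate has a nonempty code and a layer has `N` gates, so the code is at least as long as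
  -- the number of variables and the number of gates. Its length can serve as the number of qubits.
  have hNG : N ≤ G.length := by
    rw [hG, gateCode]
    refine le_trans ?_ (length_le_flatMap_encode _)
    simp [hadLayer]
  obtain ⟨C, h1, h2, h3⟩ := exists_cubic_circuit hNG
    (allMonos M R (hgt x q T) (rowsOf x q T) ch).reverse fun m hm => by
      rw [hN]
      exact allMonos_isMono hM hR (by simp) (by simp [rowsOf]) (List.mem_reverse.1 hm)
  refine ⟨C, ?_, ?_, hNG, ?_⟩
  · rw [h1]
    exact (length_le_flatMap_encode _).trans (le_of_eq (by rw [hG, gateCode]))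
  · rw [Circuit.encode, h2, ← gateCode, ← hG]
  · rw [h3, cubicSum_reverse, hN, cubicSum_allMonos_eq hM hR (by simp) (by simp [rowsOf])
      (by simp [rowsOf]) (by simp) (by simp; omega : x.length + 1 + q ≤ _) rowsOf_eq_free_iff, ← hN,
      card_accepts hV]
    -- The normalization 2^{-2N} of the probability, the square of the power of two in the
    -- exponential sum, and the factor 2^N leave exactly 4.
    have hN2 : N = 2 * ((rowsOf x q T).length * (hgt x q T * nk M R) + 2 * ch.length + 6) + 2 := by
      rw [hN, numVars, base, bw]; ring
    generalize (rowsOf x q T).length * (hgt x q T * nk M R) + 2 * ch.length = e at *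
    rw [hN2, Int.cast_mul, show e + 8 = (e + 6) + 2 by omega]
    generalize e + 6 = e
    push_cast
    field_simp
    ring

end Rows

/-! ### Answers of the oracle -/

/-- The admissible answers determine the output probabilities of circuits up to a factor `2` and a
small error. -/
def EstimationProblem.Good (P : EstimationProblem) : Prop :=
  ∀ (n : ℕ) (C : Circuit n) (s : ℚ), C.length ≤ n → s ∈ P (Circuit.encode C) →
    (s : ℝ) ≤ 3 / 2 * C.zeroProb + 1 / 4 ^ n ∧ C.zeroProb ≤ 2 * s + 2 / 4 ^ n

/-- The bound ε < 1/2 enters here: 1 + ε < 3/2, and (1 - ε) p ≤ s gives p ≤ 2s. -/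
theorem good_relProblem {σ : ℕ → ℕ∞} (hσ : ∀ n : ℕ, (n : ℕ∞) ≤ σ n) {ε : ℝ} (h0 : 0 < ε)
    (h1 : ε < 1 / 2) : (RelProblem σ ε).Good := by
  intro n C s hC hs
  obtain ⟨h2, h3⟩ := hs n C (le_trans (by exact_mod_cast hC) (hσ n)) rfl
  have hp : 0 ≤ C.zeroProb := sq_nonneg _
  have h4 : (0 : ℝ) < 1 / 4 ^ n := by positivity
  have h5 : (2 : ℝ) / 4 ^ n = 2 * (1 / 4 ^ n) := by ring
  constructor <;> nlinarith

/-- The additive error is 4^{-n}. The factor 2 in the second bound costs nothing, since s + 4^{-n} ≥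
p ≥ 0. -/
theorem good_addProblem {σ : ℕ → ℕ∞} (hσ : ∀ n : ℕ, (n : ℕ∞) ≤ σ n) : (AddProblem σ).Good := by
  intro n C s hC hs
  have h2 : |C.zeroProb - s| ≤ 1 / 2 ^ (2 * n) :=
    hs n C (le_trans (by exact_mod_cast hC) (hσ n)) rfl
  rw [pow_mul, show (2 : ℝ) ^ 2 = 4 by norm_num, abs_le] at h2
  have hp : 0 ≤ C.zeroProb := sq_nonneg _
  have h5 : (2 : ℝ) / 4 ^ n = 2 * (1 / 4 ^ n) := by ring
  constructor <;> linarith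

/-- The test that tells whether an answer is large. -/
def isLarge (s : ℚ) (N q : ℕ) : Bool :=
  decide (0 < s.num ∧ s.den.size + (2 * q + 5) < s.num.natAbs.size + N)

/-- A positive number of bit length k lies between 2^{k-1} and 2^k. Comparing lengths thus locates s
2^N with respect to a threshold up to a factor 2, which is the gap between this lemma and the next
one, and no multiplication has to be programmed. -/
theorem lt_of_isLarge {s : ℚ} {N q : ℕ} (h : isLarge s N q = true) :
    (2 : ℝ) ^ (2 * q + 5) < s * 2 ^ N := by
  simp only [isLarge, decide_eq_true_eq] at h
  obtain ⟨h0, h⟩ := h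
  have hn : 2 ^ (s.num.natAbs.size - 1) ≤ s.num.natAbs :=
    Nat.lt_size.1 (by
      have : 0 < s.num.natAbs.size := Nat.size_pos.2 (by omega)
      omega)
  have hpos : 0 < s.num.natAbs.size := Nat.size_pos.2 (by omega)
  have hd : s.den < 2 ^ s.den.size := Nat.lt_size_self _
  have hs : (s : ℝ) = (s.num.natAbs : ℝ) / s.den := by
    rw [Rat.cast_def, ← Int.cast_natCast s.num.natAbs, Int.natAbs_of_nonneg h0.le]
  have hden : (0 : ℝ) < s.den := by exact_mod_cast s.den_pos
  rw [hs, div_mul_eq_mul_div, lt_div_iff₀ hden]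
  have h2 : 2 ^ (2 * q + 5) * s.den < s.num.natAbs * 2 ^ N := by
    calc 2 ^ (2 * q + 5) * s.den < 2 ^ (2 * q + 5) * 2 ^ s.den.size := by gcongr
      _ = 2 ^ (s.den.size + (2 * q + 5)) := by rw [← pow_add, Nat.add_comm]
      _ ≤ 2 ^ (s.num.natAbs.size - 1 + N) := Nat.pow_le_pow_right (by norm_num) (by omega)
      _ = 2 ^ (s.num.natAbs.size - 1) * 2 ^ N := pow_add _ _ _
      _ ≤ _ := by gcongr
  exact_mod_cast h2

theorem lt_of_not_isLarge {s : ℚ} {N q : ℕ} (h : isLarge s N q = false) :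
    (s : ℝ) * 2 ^ N < 2 ^ (2 * q + 6) := by
  simp only [isLarge, decide_eq_false_iff_not, not_and, not_lt] at h
  by_cases h0 : 0 < s.num
  · have h := h h0
    have hn : s.num.natAbs < 2 ^ s.num.natAbs.size := Nat.lt_size_self _
    have hdpos : 0 < s.den.size := Nat.size_pos.2 s.den_pos
    have hd : 2 ^ (s.den.size - 1) ≤ s.den := Nat.lt_size.1 (by omega)
    have hs : (s : ℝ) = (s.num.natAbs : ℝ) / s.den := by
      rw [Rat.cast_def, ← Int.cast_natCast s.num.natAbs, Int.natAbs_of_nonneg h0.le]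
    have hden : (0 : ℝ) < s.den := by exact_mod_cast s.den_pos
    rw [hs, div_mul_eq_mul_div, div_lt_iff₀ hden]
    have h2 : s.num.natAbs * 2 ^ N < 2 ^ (2 * q + 6) * s.den := by
      calc s.num.natAbs * 2 ^ N < 2 ^ s.num.natAbs.size * 2 ^ N := by gcongr
        _ = 2 ^ (s.num.natAbs.size + N) := (pow_add _ _ _).symm
        _ ≤ 2 ^ ((2 * q + 6) + (s.den.size - 1)) := Nat.pow_le_pow_right (by norm_num) (by omega)
        _ = 2 ^ (2 * q + 6) * 2 ^ (s.den.size - 1) := pow_add _ _ _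
        _ ≤ _ := by gcongr
    exact_mod_cast h2
  · have : (s : ℝ) ≤ 0 := by
      have : s ≤ 0 := Rat.num_nonpos.1 (not_lt.1 h0)
      exact_mod_cast this
    calc (s : ℝ) * 2 ^ N ≤ 0 := mul_nonpos_of_nonpos_of_nonneg this (by positivity)
      _ < _ := by positivity

/-- A large answer gives 6Y² + 1/2 > 32·4^q, which is impossible for Y < 2·2^q. Otherwise 4Y² <
128·4^q + 1, which is impossible for Y ≥ 6·2^q. -/
theorem isLarge_spec {s : ℚ} {n N q : ℕ} {p : ℝ} {Y : ℤ} (hY : 0 ≤ Y) (hN : 1 ≤ N) (hNn : N ≤ n)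
    (hp : p * 2 ^ N = 4 * (Y : ℝ) ^ 2) (h1 : (s : ℝ) ≤ 3 / 2 * p + 1 / 4 ^ n)
    (h2 : p ≤ 2 * s + 2 / 4 ^ n) :
    if isLarge s N q = true then 2 ^ (q + 1) ≤ Y else Y < 3 * 2 ^ (q + 1) := by
  -- After scaling by 2^N the additive error is at most 2^N / 4^n ≤ 1 / 2^n ≤ 1/2.
  have hsmall : (1 : ℝ) / 4 ^ n * 2 ^ N ≤ 1 / 2 := by
    rw [div_mul_eq_mul_div, one_mul, div_le_iff₀ (by positivity)]
    have h4 : (4 : ℝ) ^ n = 2 ^ n * 2 ^ n := by rw [← mul_pow]; norm_num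
    have ha : (2 : ℝ) ^ N ≤ 2 ^ n := pow_le_pow_right₀ (by norm_num) hNn
    have hb : (2 : ℝ) ^ 1 ≤ 2 ^ n := pow_le_pow_right₀ (by norm_num) (hN.trans hNn)
    rw [h4]
    nlinarith
  have hpos : (0 : ℝ) < 2 ^ N := by positivity
  have h1' : (s : ℝ) * 2 ^ N ≤ 6 * (Y : ℝ) ^ 2 + 1 / 2 := by nlinarith
  have h2' : 4 * (Y : ℝ) ^ 2 ≤ 2 * (s * 2 ^ N) + 1 := by
    have : (2 : ℝ) / 4 ^ n * 2 ^ N = 2 * (1 / 4 ^ n * 2 ^ N) := by ring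
    nlinarith
  have hq : (1 : ℝ) ≤ 2 ^ q := one_le_pow₀ (by norm_num)
  have e5 : (2 : ℝ) ^ (2 * q + 5) = 32 * 2 ^ q * 2 ^ q := by ring
  have e6 : (2 : ℝ) ^ (2 * q + 6) = 64 * 2 ^ q * 2 ^ q := by ring
  have hY' : (0 : ℝ) ≤ Y := by exact_mod_cast hY
  split_ifs with h
  · have := lt_of_isLarge h
    rw [e5] at this
    have : (2 : ℝ) ^ (q + 1) ≤ Y := by
      rw [pow_succ]
      by_contra hc
      push Not at hc
      nlinarith
    exact_mod_cast this
  · have := lt_of_not_isLarge (Bool.not_eq_true _ ▸ h)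
    rw [e6] at this
    have : (Y : ℝ) < 3 * 2 ^ (q + 1) := by
      rw [pow_succ]
      by_contra hc
      push Not at hc
      nlinarith
    exact_mod_cast this

/-! ### The search for a number -/

/-- The predecessor of a positive number. -/
def decBits : List Bool → List Bool
  | [] => []
  | true :: l => false :: l
  | false :: l => true :: decBits l

@[simp] theorem length_decBits (l : List Bool) : (decBits l).length = l.length := by
  induction l with
  | nil => rfl
  | cons b l ih => cases b <;> simp [decBits, ih]

theorem bval_decBits {l : List Bool} (h : 1 ≤ bval l) : bval (decBits l) + 1 = bval l := by
  induction l with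
  | nil => simp [bval] at h
  | cons b l ih =>
    cases b
    · simp only [bval, decBits, Bool.toNat_false, Bool.toNat_true] at h ⊢
      have := ih (by omega)
      omega
    · simp only [bval, decBits, Bool.toNat_false, Bool.toNat_true]
      omega

/-- One query of the search: `t` says whether the answer is large. -/
def probe (t : List Bool → Bool) (ch : List Bool) : List Bool := if t ch then decBits ch else ch

@[simp] theorem length_probe (t : List Bool → Bool) (ch : List Bool) :
    (probe t ch).length = ch.length := by unfold probe; split_ifs <;> simp

/-- A stage of the search. -/
def stage (t : List Bool → Bool) (ch : List Bool) : List Bool :=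
  probe t (probe t (probe t (false :: ch)))

@[simp] theorem length_stage (t : List Bool → Bool) (ch : List Bool) :
    (stage t ch).length = ch.length + 1 := by simp [stage]

/-- The test compares a number with a fraction of the number `f`. -/
def TestSpec (q f : ℕ) (t : List Bool → Bool) : Prop :=
  ∀ ch : List Bool, (2 : ℤ) ^ ch.length * f ≤ 2 ^ (q + 1) * bval ch →
    if t ch = true then (2 : ℤ) ^ (q + 1) ≤ 2 ^ (q + 1) * bval ch - 2 ^ ch.length * f
      else 2 ^ (q + 1) * bval ch - 2 ^ ch.length * f < (3 : ℤ) * 2 ^ (q + 1)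

/-- In units of 2^{q+1}: a large answer certifies one unit, so a decrement, which lowers the
difference by one unit, keeps it nonnegative. Any other answer puts it below 3, hence below m. -/
theorem probe_spec {q f : ℕ} {t : List Bool → Bool} (ht : TestSpec q f t) {ch : List Bool} {m : ℤ}
    (hm : 3 ≤ m) (h0 : (2 : ℤ) ^ ch.length * f ≤ 2 ^ (q + 1) * bval ch)
    (h1 : 2 ^ (q + 1) * bval ch - 2 ^ ch.length * f < (m + 1) * 2 ^ (q + 1)) :
    (2 : ℤ) ^ (probe t ch).length * f ≤ 2 ^ (q + 1) * bval (probe t ch) ∧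
      2 ^ (q + 1) * bval (probe t ch) - 2 ^ (probe t ch).length * f < m * 2 ^ (q + 1) := by
  have hpos : (0 : ℤ) < 2 ^ (q + 1) := by positivity
  have hf : (0 : ℤ) ≤ 2 ^ ch.length * f := by positivity
  have := ht ch h0
  rw [length_probe, probe]
  split_ifs at this ⊢ with h
  · have hb : 1 ≤ bval ch := by
      by_contra hc
      have : bval ch = 0 := by omega
      simp only [this, Nat.cast_zero, mul_zero] at *
      omega
    have hd : (bval ch : ℤ) = bval (decBits ch) + 1 := by exact_mod_cast (bval_decBits hb).symm
    rw [hd] at this h1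
    constructor <;> nlinarith
  · exact ⟨h0, by nlinarith⟩

/-- Appending a digit turns the bound of 3 units into 6; three probes lower it to 5, 4 and 3. -/
theorem stage_spec {q f : ℕ} {t : List Bool → Bool} (ht : TestSpec q f t) {ch : List Bool}
    (h0 : (2 : ℤ) ^ ch.length * f ≤ 2 ^ (q + 1) * bval ch)
    (h1 : 2 ^ (q + 1) * bval ch - 2 ^ ch.length * f < (3 : ℤ) * 2 ^ (q + 1)) :
    (2 : ℤ) ^ (stage t ch).length * f ≤ 2 ^ (q + 1) * bval (stage t ch) ∧
      2 ^ (q + 1) * bval (stage t ch) - 2 ^ (stage t ch).length * f < (3 : ℤ) * 2 ^ (q + 1) := by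
  have hb : (bval (false :: ch) : ℤ) = 2 * bval ch := by simp [bval]
  have hl : (2 : ℤ) ^ (false :: ch).length = 2 * 2 ^ ch.length := by rw [List.length_cons]; ring
  have a1 := probe_spec ht (ch := false :: ch) (m := 5) (by norm_num)
    (by rw [hb, hl]; nlinarith) (by rw [hb, hl]; nlinarith)
  have a2 := probe_spec ht (m := 4) (by norm_num) a1.1 (by linarith [a1.2])
  exact probe_spec ht (m := 3) le_rfl a2.1 (by linarith [a2.2])

theorem search_spec {q f : ℕ} {t : List Bool → Bool} (ht : TestSpec q f t) (hf : f ≤ 2 ^ q) :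
    bval (((stage t)^[q + 2] [true]).drop 2) = f := by
  have key : ∀ k, (2 : ℤ) ^ ((stage t)^[k] [true]).length * f ≤
      2 ^ (q + 1) * bval ((stage t)^[k] [true]) ∧
      2 ^ (q + 1) * bval ((stage t)^[k] [true]) - 2 ^ ((stage t)^[k] [true]).length * f <
        (3 : ℤ) * 2 ^ (q + 1) ∧ ((stage t)^[k] [true]).length = k + 1 := by
    intro k
    induction k with
    | zero =>
      have : (f : ℤ) ≤ 2 ^ q := by exact_mod_cast hf
      have h2 : (0 : ℤ) < 2 ^ q := by positivity
      simp only [Function.iterate_zero, id, List.length_singleton, bval, pow_succ]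
      norm_num
      constructor <;> nlinarith
    | succ k ih =>
      rw [Function.iterate_succ_apply']
      have := stage_spec ht ih.1 ih.2.1
      exact ⟨this.1, this.2, by rw [length_stage, ih.2.2]⟩
  obtain ⟨h1, h2, h3⟩ := key (q + 2)
  generalize (stage t)^[q + 2] [true] = l at *
  obtain ⟨a, b, r, rfl⟩ : ∃ a b r, l = a :: b :: r := by
    rcases l with _ | ⟨a, _ | ⟨b, r⟩⟩
    · simp at h3
    · simp at h3
    · exact ⟨a, b, r, rfl⟩
  -- With q + 3 digits the difference is 2^{q+1} (c - 4f), so the invariant reads 4f ≤ c < 4f + 3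
  -- and the two lowest digits of c can be dropped.
  rw [h3, show q + 2 + 1 = (q + 1) + 2 by ring, pow_add _ (q + 1) 2] at h1 h2
  have hp : (0 : ℤ) < 2 ^ (q + 1) := by positivity
  have h4 : (4 : ℤ) * f ≤ bval (a :: b :: r) := by
    by_contra hc
    push Not at hc
    nlinarith
  have h5 : (bval (a :: b :: r) : ℤ) < 4 * f + 3 := by
    by_contra hc
    push Not at hc
    nlinarith
  simp only [bval, List.drop_succ_cons, List.drop_zero] at *
  cases a <;> cases b <;> simp at h4 h5 <;> omega

/-! ### Programs with a fixed number of stacks -/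

/-- The contents of the stacks that are used by a program. -/
structure Regs : Type where
  r0 : List Bool := []
  r1 : List Bool := []
  r2 : List Bool := []
  r3 : List Bool := []
  r4 : List Bool := []
  r5 : List Bool := []
  r6 : List Bool := []
  r7 : List Bool := []
  r8 : List Bool := []
  r9 : List Bool := []
  r10 : List Bool := []
  r11 : List Bool := []
  r12 : List Bool := []
  r13 : List Bool := []
  r14 : List Bool := []
  r15 : List Bool := []
  r16 : List Bool := []
  r17 : List Bool := []
  r18 : List Bool := []
  r19 : List Bool := []
  r20 : List Bool := []
  r21 : List Bool := []
  r22 : List Bool := []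
  r23 : List Bool := []

namespace Regs

/-- The stacks. -/
def toStk (s : Regs) : ℕ → List Bool
  | 0 => s.r0
  | 1 => s.r1
  | 2 => s.r2
  | 3 => s.r3
  | 4 => s.r4
  | 5 => s.r5
  | 6 => s.r6
  | 7 => s.r7
  | 8 => s.r8
  | 9 => s.r9
  | 10 => s.r10
  | 11 => s.r11
  | 12 => s.r12
  | 13 => s.r13
  | 14 => s.r14
  | 15 => s.r15
  | 16 => s.r16
  | 17 => s.r17
  | 18 => s.r18
  | 19 => s.r19
  | 20 => s.r20
  | 21 => s.r21
  | 22 => s.r22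
  | 23 => s.r23
  | _ => []

/-- Change of a stack. -/
def set (s : Regs) (k : ℕ) (v : List Bool) : Regs :=
  match k with
  | 0 => { s with r0 := v }
  | 1 => { s with r1 := v }
  | 2 => { s with r2 := v }
  | 3 => { s with r3 := v }
  | 4 => { s with r4 := v }
  | 5 => { s with r5 := v }
  | 6 => { s with r6 := v }
  | 7 => { s with r7 := v }
  | 8 => { s with r8 := v }
  | 9 => { s with r9 := v }
  | 10 => { s with r10 := v }
  | 11 => { s with r11 := v }
  | 12 => { s with r12 := v }
  | 13 => { s with r13 := v }
  | 14 => { s with r14 := v }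
  | 15 => { s with r15 := v }
  | 16 => { s with r16 := v }
  | 17 => { s with r17 := v }
  | 18 => { s with r18 := v }
  | 19 => { s with r19 := v }
  | 20 => { s with r20 := v }
  | 21 => { s with r21 := v }
  | 22 => { s with r22 := v }
  | 23 => { s with r23 := v }
  | _ => s

/-- States of programs are kept as records from here on: changes of different stacks then commute by
computation, and states can be compared by unfolding. -/
theorem update_toStk (s : Regs) {k : ℕ} (hk : k < 24) (v : List Bool) :
    Function.update s.toStk k v = (s.set k v).toStk := by
  funext i
  by_cases hi : i = k
  · subst hi
    rw [Function.update_self]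
    interval_cases i <;> rfl
  · rw [Function.update_of_ne hi]
    interval_cases k <;> (unfold toStk; split <;> first | rfl | omega)

theorem toStk_eq_getD (x : List Bool) : (fun r => [x].getD r []) = Regs.toStk { r0 := x } := by
  funext r
  unfold toStk
  split <;> first
    | rfl
    | exact List.getD_eq_default _ _ (Nat.one_le_iff_ne_zero.2 (by assumption))

theorem toStk_eq_getD_two (x y : List Bool) :
    (fun r => [x, y].getD r []) = Regs.toStk { r0 := x, r1 := y } := by
  funext r
  unfold toStk
  split <;> first
    | rfl
    | have h0 : r ≠ 0 := by assumption
      have h1 : r ≠ 1 := by assumption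
      exact List.getD_eq_default _ _ (show 2 ≤ r by omega)

end Regs

namespace Runs

variable {O : List Bool → List Bool} {P Q E Z P₀ P₁ : Prog} {s s' s'' : Regs} {k l r : ℕ}
  {t : List Bool} {c₀ c₁ : Bool}

theorem pushR (s : Regs) (r : ℕ) (b : Bool) (hr : r < 24 := by norm_num) :
    Runs O (.push r b) s.toStk 1 (s.set r (b :: s.toStk r)).toStk :=
  Regs.update_toStk s hr _ ▸ Runs.push r b

theorem cs_falseR (hr : s.toStk r = false :: t) (hr' : r < 24)
    (h : Runs O Z (s.set r t).toStk k s'.toStk) : Runs O (.cs r E Z Q) s.toStk (k + 3) s'.toStk :=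
  cs_false hr (Regs.update_toStk s hr' _ ▸ h)

theorem cs_trueR (hr : s.toStk r = true :: t) (hr' : r < 24)
    (h : Runs O Q (s.set r t).toStk k s'.toStk) : Runs O (.cs r E Z Q) s.toStk (k + 3) s'.toStk :=
  cs_true hr (Regs.update_toStk s hr' _ ▸ h)

theorem wh_stopR {b : Bool} (hr : s.toStk r = b :: t) (hr' : r < 24)
    (hc : (if b then c₁ else c₀) = false)
    (h : Runs O (if b then P₁ else P₀) (s.set r t).toStk k s'.toStk) :
    Runs O (.wh r c₀ P₀ c₁ P₁) s.toStk (k + 3) s'.toStk := by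
  cases b <;> simp only [if_true, if_false, Bool.false_eq_true] at hc h <;> subst hc
  · exact wh_false_stop hr (Regs.update_toStk s hr' _ ▸ h)
  · exact wh_true_stop hr (Regs.update_toStk s hr' _ ▸ h)

theorem whR {b : Bool} {S : ℕ → List Bool} (hr : s.toStk r = b :: t) (hr' : r < 24)
    (hc : (if b then c₁ else c₀) = true)
    (h : Runs O (if b then P₁ else P₀) (s.set r t).toStk k s'.toStk)
    (h' : Runs O (.wh r c₀ P₀ c₁ P₁) s'.toStk l S) :
    Runs O (.wh r c₀ P₀ c₁ P₁) s.toStk (k + 3 + l) S := by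
  cases b <;> simp only [if_true, if_false, Bool.false_eq_true] at hc h <;> subst hc
  · exact wh_false hr (Regs.update_toStk s hr' _ ▸ h) h'
  · exact wh_true hr (Regs.update_toStk s hr' _ ▸ h) h'

/-- A loop that consumes the stack `r`. -/
theorem drain (F : ℕ → Regs) (u : List Bool) (hr' : r < 24)
    (h0 : ∀ i ≤ u.length, (F i).toStk r = u.drop i)
    (hb : ∀ i (hi : i < u.length), Runs O (if u[i] then P₁ else P₀)
      ((F i).set r (u.drop (i + 1))).toStk k (F (i + 1)).toStk) :
    Runs O (.wh r true P₀ true P₁) (F 0).toStk (u.length * (k + 3) + 1) (F u.length).toStk := by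
  suffices H : ∀ j i, i + j = u.length →
      Runs O (.wh r true P₀ true P₁) (F i).toStk (j * (k + 3) + 1) (F u.length).toStk from
    H u.length 0 (by omega)
  intro j
  induction j with
  | zero =>
    intro i hi
    obtain rfl : i = u.length := by omega
    refine (wh_nil ?_).mono (by omega)
    rw [h0 _ le_rfl, List.drop_length]
  | succ j ih =>
    intro i hi
    have hlt : i < u.length := by omega
    refine (whR ((h0 i hlt.le).trans (List.drop_eq_getElem_cons hlt)) hr' (by simp) (hb i hlt)
      (ih (i + 1) (by omega))).mono ?_
    rw [Nat.add_mul]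
    omega

end Runs

namespace Prog

/-- Moves a stack to another one, which reverses it. -/
def mv (r d : ℕ) : Prog := .wh r true (.push d false) true (.push d true)

/-- Empties a stack. -/
def clr (r : ℕ) : Prog := .wh r true .skip true .skip

/-- Runs `P₀` or `P₁` for every bit of the stack `r`, which does not change; `t` is scratch space. -/
def forEach (r t : ℕ) (P₀ P₁ : Prog) : Prog :=
  .seq (.wh r true (.seq (.push t false) P₀) true (.seq (.push t true) P₁)) (mv t r)

/-- Pushes the bit `b` `n` times. -/
def pushN (r : ℕ) (b : Bool) : ℕ → Prog
  | 0 => .skip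
  | n + 1 => .seq (.push r b) (pushN r b n)

end Prog

/-! ### Moving, clearing and traversing stacks -/

namespace Runs

open Prog

variable {O : List Bool → List Bool} {P₀ P₁ : Prog} {S : ℕ → List Bool}

theorem mv_stk {r d : ℕ} (hrd : r ≠ d) (l : List Bool) (hl : S r = l) :
    Runs O (mv r d) S (4 * l.length + 1)
      (Function.update (Function.update S r []) d (l.reverse ++ S d)) := by
  induction l generalizing S with
  | nil =>
    refine (wh_nil hl).congr (by simp) ?_
    rw [List.reverse_nil, List.nil_append, ← hl, Function.update_eq_self, Function.update_eq_self]
  | cons b l ih =>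
    have h := ih (S := Function.update (Function.update S r l) d (b :: S d))
      (by rw [Function.update_of_ne hrd, Function.update_self])
    have hd : (Function.update S r l) d = S d := Function.update_of_ne hrd.symm _ _
    refine Runs.congr (k := 1 + 3 + (4 * l.length + 1)) ?_ (by simp; omega)
      (S' := Function.update (Function.update (Function.update (Function.update S r l) d
        (b :: S d)) r []) d (l.reverse ++ (b :: S d))) ?_
    · rw [Function.update_self] at h
      cases b
      · exact wh_false hl (hd ▸ Runs.push d false) h
      · exact wh_true hl (hd ▸ Runs.push d true) h
    · funext i
      simp only [Function.update_apply]
      split_ifs <;> simp_all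

theorem mv {r d : ℕ} (s : Regs) (hrd : r ≠ d := by norm_num) (hr : r < 24 := by norm_num)
    (hd : d < 24 := by norm_num) :
    Runs O (mv r d) s.toStk (4 * (s.toStk r).length + 1)
      ((s.set r []).set d ((s.toStk r).reverse ++ s.toStk d)).toStk := by
  rw [← Regs.update_toStk _ hd, ← Regs.update_toStk _ hr]
  exact mv_stk hrd _ rfl

theorem clr {r : ℕ} (s : Regs) (hr : r < 24 := by norm_num) :
    Runs O (clr r) s.toStk (3 * (s.toStk r).length + 1) (s.set r []).toStk := by
  rw [← Regs.update_toStk _ hr]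
  suffices H : ∀ (l : List Bool) (S : ℕ → List Bool), S r = l →
      Runs O (Prog.clr r) S (3 * l.length + 1) (Function.update S r []) from H _ _ rfl
  intro l
  induction l with
  | nil =>
    intro S hl
    refine (wh_nil hl).congr (by simp) ?_
    rw [← hl, Function.update_eq_self]
  | cons b l ih =>
    intro S hl
    have h := ih (Function.update S r l) (by simp)
    rw [Function.update_idem] at h
    cases b
    · exact (wh_false hl skip h).mono (by simp; omega)
    · exact (wh_true hl skip h).mono (by simp; omega)

/-- A loop over the stack `r`, which is restored at the end. -/
theorem forEach_stk {r t k : ℕ} (hrt : r ≠ t) (F : ℕ → ℕ → List Bool) (l : List Bool)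
    (hb : ∀ i (hi : i < l.length), ∀ u v, Runs O (if l[i] then P₁ else P₀)
      (Function.update (Function.update (F i) r u) t v) k
      (Function.update (Function.update (F (i + 1)) r u) t v)) :
    Runs O (forEach r t P₀ P₁) (Function.update (Function.update (F 0) r l) t [])
      (l.length * (k + 8) + 2) (Function.update (Function.update (F l.length) r l) t []) := by
  -- The bits already read lie on `t` in reverse order; the move at the end restores `r`, at a cost
  -- of 4 more steps per bit.
  have H : ∀ j i, i + j = l.length → Runs O (.wh r true (.seq (.push t false) P₀) true
      (.seq (.push t true) P₁)) (Function.update (Function.update (F i) r (l.drop i)) t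
        (l.take i).reverse) (j * (k + 4) + 1)
        (Function.update (Function.update (F l.length) r []) t l.reverse) := by
    intro j
    induction j with
    | zero =>
      intro i hi
      obtain rfl : i = l.length := by omega
      rw [List.take_length, List.drop_length]
      refine (wh_nil ?_).mono (by omega)
      rw [Function.update_of_ne hrt, Function.update_self]
    | succ j ih =>
      intro i hi
      have hlt : i < l.length := by omega
      have h1 : (Function.update (Function.update (F i) r (l.drop i)) t (l.take i).reverse) r =
          l[i] :: l.drop (i + 1) := by
        rw [Function.update_of_ne hrt, Function.update_self, List.drop_eq_getElem_cons hlt]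
      have h2 : Function.update (Function.update (Function.update (F i) r (l.drop i)) t
          (l.take i).reverse) r (l.drop (i + 1)) =
          Function.update (Function.update (F i) r (l.drop (i + 1))) t (l.take i).reverse := by
        rw [Function.update_comm hrt.symm, Function.update_idem]
      have h3 : Function.update (Function.update (Function.update (F i) r (l.drop (i + 1))) t
          (l.take i).reverse) t (l[i] :: (Function.update (Function.update (F i) r
            (l.drop (i + 1))) t (l.take i).reverse) t) =
          Function.update (Function.update (F i) r (l.drop (i + 1))) t (l.take (i + 1)).reverse := by
        rw [Function.update_idem, Function.update_self, List.take_succ_eq_append_getElem hlt,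
          List.reverse_append]
        rfl
      have h4 := (Runs.push (O := O) t l[i]).seq (h3 ▸ hb i hlt (l.drop (i + 1))
        (l.take (i + 1)).reverse)
      rw [← h2] at h4
      have h5 := ih (i + 1) (by omega)
      have hk : 1 + k + 3 + (j * (k + 4) + 1) ≤ (j + 1) * (k + 4) + 1 := by
        rw [Nat.add_mul]; omega
      cases hli : l[i] <;> rw [hli] at h1 h4
      · exact (wh_false h1 h4 h5).mono hk
      · exact (wh_true h1 h4 h5).mono hk
  have h1 := H l.length 0 (by omega)
  have h2 := mv_stk (O := O) (S := Function.update (Function.update (F l.length) r []) t l.reverse)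
    hrt.symm l.reverse (by simp)
  refine (h1.seq h2).congr ?_ ?_
  · rw [List.length_reverse]
    have : l.length * (k + 8) = l.length * (k + 4) + 4 * l.length := by ring
    omega
  · funext i
    simp only [Function.update_apply]
    split_ifs <;> simp_all

theorem forEach {r t k : ℕ} (F : ℕ → Regs) (l : List Bool) (hrt : r ≠ t) (hr : r < 24) (ht : t < 24)
    (hb : ∀ i (hi : i < l.length), ∀ u v, Runs O (if l[i] then P₁ else P₀)
      (((F i).set r u).set t v).toStk k (((F (i + 1)).set r u).set t v).toStk) :
    Runs O (forEach r t P₀ P₁) (((F 0).set r l).set t []).toStk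
      (l.length * (k + 8) + 2) (((F l.length).set r l).set t []).toStk := by
  simp only [← Regs.update_toStk _ ht, ← Regs.update_toStk _ hr] at hb ⊢
  exact forEach_stk hrt (fun i => (F i).toStk) l hb

theorem pushN_stk (r : ℕ) (b : Bool) (n : ℕ) (S : ℕ → List Bool) :
    Runs O (pushN r b n) S n (Function.update S r (List.replicate n b ++ S r)) := by
  induction n generalizing S with
  | zero =>
    refine skip.congr le_rfl ?_
    rw [List.replicate_zero, List.nil_append, Function.update_eq_self]
  | succ n ih =>
    refine ((Runs.push r b).seq (ih _)).congr (by omega) ?_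
    rw [Function.update_idem, Function.update_self, List.replicate_succ', List.append_assoc]
    rfl

theorem pushN {r : ℕ} (s : Regs) (b : Bool) (n : ℕ) (hr : r < 24 := by norm_num) :
    Runs O (pushN r b n) s.toStk n (s.set r (List.replicate n b ++ s.toStk r)).toStk := by
  rw [← Regs.update_toStk _ hr]
  exact pushN_stk r b n _

/-- Pushes a bit for every bit of another stack. -/
theorem forEach_push {r t d : ℕ} (s : Regs) (ht : s.toStk t = []) (n : ℕ)
    (hrt : r ≠ t := by norm_num) (hrd : r ≠ d := by norm_num) (htd : t ≠ d := by norm_num)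
    (hd : d < 24 := by norm_num) :
    Runs O (.forEach r t (.pushN d true n) (.pushN d true n)) s.toStk
      ((s.toStk r).length * (n + 8) + 2)
      (s.set d (List.replicate ((s.toStk r).length * n) true ++ s.toStk d)).toStk := by
  rw [← Regs.update_toStk _ hd]
  generalize hl : s.toStk r = l
  have := forEach_stk (O := O) (P₀ := .pushN d true n) (P₁ := .pushN d true n) (k := n) hrt
    (fun i => Function.update s.toStk d (List.replicate (i * n) true ++ s.toStk d)) l (by
      intro i hi u v
      rw [ite_self]
      refine (pushN_stk d true n _).congr le_rfl ?_
      funext j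
      have hrep : List.replicate ((i + 1) * n) true =
          List.replicate n true ++ List.replicate (i * n) true := by
        rw [← List.replicate_add]; congr 1; ring
      rw [hrep, List.append_assoc]
      simp only [Function.update_apply]
      split_ifs <;> simp_all)
  refine Runs.congr (S' := Function.update (Function.update (Function.update s.toStk d
    (List.replicate (l.length * n) true ++ s.toStk d)) r l) t []) ?_ le_rfl ?_
  · convert this using 1
    funext j
    simp only [Function.update_apply]
    split_ifs <;> simp_all
  · funext j
    simp only [Function.update_apply]
    split_ifs <;> simp_all

end Runs

open Polynomial (C X)

theorem eval_le_eval (p : Polynomial ℕ) {a b : ℕ} (h : a ≤ b) : p.eval a ≤ p.eval b := by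
  simp only [Polynomial.eval_eq_sum, Polynomial.sum]
  exact Finset.sum_le_sum fun i _ => Nat.mul_le_mul_left _ (Nat.pow_le_pow_left h i)

/-- A step lengthens a stack by at most one bit, except for the answer tape. Running times thus
bound the lengths of results about which nothing else is known. -/
theorem Runs.length_le {O : List Bool → List Bool} {P : Prog} {S S' : ℕ → List Bool} {k : ℕ}
    (h : Runs O P S k S') {r : ℕ} (hr : r ≠ 3) : (S' r).length ≤ (S r).length + k := by
  obtain ⟨t, ht, h⟩ := h (P.compile 0) 0 ⟨[], [], by simp, rfl⟩
  have key : ∀ (M : Machine) (c : Config) (t : ℕ),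
      (((step O M)^[t] c).stk r).length ≤ (c.stk r).length + t := by
    intro M c t
    induction t with
    | zero => simp
    | succ t ih =>
      rw [Function.iterate_succ_apply']
      generalize (step O M)^[t] c = c' at *
      refine le_trans ?_ (Nat.succ_le_succ ih)
      unfold step
      cases M[c'.pc]? with
      | none => simp
      | some i =>
        cases i with
        | push r' b =>
          simp only [Instr.exec, Function.update_apply]
          split_ifs with h <;> simp_all
        | pop r' e z o =>
          simp only [Instr.exec]
          split <;> simp only [Function.update_apply] <;> (try split_ifs) <;> simp_all <;> omega
        | ask =>
          simp only [Instr.exec, Function.update_apply]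
          split_ifs <;> simp_all
  have := key (P.compile 0) ⟨0, S⟩ t
  rw [h] at this
  simp only at this
  omega

/-- Polynomials can be evaluated in unary. -/
theorem exists_unary_polynomial (p : Polynomial ℕ) :
    ∃ (Q : Prog) (c : Polynomial ℕ), ∀ (O : List Bool → List Bool) (s : Regs), s.r1 = [] →
      s.r14 = [] → s.r15 = [] → Runs O Q s.toStk (c.eval s.r0.length)
        (s.set 14 (List.replicate (p.eval s.r0.length) true)).toStk := by
  induction p using Polynomial.recOnHorner with
  | M0 =>
    refine ⟨.skip, 0, fun O s h1 h14 h15 => Runs.skip.congr (by simp) ?_⟩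
    simp only [Polynomial.eval_zero, List.replicate_zero, ← h14]
    rfl
  | MC p a _ _ ih =>
    obtain ⟨Q, c, h⟩ := ih
    refine ⟨.seq Q (.pushN 14 true a), c + C a, fun O s h1 h14 h15 => ?_⟩
    refine ((h O s h1 h14 h15).seq (Runs.pushN _ true a)).congr (by simp) ?_
    simp only [Regs.set, Regs.toStk, Polynomial.eval_add, Polynomial.eval_C, ← List.replicate_add]
    rw [Nat.add_comm]
  | MX p _ ih =>
    obtain ⟨Q, c, h⟩ := ih
    -- Horner's scheme in unary: multiplication by the variable means appending one copy of the
    -- input length for every unit of the previous value.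
    refine ⟨.seq Q (.seq (.mv 14 15) (.wh 15 true (.forEach 0 1 (.pushN 14 true 1) (.pushN 14 true 1))
      true (.forEach 0 1 (.pushN 14 true 1) (.pushN 14 true 1)))),
      c + (C 4 * p + C 1 + (p * (X * C 9 + C 5) + C 1)), fun O s h1 h14 h15 => ?_⟩
    set e := p.eval s.r0.length with he
    have hd := Runs.drain (O := O) (r := 15) (k := s.r0.length * 9 + 2)
      (P₀ := .forEach 0 1 (.pushN 14 true 1) (.pushN 14 true 1))
      (P₁ := .forEach 0 1 (.pushN 14 true 1) (.pushN 14 true 1))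
      (fun i => { s with
        r14 := List.replicate (s.r0.length * i) true
        r15 := (List.replicate e true).drop i }) (List.replicate e true) (by norm_num)
      (fun _ _ => rfl) (by
        intro i hi
        rw [ite_self]
        have := Runs.forEach_push (O := O) (r := 0) (t := 1) (d := 14) { s with
          r14 := List.replicate (s.r0.length * i) true
          r15 := (List.replicate e true).drop (i + 1) } h1 1
        refine this.congr le_rfl ?_
        simp only [Regs.set, Regs.toStk, mul_one, ← List.replicate_add]
        rw [Nat.mul_succ, Nat.add_comm])
    have hm : Runs O (.mv 14 15) { s with r14 := List.replicate e true }.toStk (4 * e + 1)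
        { s with r14 := [], r15 := List.replicate e true }.toStk :=
      (Runs.mv _).congr (by simp [Regs.toStk]) (by simp [Regs.set, Regs.toStk, h15])
    refine ((h O s h1 h14 h15).seq (hm.seq hd)).congr ?_ ?_
    · simp only [Polynomial.eval_add, Polynomial.eval_mul, Polynomial.eval_C, Polynomial.eval_X,
        ← he, List.length_replicate]
      exact le_rfl
    · rw [Polynomial.eval_mul, Polynomial.eval_X, ← he, List.length_replicate,
        List.drop_of_length_le (by simp), h15.symm, Nat.mul_comm]
      rfl

open Polynomial (C X)

/-! ### Writing the gates of a circuit -/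

/-- The code of the gates of a list of monomials. -/
def monoCode (L : List (ℕ × ℕ × ℕ)) : List Bool := (L.flatMap cczGates).flatMap RawGate.encode

@[simp] theorem monoCode_nil : monoCode [] = [] := rfl

@[simp] theorem monoCode_append (L L' : List (ℕ × ℕ × ℕ)) :
    monoCode (L ++ L') = monoCode L ++ monoCode L' := by simp [monoCode]

namespace Prog

/-- Writes the number of a variable; the positions of the rows are on the stacks `4` and `5`. -/
def emitRef : Ref → Prog
  | .glob o => .seq (.push 2 false) (pushN 2 true o)
  | .prev o => .seq (.push 2 false) (.seq (pushN 2 true o)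
      (forEach 4 1 (pushN 2 true 1) (pushN 2 true 1)))
  | .cur o => .seq (.push 2 false) (.seq (pushN 2 true o)
      (forEach 5 1 (pushN 2 true 1) (pushN 2 true 1)))

/-- Writes the gates of a monomial. -/
def emitMono (m : Ref × Ref × Ref) : Prog :=
  .seq (.seq (emitRef m.2.2) (.push 2 false))
    (.seq (.seq (emitRef m.2.2) (.seq (emitRef m.2.1) (.seq (emitRef m.1) (.push 2 true))))
      (.seq (emitRef m.2.2) (.push 2 false)))

/-- Writes the gates of a list of monomials. -/
def emitTerms : List (Ref × Ref × Ref) → Prog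
  | [] => .skip
  | m :: ts => .seq (emitMono m) (emitTerms ts)

end Prog

/-- What is pushed last is read first, so the final `false` of the unary code comes first. -/
theorem runs_emitRef {O : List Bool → List Bool} (ρ : Ref) (s : Regs) (h1 : s.r1 = []) :
    Runs O (.emitRef ρ) s.toStk (10 * ρ.val s.r4.length s.r5.length + 3)
      (s.set 2 (encodeUnary (ρ.val s.r4.length s.r5.length) ++ s.r2)).toStk := by
  cases ρ with
  | glob o =>
    refine ((Runs.pushR s 2 false).seq (Runs.pushN _ true o)).congr (by simp; omega) ?_
    simp [Regs.set, Regs.toStk, encodeUnary]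
  | prev o =>
    refine ((Runs.pushR s 2 false).seq ((Runs.pushN _ true o).seq
      (Runs.forEach_push (r := 4) (t := 1) (d := 2) _ (by exact h1) 1))).congr ?_ ?_
    · simp only [Regs.set, Regs.toStk, Ref.val_prev]; omega
    · simp [Regs.set, Regs.toStk, encodeUnary, ← List.append_assoc]
      simp
  | cur o =>
    refine ((Runs.pushR s 2 false).seq ((Runs.pushN _ true o).seq
      (Runs.forEach_push (r := 5) (t := 1) (d := 2) _ (by exact h1) 1))).congr ?_ ?_
    · simp only [Regs.set, Regs.toStk, Ref.val_cur]; omega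
    · simp [Regs.set, Regs.toStk, encodeUnary, ← List.append_assoc]
      simp

/-- The program writes the gates of a list of monomials that depends on the positions of the rows. -/
def Emits (P : Prog) (f : ℕ → ℕ → List (ℕ × ℕ × ℕ)) : Prop :=
  ∃ p : Polynomial ℕ, ∀ (O : List Bool → List Bool) (s : Regs) (B : ℕ), s.r1 = [] →
    s.r4.length ≤ B → s.r5.length ≤ B → Runs O P s.toStk (p.eval B)
      (s.set 2 (monoCode (f s.r4.length s.r5.length).reverse ++ s.r2)).toStk

theorem emits_emitMono (m : Ref × Ref × Ref) : Emits (.emitMono m) fun a d =>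
    [(m.1.val a d, m.2.1.val a d, m.2.2.val a d)] := by
  have hval : ∀ ρ : Ref, ∃ c : ℕ, ∀ a d B, a ≤ B → d ≤ B → ρ.val a d ≤ B + c := by
    intro ρ
    cases ρ with
    | glob o => exact ⟨o, fun a d B _ _ => by simp⟩
    | prev o => exact ⟨o, fun a d B _ _ => by simpa⟩
    | cur o => exact ⟨o, fun a d B _ _ => by simpa⟩
  obtain ⟨c₁, h₁⟩ := hval m.1
  obtain ⟨c₂, h₂⟩ := hval m.2.1
  obtain ⟨c₃, h₃⟩ := hval m.2.2
  -- Five numbers are written, the target three times and each control once, at 10 steps per unit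
  -- and 3 more each; the three gate markers complete the constant 18.
  refine ⟨C 50 * X + C (10 * c₁ + 10 * c₂ + 30 * c₃ + 18), fun O s B h1 h4 h5 => ?_⟩
  have h₁ := h₁ _ _ B h4 h5
  have h₂ := h₂ _ _ B h4 h5
  have h₃ := h₃ _ _ B h4 h5
  refine (((runs_emitRef m.2.2 s h1).seq (Runs.pushR _ 2 false)).seq
    (((runs_emitRef m.2.2 _ (by exact h1)).seq ((runs_emitRef m.2.1 _ (by exact h1)).seq ((runs_emitRef m.1 _ (by exact h1)).seq
      (Runs.pushR _ 2 true)))).seq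
      ((runs_emitRef m.2.2 _ (by exact h1)).seq (Runs.pushR _ 2 false)))).congr ?_ ?_
  · simp only [Regs.set, Regs.toStk, Polynomial.eval_add, Polynomial.eval_mul, Polynomial.eval_C,
      Polynomial.eval_X]
    omega
  · simp [Regs.set, Regs.toStk, monoCode, cczGates, RawGate.encode]

theorem emits_emitTerms (ts : List (Ref × Ref × Ref)) :
    Emits (.emitTerms ts) fun a d => evalTerms a d ts := by
  induction ts with
  | nil => exact ⟨0, fun O s B _ _ _ => Runs.skip.congr (by simp) rfl⟩
  | cons m ts ih =>
    obtain ⟨p, hp⟩ := emits_emitMono m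
    obtain ⟨p', hp'⟩ := ih
    refine ⟨p + p', fun O s B h1 h4 h5 => ?_⟩
    refine ((hp O s B h1 h4 h5).seq (hp' O _ B h1 h4 h5)).congr (by simp) ?_
    simp [evalTerms, Regs.set]

/-- The terms of a list of checks. -/
def chkTerms (cs : List Check) : List (Ref × Ref × Ref) :=
  cs.flatMap fun c => c.2.map fun p => (c.1, p.1, p.2)

theorem evalTerms_chkTerms (a d : ℕ) (cs : List Check) :
    evalTerms a d (chkTerms cs) = (cs.map fun c => ((a, d, c) : PlacedCheck)).flatMap
      PlacedCheck.monos := by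
  simp only [evalTerms, chkTerms, List.map_flatMap, List.flatMap_map, List.map_map]
  rfl

section Rows

variable (M : Machine) (R : ℕ)

/-- The terms of a column. -/
def colTerms (w : Row) (c : Col) : List (Ref × Ref × Ref) := chkTerms (colChecks M R w c)

/-- Moves on by `n` columns. -/
def Prog.advance (n : ℕ) : Prog :=
  .seq (.pushN 4 true (n * bw M R)) (.pushN 5 true (n * bw M R))

/-- Writes the gates of a row. -/
def Prog.emitRow (w : Row) : Prog :=
  .seq (.emitTerms (colTerms M R w .first)) (.seq
    (.forEach 10 12 (.seq (.emitTerms (colTerms M R w .mid)) (.advance M R 1))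
      (.seq (.emitTerms (colTerms M R w .mid)) (.advance M R 1)))
    (.seq (.emitTerms (colTerms M R w .last)) (.advance M R 2)))

variable {M R}

theorem runs_advance {O : List Bool → List Bool} (n : ℕ) (s : Regs) {a d : ℕ}
    (h4 : s.r4 = List.replicate a true) (h5 : s.r5 = List.replicate d true) :
    Runs O (.advance M R n) s.toStk (2 * (n * bw M R)) ((s.set 4 (List.replicate (a + n * bw M R) true)).set 5
      (List.replicate (d + n * bw M R) true)).toStk := by
  refine ((Runs.pushN s true _).seq (Runs.pushN _ true _)).congr (by omega) ?_
  simp only [Regs.set, Regs.toStk, h4, h5, ← List.replicate_add, Nat.add_comm]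

/-- Columns 0 and 1 share their reference position. The writer therefore does not move after the
first column, moves by one after each middle column and by two at the end, in total by one row. -/
theorem monos_rowChecks (h a d : ℕ) (w : Row) :
    (rowChecks M R (h + 2) a d w).flatMap PlacedCheck.monos =
      evalTerms a d (colTerms M R w .first) ++ ((List.range h).flatMap fun i =>
        evalTerms (a + i * bw M R) (d + i * bw M R) (colTerms M R w .mid)) ++
        evalTerms (a + h * bw M R) (d + h * bw M R) (colTerms M R w .last) := by
  rw [rowChecks, List.flatMap_assoc, List.range_succ_eq_map, List.range_succ]
  simp only [colTerms, evalTerms_chkTerms, List.map_append, List.flatMap_cons, List.flatMap_append,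
    List.flatMap_map, List.map_cons, List.map_nil, List.flatMap_nil, List.append_nil,
    Nat.succ_eq_add_one, Nat.add_sub_cancel, List.append_assoc]
  congr 1
  · simp [colOf]
  congr 1
  · refine List.flatMap_congr fun i hi => ?_
    have := List.mem_range.1 hi
    rw [colOf, if_neg (by omega), if_neg (by omega)]
  · simp [colOf]

theorem runs_emitRow (w : Row) : ∃ p : Polynomial ℕ, ∀ (O : List Bool → List Bool) (s : Regs)
    (a d B : ℕ), s.r1 = [] → s.r12 = [] → s.r4 = List.replicate a true →
    s.r5 = List.replicate d true → a + (s.r10.length + 2) * bw M R ≤ B →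
    d + (s.r10.length + 2) * bw M R ≤ B → s.r10.length ≤ B →
    Runs O (.emitRow M R w) s.toStk (p.eval B) (((s.set 4
      (List.replicate (a + (s.r10.length + 2) * bw M R) true)).set 5
      (List.replicate (d + (s.r10.length + 2) * bw M R) true)).set 2
      (monoCode ((rowChecks M R (s.r10.length + 2) a d w).flatMap PlacedCheck.monos).reverse ++
        s.r2)).toStk := by
  obtain ⟨p₁, h₁⟩ := emits_emitTerms (colTerms M R w .first)
  obtain ⟨p₂, h₂⟩ := emits_emitTerms (colTerms M R w .mid)
  obtain ⟨p₃, h₃⟩ := emits_emitTerms (colTerms M R w .last)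
  refine ⟨p₁ + (X * (p₂ + C (2 * bw M R + 8)) + C 2 + (p₃ + C (4 * bw M R))),
    fun O s a d B h1 h12 h4 h5 ha hd hB => ?_⟩
  set h := s.r10.length with hh
  set out := monoCode (evalTerms a d (colTerms M R w .first)).reverse ++ s.r2 with hout
  have e₁ : Runs O (.emitTerms (colTerms M R w .first)) s.toStk (p₁.eval B)
      (s.set 2 out).toStk := by
    have := h₁ O s B h1 (by simp [h4]; omega) (by simp [h5]; omega)
    simpa only [h4, h5, List.length_replicate] using this
  set F : ℕ → Regs := fun i => ((s.set 4
    (List.replicate (a + i * bw M R) true)).set 5 (List.replicate (d + i * bw M R) true)).set 2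
    (monoCode ((List.range i).flatMap fun i =>
      evalTerms (a + i * bw M R) (d + i * bw M R) (colTerms M R w .mid)).reverse ++ out) with hF
  have hmul : ∀ i ≤ h, i * bw M R ≤ (h + 2) * bw M R := fun i hi => Nat.mul_le_mul_right _ (by omega)
  have e₂ := Runs.forEach (O := O) (r := 10) (t := 12) (k := p₂.eval B + 2 * bw M R)
    (P₀ := .seq (.emitTerms (colTerms M R w .mid)) (.advance M R 1))
    (P₁ := .seq (.emitTerms (colTerms M R w .mid)) (.advance M R 1)) F s.r10 (by norm_num)
    (by norm_num) (by norm_num) (by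
      intro i hi u v
      rw [ite_self]
      have := hmul i hi.le
      refine ((h₂ O (((F i).set 10 u).set 12 v) B h1 (by simp [F, Regs.set]; omega)
        (by simp [F, Regs.set]; omega)).seq (runs_advance 1 _ rfl rfl)).congr (by omega) ?_
      simp only [F, Regs.set, List.length_replicate, List.range_succ, List.flatMap_append,
        List.reverse_append, monoCode_append, List.flatMap_cons, List.flatMap_nil, List.append_nil,
        List.append_assoc, Nat.add_mul, Nat.add_assoc])
  have e₃ := (h₃ O (F h) B h1 (by have := hmul h le_rfl; simp [F, Regs.set]; omega)
    (by have := hmul h le_rfl; simp [F, Regs.set]; omega)).seq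
    (runs_advance (O := O) (M := M) (R := R) 2 _ rfl rfl)
  have e₂' : Runs O (.forEach 10 12 (.seq (.emitTerms (colTerms M R w .mid)) (.advance M R 1))
      (.seq (.emitTerms (colTerms M R w .mid)) (.advance M R 1))) (s.set 2 out).toStk
      (h * (p₂.eval B + 2 * bw M R + 8) + 2) (F h).toStk := by
    convert e₂ using 2
    · simp [F, Regs.set, h4, h5, h12]
    · simp [F, Regs.set, h12, hh]
  refine (e₁.seq (e₂'.seq e₃)).congr ?_ ?_
  · simp only [Polynomial.eval_add, Polynomial.eval_mul, Polynomial.eval_C, Polynomial.eval_X]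
    have := Nat.mul_le_mul_right (p₂.eval B + 2 * bw M R + 8) hB
    simp only [Nat.add_assoc] at this ⊢
    omega
  · simp only [F, Regs.set, monos_rowChecks, List.length_replicate, List.reverse_append, monoCode_append,
      List.append_assoc, hout, Nat.add_mul, Nat.add_assoc]

end Rows

open Polynomial (C X)

/-! ### Writing the tableau row by row -/

section Grid

variable {M : Machine} {R : ℕ}

/-- The checks of the first `t` rows. -/
def gridPrefix (M : Machine) (R H : ℕ) (ws : List Row) (t : ℕ) : List PlacedCheck :=
  (List.range t).flatMap fun t =>
    rowChecks M R H (base M R H (t - 1)) (base M R H t) (ws.getD t .step)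

theorem gridPrefix_succ (H : ℕ) (ws : List Row) (t : ℕ) :
    gridPrefix M R H ws (t + 1) = gridPrefix M R H ws t ++
      rowChecks M R H (base M R H (t - 1)) (base M R H t) (ws.getD t .step) := by
  simp [gridPrefix, List.range_succ]

theorem base_succ (H t : ℕ) : base M R H (t + 1) = base M R H t + H * bw M R := by
  unfold base; ring

theorem base_one (H : ℕ) : base M R H 1 = 10 + H * bw M R := by unfold base; ring

theorem base_mono (H : ℕ) {t t' : ℕ} (h : t ≤ t') : base M R H t ≤ base M R H t' := by
  unfold base; gcongr

/-- The stacks after the gates of `t` rows have been written. -/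
def rowState (M : Machine) (R : ℕ) (ws : List Row) (out : List Bool) (s : Regs) (t : ℕ) : Regs :=
  ((s.set 4 (List.replicate (base M R (s.r10.length + 2) (t - 1)) true)).set 5
    (List.replicate (base M R (s.r10.length + 2) t) true)).set 2
    (monoCode ((gridPrefix M R (s.r10.length + 2) ws t).flatMap PlacedCheck.monos).reverse ++ out)

variable (M R) in
theorem runs_emitRow_rowState (w : Row) : ∃ p : Polynomial ℕ, ∀ (O : List Bool → List Bool)
    (s : Regs) (ws : List Row) (out : List Bool) (t B : ℕ), s.r1 = [] → s.r12 = [] → 1 ≤ t →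
    ws.getD t .step = w → base M R (s.r10.length + 2) (t + 1) ≤ B → s.r10.length ≤ B →
    Runs O (.emitRow M R w) (rowState M R ws out s t).toStk (p.eval B)
      (rowState M R ws out s (t + 1)).toStk := by
  obtain ⟨p, hp⟩ := runs_emitRow (M := M) (R := R) w
  refine ⟨p, fun O s ws out t B h1 h12 ht hw hB hB' => ?_⟩
  have e1 := base_succ (M := M) (R := R) (s.r10.length + 2) t
  have e2 := base_succ (M := M) (R := R) (s.r10.length + 2) (t - 1)
  rw [Nat.sub_add_cancel ht] at e2
  have := hp O (rowState M R ws out s t) _ _ B h1 h12 rfl rfl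
    (by simp only [rowState, Regs.set]; omega) (by simp only [rowState, Regs.set]; omega) hB'
  refine this.congr le_rfl ?_
  simp only [rowState, Regs.set, gridPrefix_succ, hw, Nat.add_sub_cancel, ← e1, ← e2,
    List.flatMap_append, List.reverse_append, monoCode_append, List.append_assoc]

variable (M R) in
/-- Writes the gates of the tableau. -/
def Prog.emitGrid : Prog :=
  .seq (.seq (.pushN 4 true 10) (.pushN 5 true 10)) (.seq (.emitRow M R .zero)
    (.seq (.seq (.clr 4) (.pushN 4 true 10)) (.seq (.mv 0 7)
      (.seq (.wh 7 true (.seq (.push 0 false) (.emitRow M R (.load false)))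
        true (.seq (.push 0 true) (.emitRow M R (.load true))))
        (.seq (.forEach 8 7 (.emitRow M R .free) (.emitRow M R .free))
          (.forEach 9 7 (.emitRow M R .step) (.emitRow M R .step)))))))

set_option maxHeartbeats 800000 in
variable (M R) in
theorem runs_emitGrid : ∃ p : Polynomial ℕ, ∀ (O : List Bool → List Bool) (s : Regs) (B : ℕ),
    s.r1 = [] → s.r4 = [] → s.r5 = [] → s.r7 = [] → s.r12 = [] →
    s.r10.length = s.r0.length + s.r8.length + s.r9.length →
    base M R (s.r10.length + 2) (s.r10.length + 1) ≤ B → s.r10.length ≤ B →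
    Runs O (.emitGrid M R) s.toStk (p.eval B) (rowState M R
      (rowsOf s.r0 s.r8.length s.r9.length) s.r2 s (s.r10.length + 1)).toStk := by
  obtain ⟨p₀, h₀⟩ := runs_emitRow (M := M) (R := R) .zero
  obtain ⟨p₁, h₁⟩ := runs_emitRow_rowState M R (.load false)
  obtain ⟨p₂, h₂⟩ := runs_emitRow_rowState M R (.load true)
  obtain ⟨p₃, h₃⟩ := runs_emitRow_rowState M R .free
  obtain ⟨p₄, h₄⟩ := runs_emitRow_rowState M R .step
  refine ⟨C 20 + (p₀ + (C 3 * X + C 11 + (C 4 * X + C 1 +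
    ((X * (p₁ + p₂ + C 4) + C 1) + ((X * (p₃ + C 8) + C 2) + (X * (p₄ + C 8) + C 2)))))),
    fun O s B h1 h4 h5 h7 h12 h10 hB hB' => ?_⟩
  set x := s.r0 with hx
  set ws := rowsOf x s.r8.length s.r9.length with hws
  set J := rowState M R ws s.r2 s with hJ
  set H := s.r10.length + 2 with hH
  have hbase : ∀ t ≤ s.r10.length + 1, base M R H t ≤ B := fun t ht => (base_mono H ht).trans hB
  have e₀ : Runs O (.seq (.pushN 4 true 10) (.pushN 5 true 10)) s.toStk 20
      ((s.set 4 (List.replicate 10 true)).set 5 (List.replicate 10 true)).toStk :=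
    ((Runs.pushN s true 10).seq (Runs.pushN _ true 10)).congr le_rfl
      (by simp [Regs.set, Regs.toStk, h4, h5])
  have hb1 : base M R H 1 = 10 + H * bw M R := base_one H
  have hb0 : base M R H 0 = 10 := by unfold base; ring
  have e₁ := h₀ O ((s.set 4 (List.replicate 10 true)).set 5 (List.replicate 10 true)) 10 10 B h1 h12
    rfl rfl (by rw [← base_one]; exact hbase 1 (by omega))
    (by rw [← base_one]; exact hbase 1 (by omega)) hB'
  set s₁ := ((((s.set 4 (List.replicate 10 true)).set 5 (List.replicate 10 true)).set 4
      (List.replicate (10 + (s.r10.length + 2) * bw M R) true)).set 5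
      (List.replicate (10 + (s.r10.length + 2) * bw M R) true)).set 2
      (monoCode ((rowChecks M R (s.r10.length + 2) 10 10 .zero).flatMap PlacedCheck.monos).reverse ++
        s.r2) with hs₁
  -- Row 0 has moved both positions on, but the predecessor of row 1 is row 0; so the previous
  -- position is set back to 10, the beginning of the tableau.
  have e₂ : Runs O (.seq (.clr 4) (.pushN 4 true 10)) s₁.toStk (3 * base M R H 1 + 1 + 10) (J 1).toStk := by
    refine ((Runs.clr s₁).seq (Runs.pushN _ true 10)).congr ?_ ?_
    · simp [s₁, Regs.toStk, Regs.set, base_one, hH]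
    · simp only [J, s₁, rowState, Regs.toStk, Regs.set, gridPrefix, List.range_one, List.flatMap_cons,
        List.flatMap_nil, List.append_nil, ← hH, hb0, hb1, Nat.zero_sub, Nat.sub_self]
      rfl
  have e₃ : Runs O (.mv 0 7) (J 1).toStk (4 * x.length + 1)
      (((J 1).set 0 []).set 7 x.reverse).toStk := by
    refine (Runs.mv _).congr le_rfl ?_
    show (((J 1).set 0 []).set 7 (x.reverse ++ s.r7)).toStk = _
    rw [h7, List.append_nil]
  -- The input lies reversed on stack 7, which is the order of the load rows. Every bit is pushed
  -- back on stack 0, so the input is restored along the way.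
  have e₄ := Runs.drain (O := O) (r := 7) (k := 1 + (p₁.eval B + p₂.eval B))
    (P₀ := .seq (.push 0 false) (.emitRow M R (.load false)))
    (P₁ := .seq (.push 0 true) (.emitRow M R (.load true)))
    (fun i => ((J (i + 1)).set 0 ((x.reverse.take i).reverse)).set 7 (x.reverse.drop i))
    x.reverse (by norm_num) (fun _ _ => rfl) (by
      intro i hi
      have hi' : i < x.length := by simpa using hi
      have hrow : ws.getD (i + 1) .step = .load x.reverse[i] := rowsOf_load hi'
      have hnext : (x.reverse.take (i + 1)).reverse = x.reverse[i] :: (x.reverse.take i).reverse := by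
        rw [List.take_succ_eq_append_getElem hi, List.reverse_append]; rfl
      set s' := (s.set 0 ((x.reverse.take (i + 1)).reverse)).set 7 (x.reverse.drop (i + 1)) with hs'
      have hp : ∀ b, x.reverse[i] = b → Runs O (.push 0 b) ((((J (i + 1)).set 0
          ((x.reverse.take i).reverse)).set 7 (x.reverse.drop i)).set 7 (x.reverse.drop (i + 1))).toStk
          1 (rowState M R ws s.r2 s' (i + 1)).toStk := by
        intro b hb
        refine (Runs.pushR _ 0 b).congr le_rfl ?_
        simp only [s', hnext, hb]
        rfl
      have hB1 : base M R (s'.r10.length + 2) (i + 1 + 1) ≤ B := hbase _ (by omega)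
      cases hb : x.reverse[i]
      · exact ((hp _ hb).seq (h₁ O s' ws s.r2 (i + 1) B h1 h12 (by omega) (hb ▸ hrow) hB1 hB')).mono
          (by omega)
      · exact ((hp _ hb).seq (h₂ O s' ws s.r2 (i + 1) B h1 h12 (by omega) (hb ▸ hrow) hB1 hB')).mono
          (by omega))
  have e₄' : Runs O (.wh 7 true (.seq (.push 0 false) (.emitRow M R (.load false)))
        true (.seq (.push 0 true) (.emitRow M R (.load true))))
      (((J 1).set 0 []).set 7 x.reverse).toStk (x.length * (1 + (p₁.eval B + p₂.eval B) + 3) + 1)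
      (J (x.length + 1)).toStk := by
    have hJ7 : ∀ k, ((J k).set 0 x).set 7 [] = J k := fun k => by rw [← h7]; rfl
    refine e₄.congr (by rw [List.length_reverse]) ?_
    rw [List.length_reverse, List.take_of_length_le (by simp), List.drop_of_length_le (by simp),
      List.reverse_reverse, hJ7]
  have loop : ∀ (r : ℕ) (l : List Bool) (w : Row) (p : Polynomial ℕ) (t₀ : ℕ), r < 24 → r ≠ 7 →
      (∀ i, (J i).set r l = J i) → (∀ u v i, rowState M R ws s.r2 ((s.set r u).set 7 v) i =
        ((J i).set r u).set 7 v ∧ ((s.set r u).set 7 v).r1 = [] ∧ ((s.set r u).set 7 v).r12 = [] ∧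
        ((s.set r u).set 7 v).r10 = s.r10) → (∀ (O : List Bool → List Bool)
    (s : Regs) (ws : List Row) (out : List Bool) (t B : ℕ), s.r1 = [] → s.r12 = [] → 1 ≤ t →
    ws.getD t .step = w → base M R (s.r10.length + 2) (t + 1) ≤ B → s.r10.length ≤ B →
    Runs O (.emitRow M R w) (rowState M R ws out s t).toStk (p.eval B)
      (rowState M R ws out s (t + 1)).toStk) → 1 ≤ t₀ → t₀ + l.length ≤ s.r10.length + 1 →
      (∀ i < l.length, ws.getD (t₀ + i) .step = w) →
      Runs O (.forEach r 7 (.emitRow M R w) (.emitRow M R w)) (J t₀).toStk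
        (l.length * (p.eval B + 8) + 2) (J (t₀ + l.length)).toStk := by
    intro r l w p t₀ hr hr7 hset hcomm hp ht₀ hlen hw
    have := Runs.forEach (O := O) (r := r) (t := 7) (k := p.eval B) (P₀ := .emitRow M R w)
      (P₁ := .emitRow M R w) (fun i => J (t₀ + i)) l hr7 hr (by norm_num) (by
        intro i hi u v
        rw [ite_self, ← (hcomm u v _).1, ← (hcomm u v _).1, ← Nat.add_assoc]
        obtain ⟨_, c1, c12, c10⟩ := hcomm u v 0
        refine hp O _ ws s.r2 (t₀ + i) B c1 c12 (by omega) (hw i hi) ?_ (by rwa [c10])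
        rw [c10]
        exact hbase _ (by omega))
    simp only [hset] at this
    have h7' : ∀ i, (J i).set 7 [] = J i := fun i => by rw [← h7]; rfl
    rw [h7', h7'] at this
    exact this
  have e₅ := loop 8 s.r8 .free p₃ (x.length + 1) (by norm_num) (by norm_num) (fun _ => rfl)
    (fun u v i => ⟨rfl, h1, h12, rfl⟩) h₃ (by omega) (by omega) (fun i hi => by
      rw [Nat.add_right_comm]; exact rowsOf_free hi)
  have e₆ := loop 9 s.r9 .step p₄ (x.length + 1 + s.r8.length) (by norm_num) (by norm_num)
    (fun _ => rfl) (fun u v i => ⟨rfl, h1, h12, rfl⟩) h₄ (by omega) (by omega) (fun i hi => by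
      rw [show x.length + 1 + s.r8.length + i = x.length + s.r8.length + i + 1 by omega]
      exact rowsOf_step)
  refine (e₀.seq (e₁.seq (e₂.seq (e₃.seq (e₄'.seq (e₅.seq e₆)))))).congr ?_ ?_
  · simp only [Polynomial.eval_add, Polynomial.eval_mul, Polynomial.eval_C, Polynomial.eval_X]
    have a1 := hbase 1 (by omega)
    have a2 : x.length * (1 + (p₁.eval B + p₂.eval B) + 3) ≤ B * (p₁.eval B + p₂.eval B + 4) :=
      Nat.mul_le_mul (by omega) (by omega)
    have a3 : s.r8.length * (p₃.eval B + 8) ≤ B * (p₃.eval B + 8) :=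
      Nat.mul_le_mul (by omega) le_rfl
    have a4 : s.r9.length * (p₄.eval B + 8) ≤ B * (p₄.eval B + 8) :=
      Nat.mul_le_mul (by omega) le_rfl
    omega
  · rw [show x.length + 1 + s.r8.length + s.r9.length = s.r10.length + 1 by omega]

end Grid

open Polynomial (C X)

/-! ### Writing the whole circuit -/

/-- Writes Hadamard gates on as many qubits as stack `11` and four times stack `6` tell. -/
def Prog.emitLayer : Prog :=
  .seq (.forEach 11 1 (.pushN 13 true 1) (.pushN 13 true 1))
    (.seq (.forEach 6 1 (.pushN 13 true 4) (.pushN 13 true 4))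
      (.wh 13 true
        (.seq (.push 2 false) (.seq (.forEach 13 1 (.pushN 2 true 1) (.pushN 2 true 1))
          (.push 2 false)))
        true
        (.seq (.push 2 false) (.seq (.forEach 13 1 (.pushN 2 true 1) (.pushN 2 true 1))
          (.push 2 false)))))

theorem runs_emitLayer : ∃ p : Polynomial ℕ, ∀ (O : List Bool → List Bool) (s : Regs) (N B : ℕ),
    s.r1 = [] → s.r13 = [] → N = s.r11.length + 4 * s.r6.length → N ≤ B →
    Runs O .emitLayer s.toStk (p.eval B)
      (s.set 2 ((hadLayer N).flatMap RawGate.encode ++ s.r2)).toStk := by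
  refine ⟨C 9 * X + C 2 + (C 12 * X + C 2 + (X * (C 9 * X + C 7) + C 1)),
    fun O s N B h1 h13 hN hB => ?_⟩
  have e₁ : Runs O (.forEach 11 1 (.pushN 13 true 1) (.pushN 13 true 1)) s.toStk
      (s.r11.length * 9 + 2) (s.set 13 (List.replicate s.r11.length true)).toStk := by
    refine (Runs.forEach_push (r := 11) (t := 1) (d := 13) s h1 1).congr le_rfl ?_
    show (s.set 13 (List.replicate (s.r11.length * 1) true ++ s.r13)).toStk = _
    rw [h13, List.append_nil, mul_one]
  have e₂ : Runs O (.forEach 6 1 (.pushN 13 true 4) (.pushN 13 true 4))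
      (s.set 13 (List.replicate s.r11.length true)).toStk (s.r6.length * 12 + 2)
      (s.set 13 (List.replicate N true)).toStk := by
    refine (Runs.forEach_push (r := 6) (t := 1) (d := 13) _ (by simp only [Regs.set, Regs.toStk, h1]) 4).congr le_rfl ?_
    show (s.set 13 (List.replicate (s.r6.length * 4) true ++
      List.replicate s.r11.length true)).toStk = _
    rw [← List.replicate_add, show s.r6.length * 4 + s.r11.length = N by omega]
  -- When a bit has been popped, stack 13 holds the number of the next qubit, from N - 1 down to 0;
  -- as the output grows in front, the gates end up in increasing order.
  have e₃ := Runs.drain (O := O) (r := 13) (k := 1 + (N * 9 + 2 + 1))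
    (P₀ := .seq (.push 2 false) (.seq (.forEach 13 1 (.pushN 2 true 1) (.pushN 2 true 1))
      (.push 2 false)))
    (P₁ := .seq (.push 2 false) (.seq (.forEach 13 1 (.pushN 2 true 1) (.pushN 2 true 1))
      (.push 2 false)))
    (fun i => (s.set 13 ((List.replicate N true).drop i)).set 2
      ((((List.range N).drop (N - i)).map RawGate.had).flatMap RawGate.encode ++ s.r2))
    (List.replicate N true) (by norm_num) (fun _ _ => rfl) (by
      intro i hi
      rw [List.length_replicate] at hi
      rw [ite_self]
      have hl : ((List.replicate N true).drop (i + 1)).length = N - (i + 1) := by simp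
      have hd : (List.range N).drop (N - (i + 1)) = (N - (i + 1)) :: (List.range N).drop (N - i) := by
        rw [List.drop_eq_getElem_cons (by simp; omega), List.getElem_range]
        congr 2; omega
      refine ((Runs.pushR _ 2 false).seq ((Runs.forEach_push (r := 13) (t := 1) (d := 2) _
        (by simp only [Regs.set, Regs.toStk, h1]) 1).seq (Runs.pushR _ 2 false))).congr ?_ ?_
      · simp only [Regs.set, Regs.toStk, hl]; omega
      · simp only [Regs.set, Regs.toStk, hl, hd, List.map_cons, List.flatMap_cons, RawGate.encode,
          encodeUnary, mul_one, List.cons_append, List.append_assoc, List.nil_append])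
  rw [List.length_replicate] at e₃
  have e₃' : Runs O (.wh 13 true
      (.seq (.push 2 false) (.seq (.forEach 13 1 (.pushN 2 true 1) (.pushN 2 true 1))
        (.push 2 false))) true
      (.seq (.push 2 false) (.seq (.forEach 13 1 (.pushN 2 true 1) (.pushN 2 true 1))
        (.push 2 false)))) (s.set 13 (List.replicate N true)).toStk
      (N * (1 + (N * 9 + 2 + 1) + 3) + 1)
      (s.set 2 ((hadLayer N).flatMap RawGate.encode ++ s.r2)).toStk := by
    convert e₃ using 2
    · rw [Nat.sub_zero, List.drop_of_length_le (l := List.range N) (by simp)]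
      rfl
    · rw [Nat.sub_self, List.drop_zero, List.drop_of_length_le (l := List.replicate N true) (by simp),
        ← h13]
      rfl
  refine (e₁.seq (e₂.seq e₃')).congr ?_ rfl
  simp only [Polynomial.eval_add, Polynomial.eval_mul, Polynomial.eval_C, Polynomial.eval_X]
  have : N * (1 + (N * 9 + 2 + 1) + 3) ≤ B * (9 * B + 7) := Nat.mul_le_mul hB (by omega)
  omega

/-- The terms of the gadget. -/
def gadgetTerms : List (Ref × Ref × Ref) := gadget.map fun m => (.glob m.1, .glob m.2.1, .glob m.2.2)

theorem evalTerms_gadgetTerms (a d : ℕ) : evalTerms a d gadgetTerms = gadget := by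
  rw [evalTerms, gadgetTerms, List.map_map]
  exact List.map_id _

/-- Writes the gates of the comparison. -/
def Prog.emitCmp : Prog :=
  .seq (.emitTerms (chkTerms [cmpInit])) (.seq
    (.forEach 6 7 (.seq (.emitTerms (chkTerms [cmpCheck false])) (.pushN 5 true 4))
      (.seq (.emitTerms (chkTerms [cmpCheck true])) (.pushN 5 true 4)))
    (.emitTerms finalTerms))

theorem runs_emitCmp : ∃ p : Polynomial ℕ, ∀ (O : List Bool → List Bool) (s : Regs) (a d B : ℕ),
    s.r1 = [] → s.r7 = [] → s.r4 = List.replicate a true → s.r5 = List.replicate d true →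
    a ≤ B → d + 4 * s.r6.length ≤ B →
    Runs O .emitCmp s.toStk (p.eval B) ((s.set 5 (List.replicate (d + 4 * s.r6.length) true)).set 2
      (monoCode ((cmpChecks a d s.r6).flatMap PlacedCheck.monos ++
        evalTerms a (d + 4 * s.r6.length) finalTerms).reverse ++ s.r2)).toStk := by
  obtain ⟨p₁, h₁⟩ := emits_emitTerms (chkTerms [cmpInit])
  obtain ⟨p₂, h₂⟩ := emits_emitTerms (chkTerms [cmpCheck false])
  obtain ⟨p₃, h₃⟩ := emits_emitTerms (chkTerms [cmpCheck true])
  obtain ⟨p₄, h₄⟩ := emits_emitTerms finalTerms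
  refine ⟨p₁ + ((X * (p₂ + p₃ + C 12) + C 2) + p₄), fun O s a d B h1 h7 h4 h5 ha hd => ?_⟩
  set ch := s.r6 with hch
  have e₁ : Runs O (.emitTerms (chkTerms [cmpInit])) s.toStk (p₁.eval B)
      (s.set 2 (monoCode ((cmpChecks a d []).flatMap PlacedCheck.monos).reverse ++ s.r2)).toStk := by
    refine (h₁ O s B h1 (by simp [h4, ha]) (by simp [h5]; omega)).congr le_rfl ?_
    simp only [h4, h5, List.length_replicate, evalTerms_chkTerms]
    rfl
  have hrest : ∀ (l : List Bool) (b : Bool) (d : ℕ), cmpRest a d (l ++ [b]) =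
      cmpRest a d l ++ [(a, d + 4 * l.length, cmpCheck b)] := by
    intro l b
    induction l with
    | nil => intro d; rfl
    | cons c l ih =>
      intro d
      rw [List.cons_append, cmpRest, ih, cmpRest, List.cons_append, List.length_cons,
        show d + 4 + 4 * l.length = d + 4 * (l.length + 1) by ring]
  have e₂ := Runs.forEach (O := O) (r := 6) (t := 7) (k := p₂.eval B + p₃.eval B + 4)
    (P₀ := .seq (.emitTerms (chkTerms [cmpCheck false])) (.pushN 5 true 4))
    (P₁ := .seq (.emitTerms (chkTerms [cmpCheck true])) (.pushN 5 true 4))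
    (fun i => (s.set 5 (List.replicate (d + 4 * i) true)).set 2
      (monoCode ((cmpChecks a d (ch.take i)).flatMap PlacedCheck.monos).reverse ++ s.r2)) ch
    (by norm_num) (by norm_num) (by norm_num) (by
      intro i hi u v
      have hlen : (ch.take i).length = i := by simp; omega
      have hnext : (cmpChecks a d (ch.take (i + 1))).flatMap PlacedCheck.monos =
          (cmpChecks a d (ch.take i)).flatMap PlacedCheck.monos ++
            evalTerms a (d + 4 * i) (chkTerms [cmpCheck ch[i]]) := by
        rw [List.take_succ_eq_append_getElem hi, cmpChecks, hrest, hlen, evalTerms_chkTerms, cmpChecks,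
          List.flatMap_cons, List.flatMap_cons, List.flatMap_append, List.append_assoc]
        rfl
      rw [hnext]
      generalize cmpChecks a d (ch.take i) = L
      have body : ∀ (b : Bool) (p : Polynomial ℕ), (∀ (O : List Bool → List Bool) (s : Regs) (B : ℕ),
          s.r1 = [] → s.r4.length ≤ B → s.r5.length ≤ B → Runs O (.emitTerms (chkTerms [cmpCheck b]))
          s.toStk (p.eval B) (s.set 2 (monoCode ((fun a d => evalTerms a d (chkTerms [cmpCheck b]))
            s.r4.length s.r5.length).reverse ++ s.r2)).toStk) →
          Runs O (.seq (.emitTerms (chkTerms [cmpCheck b])) (.pushN 5 true 4))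
          ((((s.set 5 (List.replicate (d + 4 * i) true)).set 2
            (monoCode (L.flatMap PlacedCheck.monos).reverse ++ s.r2)).set 6 u).set 7 v).toStk
          (p.eval B + 4) ((((s.set 5 (List.replicate (d + 4 * (i + 1)) true)).set 2
            (monoCode (L.flatMap PlacedCheck.monos ++ evalTerms a (d + 4 * i)
              (chkTerms [cmpCheck b])).reverse ++ s.r2)).set 6 u).set 7 v).toStk := by
        intro b p hp
        refine ((hp O _ B (by simp only [Regs.set, h1]) (by simp [Regs.set, h4, ha])
          (by simp [Regs.set]; omega)).seq (Runs.pushN _ true 4)).congr le_rfl ?_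
        simp only [Regs.set, Regs.toStk, h4, List.length_replicate, ← List.replicate_add,
          List.reverse_append, monoCode_append, List.append_assoc,
          show 4 + (d + 4 * i) = d + 4 * (i + 1) by ring]
      cases ch[i]
      · exact (body false p₂ h₂).mono (by omega)
      · exact (body true p₃ h₃).mono (by omega))
  have e₂' : Runs O (.forEach 6 7 (.seq (.emitTerms (chkTerms [cmpCheck false])) (.pushN 5 true 4))
      (.seq (.emitTerms (chkTerms [cmpCheck true])) (.pushN 5 true 4)))
      (s.set 2 (monoCode ((cmpChecks a d []).flatMap PlacedCheck.monos).reverse ++ s.r2)).toStk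
      (ch.length * (p₂.eval B + p₃.eval B + 4 + 8) + 2)
      ((s.set 5 (List.replicate (d + 4 * ch.length) true)).set 2
        (monoCode ((cmpChecks a d ch).flatMap PlacedCheck.monos).reverse ++ s.r2)).toStk := by
    convert e₂ using 2
    · rw [List.take_zero, mul_zero, add_zero, ← h5, ← h7]
      simp only [Regs.set, hch]
    · rw [List.take_length, ← h7]
      simp only [Regs.set, hch]
  have e₃ := h₄ O ((s.set 5 (List.replicate (d + 4 * ch.length) true)).set 2
        (monoCode ((cmpChecks a d ch).flatMap PlacedCheck.monos).reverse ++ s.r2)) B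
    (by simp only [Regs.set, h1])
    (by simp [Regs.set, h4, ha]) (by simp [Regs.set]; omega)
  refine (e₁.seq (e₂'.seq e₃)).congr ?_ ?_
  · simp only [Polynomial.eval_add, Polynomial.eval_mul, Polynomial.eval_C, Polynomial.eval_X]
    have : ch.length * (p₂.eval B + p₃.eval B + 4 + 8) ≤ B * (p₂.eval B + p₃.eval B + 12) :=
      Nat.mul_le_mul (by omega) (by omega)
    omega
  · simp only [Regs.set, h4, List.length_replicate, List.reverse_append, monoCode_append,
      List.append_assoc]

/-! ### The code of a complete query -/

section Circuit

variable (M : Machine) (R : ℕ)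

/-- Writes the gates of the circuit of the comparison. -/
def Prog.emitCircuit : Prog :=
  .seq .emitLayer (.seq (.emitTerms gadgetTerms) (.seq (.emitGrid M R) (.seq .emitCmp
    (.seq (.clr 4) (.seq (.clr 5) .emitLayer)))))

/-- The stacks are prepared for a query. -/
structure Ready (s : Regs) : Prop where
  h1 : s.r1 = []
  h2 : s.r2 = []
  h4 : s.r4 = []
  h5 : s.r5 = []
  h7 : s.r7 = []
  h10 : s.r10.length = s.r0.length + s.r8.length + s.r9.length
  h11 : s.r11.length = base M R (s.r10.length + 2) (s.r10.length + 1) + 4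
  h12 : s.r12 = []
  h13 : s.r13 = []

/-- The code of the gates of the circuit that is written. -/
def queryGates (s : Regs) : List Bool :=
  gateCode (numVars M R (hgt s.r0 s.r8.length s.r9.length) (rowsOf s.r0 s.r8.length s.r9.length) s.r6)
    (allMonos M R (hgt s.r0 s.r8.length s.r9.length) (rowsOf s.r0 s.r8.length s.r9.length) s.r6).reverse

set_option maxHeartbeats 1600000 in
theorem runs_emitCircuit : ∃ p : Polynomial ℕ, ∀ (O : List Bool → List Bool) (s : Regs) (B : ℕ),
    Ready M R s → s.r10.length ≤ B → s.r11.length + 4 * s.r6.length ≤ B →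
    Runs O (.emitCircuit M R) s.toStk (p.eval B) (s.set 2 (queryGates M R s)).toStk := by
  obtain ⟨p₁, h₁⟩ := runs_emitLayer
  obtain ⟨p₂, h₂⟩ := emits_emitTerms gadgetTerms
  obtain ⟨p₃, h₃⟩ := runs_emitGrid M R
  obtain ⟨p₄, h₄⟩ := runs_emitCmp
  refine ⟨p₁ + (p₂ + (p₃ + (p₄ + (C 3 * X + C 1 + (C 3 * X + C 1 + p₁))))), fun O s B hs hB hB' => ?_⟩
  set ws := rowsOf s.r0 s.r8.length s.r9.length with hws
  set H := s.r10.length + 2 with hH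
  have hwsl : ws.length = s.r10.length + 1 := by rw [hws, length_rowsOf, hs.h10]
  set N := s.r11.length + 4 * s.r6.length with hN
  have hbase : base M R H (s.r10.length + 1) + 4 = s.r11.length := hs.h11.symm
  have hbase' : base M R H s.r10.length ≤ base M R H (s.r10.length + 1) := base_mono H (by omega)
  -- The code is written from its end: the last layer, the monomials in reverse order, the first
  -- layer.
  set out₁ := (hadLayer N).flatMap RawGate.encode with hout₁
  have e₁ : Runs O .emitLayer s.toStk (p₁.eval B) (s.set 2 out₁).toStk := by
    have := h₁ O s N B hs.h1 hs.h13 rfl hB'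
    rwa [hs.h2, List.append_nil] at this
  set out₂ := monoCode gadget.reverse ++ out₁ with hout₂
  have e₂ : Runs O (.emitTerms gadgetTerms) (s.set 2 out₁).toStk (p₂.eval B) (s.set 2 out₂).toStk := by
    refine (h₂ O (s.set 2 out₁) B (by simp only [Regs.set, hs.h1]) (by simp [Regs.set, hs.h4])
      (by simp [Regs.set, hs.h5])).congr le_rfl ?_
    simp only [evalTerms_gadgetTerms]
    rfl
  have e₃ := h₃ O (s.set 2 out₂) B hs.h1 hs.h4 hs.h5 hs.h7 hs.h12 hs.h10
    (by show base M R H (s.r10.length + 1) ≤ B; omega) hB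
  set out₃ := monoCode ((gridChecks M R H ws).flatMap PlacedCheck.monos).reverse ++ out₂ with hout₃
  have e₃' : Runs O (.emitGrid M R) (s.set 2 out₂).toStk (p₃.eval B)
      (((s.set 4 (List.replicate (base M R H s.r10.length) true)).set 5
        (List.replicate (base M R H (s.r10.length + 1)) true)).set 2 out₃).toStk := by
    refine e₃.congr le_rfl ?_
    rw [hout₃, gridChecks, hwsl]
    rfl
  set s₃ := ((s.set 4 (List.replicate (base M R H s.r10.length) true)).set 5
        (List.replicate (base M R H (s.r10.length + 1)) true)).set 2 out₃ with hs₃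
  have e₄ := h₄ O s₃ (base M R H s.r10.length) (base M R H (s.r10.length + 1)) B
    (by simp only [s₃, Regs.set, hs.h1]) (by simp only [s₃, Regs.set, hs.h7])
    (by simp only [s₃, Regs.set]) (by simp only [s₃, Regs.set]) (by omega)
    (by simp only [s₃, Regs.set]; omega)
  set out₄ := monoCode ((cmpChecks (base M R H s.r10.length) (base M R H (s.r10.length + 1))
    s.r6).flatMap PlacedCheck.monos ++ evalTerms (base M R H s.r10.length)
      (base M R H (s.r10.length + 1) + 4 * s.r6.length) finalTerms).reverse ++ out₃ with hout₄
  have e₄' : Runs O .emitCmp s₃.toStk (p₄.eval B)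
      (((s.set 4 (List.replicate (base M R H s.r10.length) true)).set 5
        (List.replicate (base M R H (s.r10.length + 1) + 4 * s.r6.length) true)).set 2 out₄).toStk := by
    simpa only [s₃, Regs.set] using e₄
  have e₅ : Runs O (.clr 4) (((s.set 4 (List.replicate (base M R H s.r10.length) true)).set 5
        (List.replicate (base M R H (s.r10.length + 1) + 4 * s.r6.length) true)).set 2 out₄).toStk
      (3 * B + 1) ((s.set 5 (List.replicate (base M R H (s.r10.length + 1) + 4 * s.r6.length)
        true)).set 2 out₄).toStk := by
    refine (Runs.clr _).congr ?_ ?_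
    · simp only [Regs.set, Regs.toStk, List.length_replicate]; omega
    · rw [← hs.h4]; rfl
  have e₆ : Runs O (.clr 5) ((s.set 5 (List.replicate (base M R H (s.r10.length + 1) +
      4 * s.r6.length) true)).set 2 out₄).toStk (3 * B + 1) (s.set 2 out₄).toStk := by
    refine (Runs.clr _).congr ?_ ?_
    · simp only [Regs.set, Regs.toStk, List.length_replicate]; omega
    · rw [← hs.h5]; rfl
  have e₇ := h₁ O (s.set 2 out₄) N B hs.h1 hs.h13 rfl hB'
  refine (e₁.seq (e₂.seq (e₃'.seq (e₄'.seq (e₅.seq (e₆.seq e₇)))))).congr ?_ ?_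
  · simp
  · have hNv : numVars M R H ws s.r6 = N := by
      rw [numVars, hwsl, hN]; omega
    show (s.set 2 ((hadLayer N).flatMap RawGate.encode ++ out₄)).toStk = _
    rw [queryGates, show hgt s.r0 s.r8.length s.r9.length = H by rw [hH, hs.h10], ← hws, hNv,
      gateCode, hout₄, hout₃, hout₂, hout₁, allMonos, allChecks, finalMonos, hwsl]
    simp only [List.flatMap_append, List.reverse_append, monoCode_append, List.append_assoc,
      Nat.add_sub_cancel]
    rfl

end Circuit

open Polynomial (C X)

/-! ### Evaluating the answer to a query -/

theorem Runs.askR {O : List Bool → List Bool} (s : Regs) :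
    Runs O .ask s.toStk 1 ((s.set 3 (O s.r2)).set 2 []).toStk := by
  rw [← Regs.update_toStk _ (by norm_num), ← Regs.update_toStk _ (by norm_num)]
  exact Runs.ask

/-- Appends the size of the query and calls the oracle. -/
def Prog.sendQuery : Prog :=
  .seq (.wh 2 true (.seq (.push 13 false) (.push 17 true)) true (.seq (.push 13 true) (.push 17 true)))
    (.seq (.mv 13 2) (.seq (.push 2 false) (.seq (.mv 17 2) .ask)))

/-- The number of qubits is the length of the gate code; it is counted while the code is moved away,
then the code is moved back and the unary header is put in front. -/
theorem runs_sendQuery (O : List Bool → List Bool) (s : Regs) (h13 : s.r13 = []) (h17 : s.r17 = []) :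
    Runs O .sendQuery s.toStk (13 * s.r2.length + 5)
      ((s.set 3 (O (encodeUnary s.r2.length ++ s.r2))).set 2 []).toStk := by
  set G := s.r2 with hG
  have e₁ := Runs.drain (O := O) (r := 2) (k := 2)
    (P₀ := .seq (.push 13 false) (.push 17 true)) (P₁ := .seq (.push 13 true) (.push 17 true))
    (fun i => ((s.set 2 (G.drop i)).set 13 (G.take i).reverse).set 17 (List.replicate i true))
    G (by norm_num) (fun _ _ => rfl) (by
      intro i hi
      have hb : ∀ b : Bool, b = G[i] → Runs O (.seq (.push 13 b) (.push 17 true))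
          ((((s.set 2 (G.drop i)).set 13 (G.take i).reverse).set 17
            (List.replicate i true)).set 2 (G.drop (i + 1))).toStk 2
          (((s.set 2 (G.drop (i + 1))).set 13 (G.take (i + 1)).reverse).set 17
            (List.replicate (i + 1) true)).toStk := by
        intro b hb
        refine ((Runs.pushR _ 13 b).seq (Runs.pushR _ 17 true)).congr le_rfl ?_
        simp only [Regs.set, Regs.toStk, List.take_succ_eq_append_getElem hi, List.reverse_append,
          List.replicate_succ, hb]
        rfl
      split_ifs with h
      · exact hb true h.symm
      · exact hb false (Bool.eq_false_iff.2 h).symm)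
  have e₁' : Runs O (.wh 2 true (.seq (.push 13 false) (.push 17 true)) true
      (.seq (.push 13 true) (.push 17 true))) s.toStk (G.length * 5 + 1)
      (((s.set 2 []).set 13 G.reverse).set 17 (List.replicate G.length true)).toStk := by
    convert e₁ using 2
    · rw [List.drop_zero, List.take_zero, List.replicate_zero, List.reverse_nil, hG]
      nth_rw 1 [← h13]
      rw [← h17]
      rfl
    · rw [List.drop_length, List.take_length]
  refine (e₁'.seq ((Runs.mv _).seq ((Runs.pushR _ 2 false).seq ((Runs.mv _).seq
    (Runs.askR _))))).congr ?_ ?_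
  · simp only [Regs.set, Regs.toStk, List.length_reverse, List.length_replicate]
    omega
  · simp only [Regs.set, Regs.toStk, List.reverse_reverse, List.reverse_replicate, encodeUnary,
      List.append_assoc, List.append_nil]
    rw [h13, h17]
    rfl

/-- Replaces a nonnegative rational number on stack `3` by its denominator and writes the length of
the numerator on stack `17`. -/
def Prog.parse : Prog :=
  .cs 3 .skip .skip (.cs 3 .skip
    (.wh 3 false .skip true (.cs 3 .skip (.push 17 true) (.push 17 true))) (.clr 3))

/-- Only the length of the numerator is needed. For a negative answer stack 17 stays empty, just as
for numerator zero, so that neither will count as large. -/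
theorem runs_parse (O : List Bool → List Bool) (s : Regs) (v : ℚ) (h3 : s.r3 = encodeRat v)
    (h17 : s.r17 = []) : Runs O .parse s.toStk (7 * (encodeRat v).length + 10)
      (if 0 ≤ v.num then
        ((s.set 3 v.den.bits).set 17 (List.replicate v.num.natAbs.bits.length true)).toStk
        else (s.set 3 []).toStk) := by
  have hr : encodeRat v = true :: decide (v.num < 0) ::
      (v.num.natAbs.bits.flatMap (fun b => [true, b]) ++ false :: v.den.bits) := rfl
  have hl : ∀ l : List Bool, (l.flatMap fun b => [true, b]).length = 2 * l.length := by
    intro l; induction l <;> simp_all; omega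
  rw [hr] at h3 ⊢
  by_cases hv : 0 ≤ v.num
  · rw [if_pos hv, decide_eq_false hv.not_gt] at *
    have loop : ∀ (l : List Bool) (s : Regs),
        s.r3 = l.flatMap (fun b => [true, b]) ++ false :: v.den.bits →
        Runs O (.wh 3 false .skip true (.cs 3 .skip (.push 17 true) (.push 17 true))) s.toStk
          (7 * l.length + 3)
          ((s.set 3 v.den.bits).set 17 (List.replicate l.length true ++ s.r17)).toStk := by
      intro l
      induction l with
      | nil =>
        intro s hs
        exact (Runs.wh_stopR (b := false) (show s.toStk 3 = _ from hs) (by norm_num) rfl Runs.skip).congr (by simp) rfl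
      | cons b l ih =>
        intro s hs
        refine (Runs.whR (b := true) (k := 1 + 3) (s' := (s.set 3 (l.flatMap (fun b => [true, b]) ++
          false :: v.den.bits)).set 17 (true :: s.r17)) (l := 7 * l.length + 3)
          (show s.toStk 3 = _ from hs) (by norm_num) rfl
          ?_ ((ih _ (by simp only [Regs.set])).congr le_rfl rfl)).congr (by simp; omega) ?_
        · cases b
          · exact Runs.cs_falseR (by rfl) (by norm_num) (Runs.pushR _ 17 true)
          · exact Runs.cs_trueR (by rfl) (by norm_num) (Runs.pushR _ 17 true)
        · simp only [Regs.set, List.length_cons, List.replicate_succ', List.append_assoc]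
          rfl
    refine (Runs.cs_trueR (s' := (s.set 3 v.den.bits).set 17
      (List.replicate v.num.natAbs.bits.length true)) (show s.toStk 3 = _ from h3) (by norm_num)
      (Runs.cs_falseR rfl (by norm_num)
        ((loop v.num.natAbs.bits _ rfl).congr le_rfl ?_))).mono ?_
    · simp only [Regs.set, h17, List.append_nil]
    · simp [hl]; omega
  · rw [if_neg hv, decide_eq_true (not_le.1 hv)] at *
    refine (Runs.cs_trueR (s' := s.set 3 []) (show s.toStk 3 = _ from h3) (by norm_num)
      (Runs.cs_trueR rfl (by norm_num) ((Runs.clr _).congr le_rfl ?_))).mono ?_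
    · simp only [Regs.set]
    · simp [Regs.set, Regs.toStk, hl]; omega

/-- Decreases the number on stack `6`. -/
def Prog.decrement : Prog := .seq (.wh 6 true (.push 12 true) false (.push 12 false)) (.mv 12 6)

theorem runs_decrement (O : List Bool → List Bool) (s : Regs) (h12 : s.r12 = []) :
    Runs O .decrement s.toStk (8 * s.r6.length + 6) (s.set 6 (decBits s.r6)).toStk := by
  have loop : ∀ (l : List Bool) (s : Regs), s.r6 = l → ∃ u v, u.length + v.length = l.length ∧
      decBits l = u ++ v ∧ Runs O (.wh 6 true (.push 12 true) false (.push 12 false)) s.toStk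
        (4 * l.length + 1) ((s.set 6 v).set 12 (u.reverse ++ s.r12)).toStk := by
    intro l
    induction l with
    | nil =>
      intro s hs
      refine ⟨[], [], rfl, rfl, (Runs.wh_nil hs).congr le_rfl ?_⟩
      rw [List.reverse_nil, List.nil_append, ← hs]
      rfl
    | cons b l ih =>
      intro s hs
      cases b
      · obtain ⟨u, v, hl, hd, h⟩ := ih ((s.set 6 l).set 12 (true :: s.r12)) rfl
        refine ⟨true :: u, v, by simp; omega, by rw [decBits, hd]; rfl, ?_⟩
        refine (Runs.whR (b := false) (show s.toStk 6 = _ from hs) (by norm_num) rfl (Runs.pushR _ 12 true) h).congr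
          (by simp; omega) ?_
        simp only [Regs.set, List.reverse_cons, List.append_assoc, List.singleton_append]
      · refine ⟨[false], l, by simp; omega, rfl, ?_⟩
        exact (Runs.wh_stopR (b := true) (show s.toStk 6 = _ from hs) (by norm_num) rfl (Runs.pushR _ 12 false)).mono
          (by simp; omega)
  obtain ⟨u, v, hl, hd, h⟩ := loop s.r6 s rfl
  refine (h.seq (Runs.mv _)).congr ?_ ?_
  · simp only [Regs.set, Regs.toStk, h12, List.append_nil, List.length_reverse]
    omega
  · simp only [Regs.set, Regs.toStk, h12, List.append_nil, List.reverse_reverse, hd]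

/-- Compares the numbers of bits on the stacks `17` and `19`. -/
def Prog.compare : Prog :=
  .seq (.wh 17 true (.cs 19 (.push 20 true) .skip .skip) true (.cs 19 (.push 20 true) .skip .skip))
    (.clr 19)

theorem runs_compare (O : List Bool → List Bool) (s : Regs) (a b : ℕ)
    (h17 : s.r17 = List.replicate a true) (h19 : s.r19 = List.replicate b true) (h20 : s.r20 = []) :
    Runs O .compare s.toStk (7 * a + 3 * b + 2)
      (((s.set 17 []).set 19 []).set 20 (List.replicate (a - b) true)).toStk := by
  have e₁ := Runs.drain (O := O) (r := 17) (k := 4) (P₀ := .cs 19 (.push 20 true) .skip .skip)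
    (P₁ := .cs 19 (.push 20 true) .skip .skip)
    (fun i => ((s.set 17 ((List.replicate a true).drop i)).set 19 (List.replicate (b - i) true)).set 20
      (List.replicate (i - b) true)) (List.replicate a true) (by norm_num) (fun _ _ => rfl) (by
      intro i hi
      rw [ite_self]
      by_cases hib : b ≤ i
      · rw [Nat.sub_eq_zero_of_le hib, Nat.sub_eq_zero_of_le (by omega : b ≤ i + 1)]
        refine (Runs.cs_nil rfl (Runs.pushR _ 20 true)).congr le_rfl ?_
        simp only [Regs.set, Regs.toStk, show i + 1 - b = (i - b) + 1 by omega, List.replicate_succ]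
      · have : Regs.toStk ((((s.set 17 ((List.replicate a true).drop i)).set 19
            (List.replicate (b - i) true)).set 20 (List.replicate (i - b) true)).set 17
              ((List.replicate a true).drop (i + 1))) 19 = true :: List.replicate (b - (i + 1)) true := by
          simp only [Regs.set, Regs.toStk, show b - i = (b - (i + 1)) + 1 by omega,
            List.replicate_succ]
        refine (Runs.cs_trueR (s' := ((s.set 17 ((List.replicate a true).drop (i + 1))).set 19
          (List.replicate (b - (i + 1)) true)).set 20 (List.replicate (i + 1 - b) true)) this
            (by norm_num) (Runs.skip.congr le_rfl ?_)).mono (by norm_num)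
        simp only [Regs.set, show i - b = 0 by omega, show i + 1 - b = 0 by omega])
  rw [List.length_replicate] at e₁
  have e₁' : Runs O (.wh 17 true (.cs 19 (.push 20 true) .skip .skip) true
      (.cs 19 (.push 20 true) .skip .skip)) s.toStk (a * 7 + 1)
      (((s.set 17 []).set 19 (List.replicate (b - a) true)).set 20
        (List.replicate (a - b) true)).toStk := by
    convert e₁ using 2
    · rw [List.drop_zero, Nat.sub_zero, Nat.zero_sub, List.replicate_zero, ← h17, ← h19, ← h20]
      rfl
    · rw [List.drop_of_length_le (by simp)]
  refine (e₁'.seq (Runs.clr _)).congr ?_ ?_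
  · simp only [Regs.set, Regs.toStk, List.length_replicate]
    omega
  · simp only [Regs.set]

open Polynomial (C X)

/-- Writes the two numbers that are to be compared. -/
def Prog.weigh : Prog :=
  .seq (.push 17 true) (.seq (.forEach 11 1 (.pushN 17 true 1) (.pushN 17 true 1))
    (.seq (.forEach 6 1 (.pushN 17 true 4) (.pushN 17 true 4)) (.seq (.pushN 19 true 5)
      (.seq (.forEach 8 1 (.pushN 19 true 2) (.pushN 19 true 2))
        (.forEach 3 1 (.pushN 19 true 1) (.pushN 19 true 1))))))

/-- Writes on stack `20` whether the answer is large. -/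
def Prog.judge : Prog := .cs 17 (.clr 3) .skip (.seq .weigh (.seq (.clr 3) .compare))

/-- The two sides of the inequality in `isLarge` are written in unary and subtracted with
truncation, so stack 20 is nonempty exactly if the inequality is strict. The case of an empty stack
17 is separate because the numerator has to be positive. -/
theorem runs_judge (O : List Bool → List Bool) (s : Regs) (a : ℕ) (h1 : s.r1 = [])
    (h17 : s.r17 = List.replicate a true) (h19 : s.r19 = []) (h20 : s.r20 = []) :
    Runs O .judge s.toStk (7 * a + 15 * s.r3.length + 16 * s.r11.length + 40 * s.r6.length +
      16 * s.r8.length + 40) (((s.set 3 []).set 17 []).set 20 (List.replicate (if 0 < a then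
        (a + (s.r11.length + 4 * s.r6.length)) - (s.r3.length + (2 * s.r8.length + 5)) else 0) true)).toStk := by
  rcases Nat.eq_zero_or_pos a with rfl | ha
  · rw [List.replicate_zero] at h17
    refine (Runs.cs_nil h17 (Runs.clr _)).congr ?_ ?_
    · simp only [Regs.toStk]; omega
    · rw [if_neg (lt_irrefl 0), List.replicate_zero]
      simp only [Regs.set, h17, h20]
  · rw [if_pos ha]
    have h17' : s.toStk 17 = true :: List.replicate (a - 1) true := by
      rw [← List.replicate_succ, show a - 1 + 1 = a by omega, ← h17]; rfl
    have e₁ : Runs O .weigh (s.set 17 (List.replicate (a - 1) true)).toStk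
        (9 * s.r3.length + 9 * s.r11.length + 12 * s.r6.length + 10 * s.r8.length + 14)
        ((s.set 17 (List.replicate (a + (s.r11.length + 4 * s.r6.length)) true)).set 19
          (List.replicate (s.r3.length + (2 * s.r8.length + 5)) true)).toStk := by
      refine ((Runs.pushR _ 17 true).seq ((Runs.forEach_push (r := 11) (t := 1) (d := 17) _
        (by simp only [Regs.set, Regs.toStk, h1]) 1).seq ((Runs.forEach_push (r := 6) (t := 1) (d := 17) _
        (by simp only [Regs.set, Regs.toStk, h1]) 4).seq ((Runs.pushN _ true 5).seq
        ((Runs.forEach_push (r := 8) (t := 1) (d := 19) _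
        (by simp only [Regs.set, Regs.toStk, h1]) 2).seq (Runs.forEach_push (r := 3) (t := 1) (d := 19) _
        (by simp only [Regs.set, Regs.toStk, h1]) 1)))))).congr ?_ ?_
      · simp only [Regs.set, Regs.toStk]; omega
      · simp only [Regs.set, Regs.toStk, h19, List.append_nil, ← List.replicate_succ,
          ← List.replicate_add]
        congr 3 <;> omega
    have e₂ := runs_compare O (((s.set 17 (List.replicate (a + (s.r11.length + 4 * s.r6.length))
      true)).set 19 (List.replicate (s.r3.length + (2 * s.r8.length + 5)) true)).set 3 [])
      (a + (s.r11.length + 4 * s.r6.length)) (s.r3.length + (2 * s.r8.length + 5))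
      (by simp only [Regs.set]) (by simp only [Regs.set]) (by simp only [Regs.set, h20])
    refine (Runs.cs_trueR h17' (by norm_num) (e₁.seq ((Runs.clr _).seq e₂))).congr ?_ ?_
    · simp only [Regs.set, Regs.toStk]; omega
    · simp only [Regs.set, h19]

/-- Decreases the number on stack `6` if stack `20` is not empty. -/
def Prog.adjust : Prog := .cs 20 .skip .skip (.seq .decrement (.clr 20))

theorem runs_adjust (O : List Bool → List Bool) (s : Regs) (n : ℕ) (h12 : s.r12 = [])
    (h20 : s.r20 = List.replicate n true) :
    Runs O .adjust s.toStk (8 * s.r6.length + 3 * n + 10)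
      ((s.set 6 (if 0 < n then decBits s.r6 else s.r6)).set 20 []).toStk := by
  rcases Nat.eq_zero_or_pos n with rfl | hn
  · rw [List.replicate_zero] at h20
    refine (Runs.cs_nil h20 Runs.skip).congr (by omega) ?_
    rw [if_neg (lt_irrefl 0), ← h20]
    rfl
  · rw [if_pos hn]
    have h20' : s.toStk 20 = true :: List.replicate (n - 1) true := by
      rw [← List.replicate_succ, show n - 1 + 1 = n by omega, ← h20]; rfl
    refine (Runs.cs_trueR h20' (by norm_num) ((runs_decrement O _
      (by simp only [Regs.set, h12])).seq (Runs.clr _))).congr ?_ ?_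
    · simp only [Regs.set, Regs.toStk, List.length_replicate]; omega
    · simp only [Regs.set]

theorem length_encodeRat (v : ℚ) :
    (encodeRat v).length = 2 * v.num.natAbs.size + v.den.size + 3 := by
  have hl : ∀ l : List Bool, (l.flatMap fun b => [true, b]).length = 2 * l.length := by
    intro l; induction l <;> simp_all; omega
  rw [encodeRat, List.length_append, hl, encodeInt]
  simp only [List.length_cons, Nat.size_eq_bits_len]
  omega

/-! ### One query of the search -/

section Probe

variable (M : Machine) (R : ℕ)

/-- A query followed by the adjustment of the number on stack `6`. -/
def Prog.probe : Prog :=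
  .seq (.emitCircuit M R) (.seq .sendQuery (.seq .parse (.seq .judge .adjust)))

theorem runs_probe (b : Polynomial ℕ) : ∃ p : Polynomial ℕ, ∀ (O : List Bool → List Bool) (s : Regs)
    (v : ℚ) (B : ℕ), Ready M R s → s.r3 = [] → s.r17 = [] → s.r19 = [] → s.r20 = [] →
    s.r10.length ≤ B → s.r11.length + 4 * s.r6.length ≤ B →
    (∀ w, (O w).length ≤ b.eval w.length) →
    O (encodeUnary (queryGates M R s).length ++ queryGates M R s) = encodeRat v →
    Runs O (.probe M R) s.toStk (p.eval B) (s.set 6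
      (if isLarge v (s.r11.length + 4 * s.r6.length) s.r8.length then decBits s.r6 else s.r6)).toStk := by
  obtain ⟨p, hp⟩ := runs_emitCircuit M R
  refine ⟨p + (C 13 * p + C 5 + (C 45 * b.comp (C 2 * p + C 1) + C 100 * X + C 70)),
    fun O s v B hs h3 h17 h19 h20 hB hB' hb hv => ?_⟩
  have e₁ := hp O s B hs hB hB'
  have hG : (queryGates M R s).length ≤ p.eval B := by
    have := e₁.length_le (r := 2) (by norm_num)
    simpa only [Regs.toStk, Regs.set, hs.h2, List.length_nil, Nat.zero_add] using this
  have e₂ := runs_sendQuery O (s.set 2 (queryGates M R s)) (by simp only [Regs.set, hs.h13])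
    (by simp only [Regs.set, h17])
  -- The query is the gate code together with its length in unary, hence the argument 2p + 1; here
  -- the bound `b` on the length of the answers enters the running time.
  have hL : (encodeRat v).length ≤ b.eval (2 * p.eval B + 1) := by
    rw [← hv]
    refine (hb _).trans (eval_le_eval b ?_)
    simp only [encodeUnary, List.length_append, List.length_replicate, List.length_singleton]
    omega
  have hL' := length_encodeRat v
  generalize hqg : queryGates M R s = G at *
  have e₂' : Runs O .sendQuery (s.set 2 G).toStk (13 * p.eval B + 5) (s.set 3 (encodeRat v)).toStk := by
    refine e₂.congr ?_ ?_
    · simp only [Regs.set]; omega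
    · simp only [Regs.set, hv, hs.h2]
  have e₃ := runs_parse O (s.set 3 (encodeRat v)) v (by simp only [Regs.set])
    (by simp only [Regs.set, h17])
  have h8 := hs.h10
  have key : Runs O (.seq .parse (.seq .judge .adjust)) (s.set 3 (encodeRat v)).toStk
      (45 * (encodeRat v).length + 100 * B + 70) (s.set 6
      (if isLarge v (s.r11.length + 4 * s.r6.length) s.r8.length then decBits s.r6 else s.r6)).toStk := by
    by_cases h0 : 0 ≤ v.num
    · rw [if_pos h0] at e₃
      have e₄ := runs_judge O (((s.set 3 (encodeRat v)).set 3 v.den.bits).set 17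
        (List.replicate v.num.natAbs.bits.length true)) v.num.natAbs.bits.length
        (by simp only [Regs.set, hs.h1]) (by simp only [Regs.set]) (by simp only [Regs.set, h19])
        (by simp only [Regs.set, h20])
      have e₅ := e₄.seq (runs_adjust O _ _ (by simp only [Regs.set, hs.h12]) rfl)
      refine (e₃.seq e₅).congr ?_ ?_
      · simp only [Regs.set, Nat.size_eq_bits_len]
        split_ifs <;> omega
      · simp only [Regs.set, Nat.size_eq_bits_len, h3, h17, h20]
        congr 2
        rw [isLarge]
        have : 0 < v.num ↔ 0 < v.num.natAbs.size := by
          rw [Nat.size_pos]; omega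
        simp only [this, decide_eq_true_eq]
        split_ifs <;> first | rfl | omega
    · rw [if_neg h0] at e₃
      have e₄ := runs_judge O ((s.set 3 (encodeRat v)).set 3 []) 0
        (by simp only [Regs.set, hs.h1]) (by simp only [Regs.set, h17, List.replicate_zero])
        (by simp only [Regs.set, h19]) (by simp only [Regs.set, h20])
      have e₅ := e₄.seq (runs_adjust O _ _ (by simp only [Regs.set, hs.h12]) rfl)
      refine (e₃.seq e₅).congr ?_ ?_
      · simp only [Regs.set, lt_irrefl, if_false, List.length_nil]
        omega
      · have hl : isLarge v (s.r11.length + 4 * s.r6.length) s.r8.length = false := by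
          rw [isLarge, decide_eq_false_iff_not]; omega
        simp only [Regs.set, lt_irrefl, if_false, hl, h3, h17, h20, Bool.false_eq_true]
  refine (e₁.seq (e₂'.seq key)).congr ?_ rfl
  simp only [Polynomial.eval_add, Polynomial.eval_mul, Polynomial.eval_C, Polynomial.eval_X,
    Polynomial.eval_comp]
  omega

end Probe

open Polynomial (C X)

/-! ### Counting with the help of the oracle -/

section Search

variable (M : Machine) (R : ℕ)

/-- The search for a number with few bits. -/
def Prog.search : Prog :=
  .seq (.wh 16 true (.seq (.push 6 false) (.seq (.probe M R) (.seq (.probe M R) (.probe M R))))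
    true (.seq (.push 6 false) (.seq (.probe M R) (.seq (.probe M R) (.probe M R)))))
    (.seq (.cs 6 .skip .skip .skip) (.cs 6 .skip .skip .skip))

theorem length_iterate_stage (t : List Bool → Bool) (n : ℕ) (l : List Bool) :
    ((stage t)^[n] l).length = l.length + n := by
  induction n with
  | zero => rfl
  | succ n ih => rw [Function.iterate_succ_apply', length_stage, ih, Nat.add_assoc]

theorem Ready.set_six {s : Regs} (hs : Ready M R s) (l : List Bool) : Ready M R (s.set 6 l) :=
  ⟨hs.h1, hs.h2, hs.h4, hs.h5, hs.h7, hs.h10, hs.h11, hs.h12, hs.h13⟩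

theorem Ready.set_sixteen {s : Regs} (hs : Ready M R s) (l : List Bool) : Ready M R (s.set 16 l) :=
  ⟨hs.h1, hs.h2, hs.h4, hs.h5, hs.h7, hs.h10, hs.h11, hs.h12, hs.h13⟩

/-- The oracle is a function of the query and, with all other stacks fixed, the query is a function
of stack 6. So the answers define a fixed test `t` on candidates, and the abstract search applies.
-/
theorem runs_search (b : Polynomial ℕ) : ∃ p : Polynomial ℕ, ∀ (O : List Bool → List Bool) (s : Regs)
    (v : List Bool → ℚ) (n B : ℕ), Ready M R s → s.r3 = [] → s.r17 = [] → s.r19 = [] → s.r20 = [] →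
    s.r6 = [true] → s.r16 = List.replicate n true →
    s.r10.length ≤ B → s.r11.length + 4 * (n + 1) ≤ B → (∀ w, (O w).length ≤ b.eval w.length) →
    (∀ ch, O (encodeUnary (queryGates M R (s.set 6 ch)).length ++ queryGates M R (s.set 6 ch)) =
      encodeRat (v ch)) →
    Runs O (.search M R) s.toStk (p.eval B) ((s.set 16 []).set 6 (((stage fun ch =>
      isLarge (v ch) (s.r11.length + 4 * ch.length) s.r8.length)^[n] [true]).drop 2)).toStk := by
  obtain ⟨p, hp⟩ := runs_probe M R b
  refine ⟨X * (C 3 * p + C 4) + C 7, fun O s v n B hs h3 h17 h19 h20 h6 h16 hB hB' hb hv => ?_⟩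
  set t : List Bool → Bool := fun ch =>
      isLarge (v ch) (s.r11.length + 4 * ch.length) s.r8.length with ht
  have hprobe : ∀ u ch : List Bool, ch.length ≤ n + 1 → Runs O (.probe M R)
      ((s.set 16 u).set 6 ch).toStk (p.eval B) ((s.set 16 u).set 6 (probe t ch)).toStk := by
    intro u ch hch
    refine (hp O ((s.set 16 u).set 6 ch) (v ch) B ((hs.set_sixteen M R u).set_six M R ch) h3 h17 h19 h20
      hB (le_trans ?_ hB') hb (hv ch)).congr le_rfl ?_
    · simp only [Regs.set]; omega
    · simp only [Regs.set, probe, ht]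
  have hbody : ∀ u ch : List Bool, ch.length ≤ n → Runs O
      (.seq (.push 6 false) (.seq (.probe M R) (.seq (.probe M R) (.probe M R))))
      ((s.set 16 u).set 6 ch).toStk (3 * p.eval B + 1) ((s.set 16 u).set 6 (stage t ch)).toStk := by
    intro u ch hch
    have e₁ : Runs O (.push 6 false) ((s.set 16 u).set 6 ch).toStk 1
        ((s.set 16 u).set 6 (false :: ch)).toStk := Runs.pushR _ 6 false
    refine (e₁.seq ((hprobe u _ (by simpa using hch)).seq ((hprobe u _ (by simpa using hch)).seq
      (hprobe u _ (by simpa using hch))))).congr (by omega) rfl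
  have e₁ := Runs.drain (O := O) (r := 16) (k := 3 * p.eval B + 1)
    (P₀ := .seq (.push 6 false) (.seq (.probe M R) (.seq (.probe M R) (.probe M R))))
    (P₁ := .seq (.push 6 false) (.seq (.probe M R) (.seq (.probe M R) (.probe M R))))
    (fun i => (s.set 16 ((List.replicate n true).drop i)).set 6 ((stage t)^[i] [true]))
    (List.replicate n true) (by norm_num) (fun _ _ => rfl) (by
      intro i hi
      rw [List.length_replicate] at hi
      rw [ite_self, Function.iterate_succ_apply']
      exact hbody _ _ (by
        show ((stage t)^[i] [true]).length ≤ n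
        rw [length_iterate_stage, List.length_singleton]; omega))
  rw [List.length_replicate, List.drop_zero, List.drop_of_length_le (l := List.replicate n true)
    (by simp)] at e₁
  have e₀ : s = (s.set 16 (List.replicate n true)).set 6 ((stage t)^[0] [true]) := by
    rw [← h16, Function.iterate_zero, id, ← h6]; rfl
  rw [← e₀] at e₁
  have hdrop : ∀ ch : List Bool, Runs O (.cs 6 .skip .skip .skip) ((s.set 16 []).set 6 ch).toStk 3
      ((s.set 16 []).set 6 (ch.drop 1)).toStk := by
    intro ch
    rcases ch with _ | ⟨c, ch⟩
    · exact Runs.cs_nil rfl Runs.skip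
    · cases c
      · exact Runs.cs_falseR (k := 0) rfl (by norm_num) Runs.skip
      · exact Runs.cs_trueR (k := 0) rfl (by norm_num) Runs.skip
  refine (e₁.seq ((hdrop _).seq (hdrop _))).congr ?_ ?_
  · simp only [Polynomial.eval_add, Polynomial.eval_mul, Polynomial.eval_C, Polynomial.eval_X]
    have : n * (3 * p.eval B + 1 + 3) ≤ B * (3 * p.eval B + 4) := Nat.mul_le_mul_right _ (by omega)
    omega
  · rw [List.drop_drop]

end Search

/-- Writes the value of a polynomial in unary on the stack `d`. -/
theorem exists_fill (p : Polynomial ℕ) {d : ℕ} (hd : d < 24) (h14 : d ≠ 14) :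
    ∃ (Q : Prog) (c : Polynomial ℕ), ∀ (O : List Bool → List Bool) (s : Regs),
      s.r1 = [] → s.r14 = [] → s.r15 = [] → s.toStk d = [] → Runs O Q s.toStk (c.eval s.r0.length)
        (s.set d (List.replicate (p.eval s.r0.length) true)).toStk := by
  obtain ⟨Q, c, h⟩ := exists_unary_polynomial p
  refine ⟨.seq Q (.mv 14 d), c + (C 4 * p + C 1), fun O s hr1 hr14 hr15 hrd => ?_⟩
  refine ((h O s hr1 hr14 hr15).seq (Runs.mv _ h14.symm (by norm_num) hd)).congr ?_ ?_
  · have : (s.set 14 (List.replicate (p.eval s.r0.length) true)).toStk 14 =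
      List.replicate (p.eval s.r0.length) true := rfl
    simp [this]
  · rw [← Regs.update_toStk _ hd, ← Regs.update_toStk _ hd, ← Regs.update_toStk _ (by norm_num),
      ← Regs.update_toStk _ (by norm_num), Function.update_idem, Function.update_self,
      Function.update_of_ne h14, hrd, List.append_nil, List.reverse_replicate]
    congr 1
    rw [show [] = s.toStk 14 from hr14.symm, Function.update_eq_self]

/-- Finitely many stacks are popped; a stack that is only pushed cannot influence the run and needs
no variables. The lower bound 2 keeps the input, the output and the certificate in the tableau. -/
theorem exists_below (M : Machine) : ∃ R, 2 ≤ R ∧ ∀ i ∈ M, i.Below R := by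
  induction M with
  | nil => exact ⟨2, le_rfl, by simp⟩
  | cons i M ih =>
    obtain ⟨R, hR, h⟩ := ih
    have hmono : ∀ (i : Instr) (R' : ℕ), R ≤ R' → i.Below R → i.Below R' := by
      intro i R' hR' hi
      cases i <;> simp_all [Instr.Below]
      omega
    cases i with
    | pop r e z o =>
      refine ⟨max R (r + 1), by omega, fun i hi => ?_⟩
      rcases List.mem_cons.1 hi with rfl | hi
      · simp [Instr.Below]
      · exact hmono i _ (by omega) (h i hi)
    | push r b =>
      refine ⟨R, hR, fun i hi => ?_⟩
      rcases List.mem_cons.1 hi with rfl | hi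
      · trivial
      · exact h i hi
    | ask =>
      refine ⟨R, hR, fun i hi => ?_⟩
      rcases List.mem_cons.1 hi with rfl | hi
      · trivial
      · exact h i hi

open Polynomial (C X)

/-- The query encodes the comparison circuit of `exists_comparison_circuit`, whose gates are no more
than its qubits; so `hP` applies to the answer and `isLarge_spec` concludes. -/
theorem testSpec_of_good {P : EstimationProblem} (hP : P.Good) {M : Machine} {R : ℕ}
    (hM : ∀ i ∈ M, i.Below R) (hR : 2 ≤ R) {V : List Bool → List Bool → Bool} {s : Regs} {q : ℕ}
    (hV : ∀ y : Fin q → Bool,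
      OutputsWithin noOracle M [s.r0, List.ofFn y] s.r9.length [V s.r0 (List.ofFn y)])
    (hs : Ready M R s) (hq : s.r8.length = q) {v : List Bool → ℚ}
    (hv : ∀ ch, v ch ∈ P (encodeUnary (queryGates M R (s.set 6 ch)).length ++
      queryGates M R (s.set 6 ch))) :
    TestSpec q (Finset.univ.filter fun y : Fin q → Bool => V s.r0 (List.ofFn y) = true).card
      fun ch => isLarge (v ch) (s.r11.length + 4 * ch.length) s.r8.length := by
  intro ch h0
  have hG : queryGates M R (s.set 6 ch) = gateCode
      (numVars M R (hgt s.r0 q s.r9.length) (rowsOf s.r0 q s.r9.length) ch)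
      (allMonos M R (hgt s.r0 q s.r9.length) (rowsOf s.r0 q s.r9.length) ch).reverse := by
    rw [← hq]; rfl
  have hv := hv ch
  generalize queryGates M R (s.set 6 ch) = G at *
  obtain ⟨D, h1, h2, h3, h4⟩ := exists_comparison_circuit hM hR ch hV rfl hG
  rw [← h2] at hv
  have hN : numVars M R (hgt s.r0 q s.r9.length) (rowsOf s.r0 q s.r9.length) ch =
      s.r11.length + 4 * ch.length := by
    rw [numVars, hs.h11, length_rowsOf, hs.h10, hq,
      show hgt s.r0 q s.r9.length = s.r0.length + q + s.r9.length + 2 from rfl]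
    omega
  rw [hN] at h3 h4
  have h11 := hs.h11
  have := isLarge_spec (q := s.r8.length) (sub_nonneg.2 h0) (by omega) h3 h4 (hP _ D _ h1 hv).1
    (hP _ D _ h1 hv).2
  simpa only [hq] using this

theorem card_filter_ofFn_le (q : ℕ) (p : List Bool → Bool) :
    (Finset.univ.filter fun y : Fin q → Bool => p (List.ofFn y) = true).card ≤ 2 ^ q :=
  (Finset.card_le_univ _).trans (by simp)

/-- Functions in `#P` can be computed with the help of an oracle. -/
theorem exists_count {P : EstimationProblem} (hP : P.Good) {f : List Bool → ℕ} (hf : IsSharpP f)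
    (b : Polynomial ℕ) : ∃ (Q : Prog) (p : Polynomial ℕ), ∀ A : List Bool → List Bool,
      Solves P b A → ∀ x u : List Bool, ∃ l, bval l = f x ∧
        Runs A Q (Regs.toStk { r0 := x, r18 := u }) (p.eval x.length)
          (Regs.toStk { r0 := x, r6 := l, r18 := u }) := by
  obtain ⟨V, q, ⟨M, pT, hM⟩, hf⟩ := hf
  obtain ⟨R, hR, hB⟩ := exists_below M
  obtain ⟨Q₁, c₁, h₁⟩ := exists_fill q (d := 8) (by norm_num) (by norm_num)
  obtain ⟨Q₂, c₂, h₂⟩ := exists_fill (pT.comp (X + q)) (d := 9) (by norm_num) (by norm_num)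
  set k : Polynomial ℕ := X + q + pT.comp (X + q) with hk
  obtain ⟨Q₃, c₃, h₃⟩ := exists_fill k (d := 10) (by norm_num) (by norm_num)
  -- The position behind a tableau with k + 1 rows and k + 2 columns, plus 4; together with four
  -- variables for each digit of the candidate this is the number of variables.
  set a : Polynomial ℕ := C 10 + (k + C 1) * ((k + C 2) * C (bw M R)) + C 4 with ha
  obtain ⟨Q₄, c₄, h₄⟩ := exists_fill a (d := 11) (by norm_num) (by norm_num)
  obtain ⟨Q₅, c₅, h₅⟩ := exists_fill (q + C 2) (d := 16) (by norm_num) (by norm_num)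
  obtain ⟨p, hp⟩ := runs_search M R b
  refine ⟨.seq Q₁ (.seq Q₂ (.seq Q₃ (.seq Q₄ (.seq Q₅ (.seq (.push 6 true) (.seq (.search M R)
    (.seq (.clr 8) (.seq (.clr 9) (.seq (.clr 10) (.clr 11)))))))))),
    c₁ + (c₂ + (c₃ + (c₄ + (c₅ + (C 1 + (p.comp (k + a + C 4 * (q + C 3)) +
      (C 3 * q + C 1 + (C 3 * pT.comp (X + q) + C 1 + (C 3 * k + C 1 + (C 3 * a + C 1)))))))))),
    fun A hA x u => ?_⟩
  set n := x.length with hn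
  set s : Regs := { r0 := x, r6 := [true], r8 := List.replicate (q.eval n) true,
                    r9 := List.replicate ((pT.comp (X + q)).eval n) true,
                    r10 := List.replicate (k.eval n) true,
                    r11 := List.replicate (a.eval n) true,
                    r16 := List.replicate (q.eval n + 2) true, r18 := u } with hs
  have hready : Ready M R s := by
    constructor <;> simp only [hs, List.length_replicate]
    · simp only [hk, Polynomial.eval_add, Polynomial.eval_X, ← hn]
    · simp only [ha, base, Polynomial.eval_add, Polynomial.eval_mul, Polynomial.eval_C]
  have hex : ∀ ch : List Bool, ∃ r ∈ P (encodeUnary (queryGates M R (s.set 6 ch)).length ++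
      queryGates M R (s.set 6 ch)), A (encodeUnary (queryGates M R (s.set 6 ch)).length ++
      queryGates M R (s.set 6 ch)) = encodeRat r := fun ch => (hA _).2
  choose v hv hv' using hex
  have hspec := testSpec_of_good hP hB hR (V := V) (s := s) (q := q.eval n) (fun y => by
    have := hM x (List.ofFn y)
    simp only [hs, List.length_replicate]
    simpa only [List.length_ofFn, Polynomial.eval_comp, Polynomial.eval_add, Polynomial.eval_X] using this)
    hready (by simp only [hs, List.length_replicate]) hv
  have hres := search_spec hspec (card_filter_ofFn_le _ _)
  have hrun := hp A s v (q.eval n + 2) ((k + a + C 4 * (q + C 3)).eval n) hready rfl rfl rfl rfl rfl rfl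
    (by
      simp only [hs, List.length_replicate, Polynomial.eval_add]
      omega)
    (by
      simp only [hs, List.length_replicate, Polynomial.eval_add, Polynomial.eval_mul, Polynomial.eval_C]
      omega) (fun w => (hA w).1) hv'
  generalize List.drop 2 ((stage fun ch => isLarge (v ch) (s.r11.length + 4 * ch.length)
    s.r8.length)^[q.eval n + 2] [true]) = l at hres hrun
  refine ⟨l, ?_, ?_⟩
  · rw [hres, hf]
  have e₁ := h₁ A { r0 := x, r18 := u } rfl rfl rfl rfl
  have e₂ := h₂ A { r0 := x, r8 := List.replicate (q.eval n) true, r18 := u } rfl rfl rfl rfl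
  have e₃ := h₃ A { r0 := x, r8 := List.replicate (q.eval n) true,
                    r9 := List.replicate ((pT.comp (X + q)).eval n) true, r18 := u } rfl rfl rfl rfl
  have e₄ := h₄ A { r0 := x, r8 := List.replicate (q.eval n) true,
                    r9 := List.replicate ((pT.comp (X + q)).eval n) true,
                    r10 := List.replicate (k.eval n) true, r18 := u } rfl rfl rfl rfl
  have e₅ := h₅ A { r0 := x, r8 := List.replicate (q.eval n) true,
                    r9 := List.replicate ((pT.comp (X + q)).eval n) true,
                    r10 := List.replicate (k.eval n) true,
                    r11 := List.replicate (a.eval n) true, r18 := u } rfl rfl rfl rfl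
  have e₆ : Runs A (.push 6 true) (Regs.toStk {
                    r0 := x, r8 := List.replicate (q.eval n) true,
                    r9 := List.replicate ((pT.comp (X + q)).eval n) true,
                    r10 := List.replicate (k.eval n) true,
                    r11 := List.replicate (a.eval n) true,
                    r16 := List.replicate (q.eval n + 2) true, r18 := u }) 1 s.toStk :=
    Runs.pushR _ 6 true
  have e₇ : Runs A (.seq (.clr 8) (.seq (.clr 9) (.seq (.clr 10) (.clr 11))))
      ((s.set 16 []).set 6 l).toStk ((C 3 * q + C 1 + (C 3 * pT.comp (X + q) + C 1 +
        (C 3 * k + C 1 + (C 3 * a + C 1)))).eval n) (Regs.toStk { r0 := x, r6 := l, r18 := u }) := by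
    refine ((Runs.clr _).seq ((Runs.clr _).seq ((Runs.clr _).seq (Runs.clr _)))).congr ?_ ?_
    · simp only [Regs.set, Regs.toStk, hs, List.length_replicate, Polynomial.eval_add,
        Polynomial.eval_mul, Polynomial.eval_C]
      exact le_rfl
    · simp only [Regs.set, hs]
  simp only [Regs.set, Polynomial.eval_add, Polynomial.eval_C, ← hn] at e₁ e₂ e₃ e₄ e₅ e₆ e₇ hrun ⊢
  refine (e₁.seq (e₂.seq (e₃.seq (e₄.seq (e₅.seq (e₆.seq (hrun.seq e₇))))))).congr ?_ rfl
  simp only [Polynomial.eval_comp, Polynomial.eval_add, Polynomial.eval_mul, Polynomial.eval_C]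
  exact le_rfl

open Polynomial (C X)

/-! ### Subtraction -/

namespace Prog

/-- One step of the subtraction: writes a bit and the borrow. -/
def subBit (a b c : Bool) : Prog :=
  .seq (.push 12 (xor a (xor b c))) (if (!a && (b || c)) || (b && c) then .push 20 true else .skip)

/-- Reads the borrow. -/
def subBorrow (a b : Bool) : Prog := .cs 20 (subBit a b false) (subBit a b false) (subBit a b true)

/-- Reads a bit of the second number. -/
def subSecond (a : Bool) : Prog := .cs 6 (subBorrow a false) (subBorrow a false) (subBorrow a true)

/-- One step of the subtraction. -/
def subStep : Prog := .cs 4 (subSecond false) (subSecond false) (subSecond true)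

/-- Subtracts the number on stack `6` from that on stack `4`. -/
def sub : Prog :=
  .seq (.forEach 4 1 (.pushN 16 true 1) (.pushN 16 true 1))
    (.seq (.forEach 6 1 (.pushN 16 true 1) (.pushN 16 true 1)) (.wh 16 true subStep true subStep))

end Prog

/-- A borrow. -/
def borrow (c : Bool) : List Bool := if c then [true] else []

theorem runs_subBit (O : List Bool → List Bool) (s : Regs) (h20 : s.r20 = []) (a b c : Bool) :
    Runs O (.subBit a b c) s.toStk 2 ((s.set 12 (xor a (xor b c) :: s.r12)).set 20
      (borrow ((!a && (b || c)) || (b && c)))).toStk := by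
  have e := Runs.pushR (O := O) s 12 (xor a (xor b c))
  cases h : ((!a && (b || c)) || (b && c))
  · rw [Prog.subBit, h]
    exact (e.seq Runs.skip).congr (by norm_num) (by rw [borrow, if_neg (by simp), ← h20]; rfl)
  · rw [Prog.subBit, h]
    exact (e.seq (Runs.pushR _ 20 true)).congr (by norm_num) (by
      simp only [Regs.set, Regs.toStk, h20, borrow, if_true])

/-- Reading an empty stack as `false` extends numbers by leading zeros, so that operands of
different lengths need no special treatment. -/
theorem runs_cs_tail {O : List Bool → List Bool} {P : Bool → Prog} {s s' : Regs} {r k : ℕ}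
    (hr : r < 24) (h : Runs O (P ((s.toStk r).headD false)) (s.set r (s.toStk r).tail).toStk k s'.toStk) :
    Runs O (.cs r (P false) (P false) (P true)) s.toStk (k + 3) s'.toStk := by
  cases hs : s.toStk r with
  | nil =>
    rw [hs] at h
    have : (s.set r []).toStk = s.toStk := by
      rw [← Regs.update_toStk _ hr, ← hs, Function.update_eq_self]
    rw [List.tail_nil, this] at h
    exact Runs.cs_nil hs h
  | cons b t =>
    rw [hs] at h
    cases b
    · exact Runs.cs_falseR hs hr h
    · exact Runs.cs_trueR hs hr h

theorem runs_subStep (O : List Bool → List Bool) (s : Regs) (c : Bool) (h20 : s.r20 = borrow c) :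
    Runs O .subStep s.toStk 11 ((((s.set 4 s.r4.tail).set 6 s.r6.tail).set 12
      (xor (s.r4.headD false) (xor (s.r6.headD false) c) :: s.r12)).set 20
      (borrow ((!(s.r4.headD false) && (s.r6.headD false || c)) || (s.r6.headD false && c)))).toStk := by
  have hc : (s.r20.headD false) = c := by rw [h20]; cases c <;> rfl
  have ht : s.r20.tail = [] := by rw [h20]; cases c <;> rfl
  have e₁ : ∀ (s' : Regs) (a b : Bool), s'.r20 = s.r20 → Runs O (.subBorrow a b) s'.toStk 5
      ((s'.set 12 (xor a (xor b c) :: s'.r12)).set 20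
        (borrow ((!a && (b || c)) || (b && c)))).toStk := by
    intro s' a b hs'
    refine runs_cs_tail (P := .subBit a b) (k := 2) (by norm_num) ?_
    rw [show s'.toStk 20 = s.r20 from hs', hc, ht]
    refine (runs_subBit O _ (by simp only [Regs.set]) _ _ _).congr le_rfl ?_
    simp only [Regs.set]
  have e₂ : ∀ (s' : Regs) (a : Bool), s'.r20 = s.r20 → Runs O (.subSecond a) s'.toStk 8
      (((s'.set 6 s'.r6.tail).set 12 (xor a (xor (s'.r6.headD false) c) :: s'.r12)).set 20
        (borrow ((!a && (s'.r6.headD false || c)) || (s'.r6.headD false && c)))).toStk := by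
    intro s' a hs'
    exact runs_cs_tail (P := .subBorrow a) (k := 5) (by norm_num) (e₁ _ _ _ hs')
  exact runs_cs_tail (P := .subSecond) (k := 8) (by norm_num) (e₂ _ _ rfl)

theorem bval_eq_head_tail (l : List Bool) :
    bval l = (l.headD false).toNat + 2 * bval l.tail := by
  cases l <;> simp [bval]

/-- The written bits are the difference modulo 2^n and the last borrow is its sign. The full
subtractor is verified on all values of the two bits and the borrows. -/
theorem runs_sub_loop (O : List Bool → List Bool) (n : ℕ) : ∀ (s : Regs) (c : Bool),
    s.r20 = borrow c → s.r16 = List.replicate n true → s.r4.length ≤ n → s.r6.length ≤ n →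
    ∃ (o : List Bool) (c' : Bool), o.length = n ∧
      (bval s.r4 : ℤ) - bval s.r6 - c.toNat = bval o - 2 ^ n * c'.toNat ∧
      Runs O (.wh 16 true .subStep true .subStep) s.toStk (14 * n + 1)
        (((((s.set 4 []).set 6 []).set 16 []).set 12 (o.reverse ++ s.r12)).set 20 (borrow c')).toStk := by
  induction n with
  | zero =>
    intro s c h20 h16 h4 h6
    have h4 : s.r4 = [] := List.eq_nil_of_length_eq_zero (by omega)
    have h6 : s.r6 = [] := List.eq_nil_of_length_eq_zero (by omega)
    refine ⟨[], c, rfl, by simp [h4, h6, bval], (Runs.wh_nil h16).congr le_rfl ?_⟩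
    rw [List.replicate_zero] at h16
    cases s
    simp only at h4 h6 h16 h20
    simp only [Regs.set, ← h20, List.reverse_nil, List.nil_append, h4, h6, h16]
  | succ n ih =>
    intro s c h20 h16 h4 h6
    obtain ⟨o, c', ho, hv, h⟩ := ih ((((((s.set 16 (List.replicate n true)).set 4 s.r4.tail).set 6
      s.r6.tail).set 12 (xor (s.r4.headD false) (xor (s.r6.headD false) c) :: s.r12)).set 20
      (borrow ((!(s.r4.headD false) && (s.r6.headD false || c)) || (s.r6.headD false && c))))) _ rfl rfl
      (by simp only [Regs.set, List.length_tail]; omega)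
      (by simp only [Regs.set, List.length_tail]; omega)
    refine ⟨xor (s.r4.headD false) (xor (s.r6.headD false) c) :: o, c', by rw [List.length_cons, ho],
      ?_, ?_⟩
    · simp only [Regs.set] at hv
      rw [bval_eq_head_tail s.r4, bval_eq_head_tail s.r6, bval]
      push_cast
      generalize (bval s.r4.tail : ℤ) = a at *
      generalize (bval s.r6.tail : ℤ) = b at *
      generalize (bval o : ℤ) = e at *
      generalize s.r4.headD false = x at *
      generalize s.r6.headD false = y at *
      rw [pow_succ]
      cases x <;> cases y <;> cases c <;> cases c' <;> simp at hv ⊢ <;> linarith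
    · have e := runs_subStep O (s.set 16 (List.replicate n true)) c h20
      refine (Runs.whR (b := true) (by rw [Regs.toStk, h16, List.replicate_succ]) (by norm_num) rfl e
        (h.congr le_rfl ?_)).mono (by omega)
      simp only [Regs.set, List.reverse_cons, List.append_assoc, List.singleton_append]

/-- The negative of a number modulo a power of two. -/
def negBits : List Bool → List Bool
  | [] => []
  | false :: l => false :: negBits l
  | true :: l => true :: l.map (!·)

theorem length_negBits (l : List Bool) : (negBits l).length = l.length := by
  induction l with
  | nil => rfl
  | cons b l ih => cases b <;> simp [negBits, ih]

theorem bval_map_not (l : List Bool) : bval (l.map (!·)) + bval l + 1 = 2 ^ l.length := by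
  induction l with
  | nil => rfl
  | cons b l ih =>
    simp only [List.map_cons, bval, List.length_cons, pow_succ]
    cases b <;> simp <;> omega

theorem bval_negBits {l : List Bool} (h : 0 < bval l) : bval (negBits l) + bval l = 2 ^ l.length := by
  induction l with
  | nil => simp [bval] at h
  | cons b l ih =>
    cases b
    · simp only [bval, negBits, List.length_cons, pow_succ, Bool.toNat_false] at h ⊢
      have := ih (by omega)
      omega
    · have := bval_map_not l
      simp only [bval, negBits, List.length_cons, pow_succ, Bool.toNat_true]
      omega

theorem bval_lt (l : List Bool) : bval l < 2 ^ l.length := by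
  have := bval_map_not l
  omega

/-- `encodeInt` asks for digits without leading zeros; these are at the end of the list here and on
top after a reversal, where they can be popped. -/
theorem exists_eq_bits_append (l : List Bool) :
    ∃ k, l = (bval l).bits ++ List.replicate k false := by
  induction l with
  | nil => exact ⟨0, by simp [bval]⟩
  | cons b l ih =>
    obtain ⟨k, hk⟩ := ih
    have hb : bval (b :: l) = Nat.bit b (bval l) := by
      rw [bval, Nat.bit_val, Nat.add_comm]
    by_cases h : bval l = 0 ∧ b = false
    · refine ⟨k + 1, ?_⟩
      rw [h.1, Nat.zero_bits, List.nil_append] at hk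
      rw [hb, h.1, h.2, List.replicate_succ, ← hk]
      simp
    · refine ⟨k, ?_⟩
      rw [hb, Nat.bits_append_bit _ _ (fun h0 => by
        by_contra hc
        exact h ⟨h0, by simpa using hc⟩), List.cons_append, ← hk]

theorem bits_reverse_head (n : ℕ) (h : 0 < n) : ∃ w, n.bits.reverse = true :: w := by
  induction n using Nat.binaryRec' with
  | zero => omega
  | bit b n hb ih =>
    rw [Nat.bits_append_bit _ _ hb, List.reverse_cons]
    rcases Nat.eq_zero_or_pos n with rfl | hn
    · rw [hb rfl]; exact ⟨[], by simp⟩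
    · obtain ⟨w, hw⟩ := ih hn
      exact ⟨w ++ [b], by rw [hw]; rfl⟩

namespace Prog

/-- Moves stack `5` to stack `4` and replaces the number by its negative. -/
def neg : Prog :=
  .seq (.wh 5 true (.push 4 false) false (.push 4 true)) (.wh 5 true (.push 4 true) true (.push 4 false))

/-- Removes leading zeros. -/
def strip : Prog := .wh 4 true .skip false (.push 4 true)

/-- Writes the difference of the numbers on the stacks `4` and `6`. -/
def output : Prog :=
  .seq .sub (.seq (.mv 12 5) (.cs 20
    (.seq (.mv 5 4) (.seq .strip (.seq (.mv 4 0) (.push 0 false)))) .skip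
    (.seq .neg (.seq .strip (.seq (.mv 4 0) (.push 0 true))))))

end Prog

theorem runs_strip (O : List Bool → List Bool) (w : List Bool) : ∀ s : Regs, s.r4 = w.reverse →
    Runs O .strip s.toStk (3 * w.length + 5) (s.set 4 (bval w).bits.reverse).toStk := by
  obtain ⟨k, hk⟩ := exists_eq_bits_append w
  have hlen : w.length = (bval w).bits.length + k := by
    conv_lhs => rw [hk]
    simp
  rw [hlen, show w.reverse = List.replicate k false ++ (bval w).bits.reverse by
    conv_lhs => rw [hk]
    simp]
  generalize bval w = n
  clear hk hlen
  induction k with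
  | zero =>
    intro s hs
    rw [List.replicate_zero, List.nil_append] at hs
    rcases Nat.eq_zero_or_pos n with rfl | hn
    · refine (Runs.wh_nil (by simp [Regs.toStk, hs])).congr (by omega) ?_
      rw [← hs]; rfl
    · obtain ⟨v, hv⟩ := bits_reverse_head n hn
      rw [hv] at hs ⊢
      exact (Runs.wh_stopR (b := true) (show s.toStk 4 = _ from hs) (by norm_num) rfl
        (Runs.pushR _ 4 true)).congr (by omega) rfl
  | succ k ih =>
    intro s hs
    refine (Runs.whR (b := false) (s' := s.set 4 (List.replicate k false ++ n.bits.reverse)) (show s.toStk 4 = _ from hs) (by norm_num) rfl Runs.skip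
      (ih _ rfl)).congr (by omega) rfl

theorem runs_neg (O : List Bool → List Bool) (s : Regs) (h4 : s.r4 = []) :
    Runs O .neg s.toStk (8 * s.r5.length + 5)
      ((s.set 5 []).set 4 (negBits s.r5).reverse).toStk := by
  have loop₂ : ∀ (l : List Bool) (s : Regs), s.r5 = l → Runs O
      (.wh 5 true (.push 4 true) true (.push 4 false)) s.toStk (4 * l.length + 1)
      ((s.set 5 []).set 4 ((l.map (!·)).reverse ++ s.r4)).toStk := by
    intro l
    induction l with
    | nil =>
      intro s hs
      refine (Runs.wh_nil hs).congr le_rfl ?_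
      rw [List.map_nil, List.reverse_nil, List.nil_append, ← hs]
      rfl
    | cons b l ih =>
      intro s hs
      refine (Runs.whR (b := b) (k := 1) (s' := (s.set 5 l).set 4 ((!b) :: s.r4))
        (show s.toStk 5 = _ from hs) (by norm_num) (by simp) ?_ (ih _ rfl)).congr
        (by simp; omega) ?_
      · cases b
        · exact Runs.pushR _ 4 true
        · exact Runs.pushR _ 4 false
      · simp only [Regs.set, List.map_cons, List.reverse_cons, List.append_assoc,
          List.singleton_append]
  have loop₁ : ∀ (l : List Bool) (s : Regs), s.r5 = l → ∃ u v, u.length + v.length = l.length ∧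
      negBits l = u ++ v.map (!·) ∧ Runs O (.wh 5 true (.push 4 false) false (.push 4 true)) s.toStk
        (4 * l.length + 1) ((s.set 5 v).set 4 (u.reverse ++ s.r4)).toStk := by
    intro l
    induction l with
    | nil =>
      intro s hs
      refine ⟨[], [], rfl, rfl, (Runs.wh_nil hs).congr le_rfl ?_⟩
      rw [List.reverse_nil, List.nil_append, ← hs]
      rfl
    | cons b l ih =>
      intro s hs
      cases b
      · obtain ⟨u, v, hl, hd, h⟩ := ih ((s.set 5 l).set 4 (false :: s.r4)) rfl
        refine ⟨false :: u, v, by simp; omega, by rw [negBits, hd]; rfl, ?_⟩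
        refine (Runs.whR (b := false) (show s.toStk 5 = _ from hs) (by norm_num) rfl
          (Runs.pushR _ 4 false) h).congr (by simp; omega) ?_
        simp only [Regs.set, List.reverse_cons, List.append_assoc, List.singleton_append]
      · refine ⟨[true], l, by simp; omega, rfl, ?_⟩
        exact (Runs.wh_stopR (b := true) (show s.toStk 5 = _ from hs) (by norm_num) rfl
          (Runs.pushR _ 4 true)).mono (by simp; omega)
  obtain ⟨u, v, hl, hd, h⟩ := loop₁ s.r5 s rfl
  refine (h.seq (loop₂ v _ rfl)).congr (by omega) ?_
  simp only [Regs.set, h4, hd, List.append_nil, List.reverse_append]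

theorem runs_output (O : List Bool → List Bool) (s : Regs) (h0 : s.r0 = []) (h5 : s.r5 = [])
    (h1 : s.r1 = []) (h12 : s.r12 = []) (h16 : s.r16 = []) (h20 : s.r20 = []) :
    ∃ s' : Regs, s'.r0 = encodeInt ((bval s.r4 : ℤ) - bval s.r6) ∧
      Runs O .output s.toStk (60 * (s.r4.length + s.r6.length) + 50) s'.toStk := by
  set n := s.r4.length + s.r6.length with hn
  have e₁ : Runs O (.forEach 4 1 (.pushN 16 true 1) (.pushN 16 true 1)) s.toStk
      (s.r4.length * 9 + 2) (s.set 16 (List.replicate s.r4.length true)).toStk :=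
    (Runs.forEach_push (r := 4) (t := 1) (d := 16) s h1 1).congr le_rfl (by
      simp only [Regs.set, Regs.toStk, h16, mul_one, List.append_nil])
  have e₂ : Runs O (.forEach 6 1 (.pushN 16 true 1) (.pushN 16 true 1))
      (s.set 16 (List.replicate s.r4.length true)).toStk (s.r6.length * 9 + 2)
      (s.set 16 (List.replicate n true)).toStk :=
    (Runs.forEach_push (r := 6) (t := 1) (d := 16) _ (by simp only [Regs.set, Regs.toStk, h1])
      1).congr le_rfl (by
      simp only [Regs.set, Regs.toStk, mul_one, ← List.replicate_add, hn, Nat.add_comm])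
  obtain ⟨o, c, ho, hv, e₃⟩ := runs_sub_loop O n (s.set 16 (List.replicate n true)) false
    (by simp only [Regs.set, h20]; rfl) (by simp only [Regs.set]) (by simp only [Regs.set]; omega)
    (by simp only [Regs.set]; omega)
  have e₄ : Runs O .sub s.toStk (23 * n + 5) ((((s.set 4 []).set 6 []).set 12 o.reverse).set 20
      (borrow c)).toStk := by
    refine (e₁.seq (e₂.seq e₃)).congr (by omega) ?_
    simp only [Regs.set, h12, h16, List.append_nil]
  have e₅ := Runs.mv (O := O) (r := 12) (d := 5) ((((s.set 4 []).set 6 []).set 12 o.reverse).set 20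
      (borrow c))
  have e₅' : Runs O (.mv 12 5) ((((s.set 4 []).set 6 []).set 12 o.reverse).set 20
      (borrow c)).toStk (4 * n + 1) ((((s.set 4 []).set 6 []).set 5 o).set 20 (borrow c)).toStk := by
    refine e₅.congr ?_ ?_
    · simp only [Regs.set, Regs.toStk, List.length_reverse, ho, le_refl]
    · simp only [Regs.set, Regs.toStk, List.reverse_reverse, h5, h12, List.append_nil]
  simp only [Regs.set, Bool.toNat_false, Nat.cast_zero, sub_zero] at hv
  have hlt := bval_lt o
  rw [ho] at hlt
  have hz : ((2 ^ n : ℕ) : ℤ) = 2 ^ n := by push_cast; rfl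
  have hfin : ∀ (s' : Regs) (w : List Bool) (b : Bool), s'.r0 = [] → w.length = n → s'.r4 = w.reverse →
      ∃ s'' : Regs, s''.r0 = b :: (bval w).bits ∧
      Runs O (.seq .strip (.seq (.mv 4 0) (.push 0 b))) s'.toStk (7 * n + 7) s''.toStk := by
    intro s' w b hs0 hw hs4
    have f₁ := runs_strip O w s' hs4
    have hle : (bval w).bits.length ≤ n := by
      obtain ⟨k, hk⟩ := exists_eq_bits_append w
      have := congrArg List.length hk
      simp only [List.length_append] at this
      omega
    refine ⟨((s'.set 4 []).set 0 (b :: (bval w).bits)), rfl,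
      (f₁.seq ((Runs.mv _).seq (Runs.pushR _ 0 b))).congr ?_ ?_⟩
    · simp only [Regs.set, Regs.toStk, List.length_reverse]; omega
    · simp only [Regs.set, Regs.toStk, List.reverse_reverse, hs0, List.append_nil]
  cases c
  · simp only [Bool.toNat_false, Nat.cast_zero, mul_zero, sub_zero] at hv
    obtain ⟨s', h', f⟩ := hfin (((((s.set 4 []).set 6 []).set 5 []).set 4 o.reverse).set 20 []) o false h0 ho rfl
    refine ⟨s', ?_, ?_⟩
    · rw [h', hv, encodeInt, Int.natAbs_natCast, decide_eq_false (by omega)]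
    · refine (e₄.seq (e₅'.seq (Runs.cs_nil rfl (((Runs.mv _).congr le_rfl ?_).seq f)))).mono ?_
      · simp only [Regs.set, Regs.toStk, List.append_nil, borrow, Bool.false_eq_true, if_false]
      · simp only [Regs.set, Regs.toStk, ho]; omega
  · simp only [Bool.toNat_true, Nat.cast_one, mul_one] at hv
    -- If the lower part were zero, the difference would be -2^n, but the subtrahend has at most n
    -- bits. So the absolute value is the complement of the lower part to 2^n.
    have hpos : 0 < bval o := by
      have := bval_lt s.r6
      have h2 : 2 ^ s.r6.length ≤ 2 ^ n := Nat.pow_le_pow_right (by norm_num) (by omega)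
      omega
    have hneg := bval_negBits hpos
    rw [ho] at hneg
    obtain ⟨s', h', f⟩ := hfin (((((s.set 4 []).set 6 []).set 5 []).set 20 []).set 4
      (negBits o).reverse) (negBits o) true h0 (by rw [length_negBits, ho]) rfl
    set s₁ : Regs := (((s.set 4 []).set 6 []).set 5 o).set 20 (borrow true) with hs₁
    have f₁ : Runs O .neg (s₁.set 20 []).toStk (8 * n + 5) (((((s.set 4 []).set 6 []).set 5 []).set
        20 []).set 4 (negBits o).reverse).toStk := by
      refine (runs_neg O (s₁.set 20 []) (by simp only [hs₁, Regs.set])).congr ?_ ?_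
      · simp only [hs₁, Regs.set, ho, le_refl]
      · simp only [hs₁, Regs.set]
    refine ⟨s', ?_, ?_⟩
    · rw [h', encodeInt, decide_eq_true (by omega)]
      congr 2
      omega
    · refine (e₄.seq (e₅'.seq (Runs.cs_trueR (t := []) ?_ (by norm_num) (f₁.seq f)))).mono (by omega)
      simp only [hs₁, Regs.set, Regs.toStk, borrow, if_true]

/-- Every `GapP` function can be computed with the help of an oracle. -/
theorem gapPHard_of_good {P : EstimationProblem} (hP : P.Good) : GapPHard P := by
  rintro g ⟨f₁, f₂, hf₁, hf₂, hg⟩ b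
  obtain ⟨Q₁, p₁, h₁⟩ := exists_count hP hf₁ b
  obtain ⟨Q₂, p₂, h₂⟩ := exists_count hP hf₂ b
  refine ⟨(Prog.seq Q₁ (.seq (.mv 6 18) (.seq Q₂ (.seq (.mv 18 4) (.seq (.clr 0) .output))))).compile 0,
    p₁ + (C 4 * p₁ + C 1 + (p₂ + (C 4 * p₁ + C 1 + (C 3 * X + C 1 + (C 60 * (p₁ + p₂) + C 50))))),
    fun A hA x => ?_⟩
  obtain ⟨l₁, hl₁, e₁⟩ := h₁ A hA x []
  -- The second count runs while the first result is kept on stack 18, reversed by the move; the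
  -- next move reverses it back.
  obtain ⟨l₂, hl₂, e₂⟩ := h₂ A hA x l₁.reverse
  have hb₁ : l₁.length ≤ p₁.eval x.length := by
    have := e₁.length_le (r := 6) (by norm_num)
    simpa only [Regs.toStk, List.length_nil, Nat.zero_add] using this
  have hb₂ : l₂.length ≤ p₂.eval x.length := by
    have := e₂.length_le (r := 6) (by norm_num)
    simpa only [Regs.toStk, List.length_nil, Nat.zero_add] using this
  obtain ⟨s, hs, e₃⟩ := runs_output A { r4 := l₁, r6 := l₂ } rfl rfl rfl rfl rfl rfl
  have m₁ : Runs A (.mv 6 18) (Regs.toStk { r0 := x, r6 := l₁ }) (4 * p₁.eval x.length + 1)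
      (Regs.toStk { r0 := x, r18 := l₁.reverse }) := by
    refine (Runs.mv _).congr ?_ ?_
    · simp only [Regs.toStk]; omega
    · simp only [Regs.set, Regs.toStk, List.append_nil]
  have m₂ : Runs A (.mv 18 4) (Regs.toStk { r0 := x, r6 := l₂, r18 := l₁.reverse })
      (4 * p₁.eval x.length + 1) (Regs.toStk { r0 := x, r4 := l₁, r6 := l₂ }) := by
    refine (Runs.mv _).congr ?_ ?_
    · simp only [Regs.toStk, List.length_reverse]; omega
    · simp only [Regs.set, Regs.toStk, List.append_nil, List.reverse_reverse]
  have m₃ : Runs A (.clr 0) (Regs.toStk { r0 := x, r4 := l₁, r6 := l₂ }) (3 * x.length + 1)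
      (Regs.toStk { r4 := l₁, r6 := l₂ }) := Runs.clr _
  have e := e₁.seq (m₁.seq (e₂.seq (m₂.seq (m₃.seq e₃))))
  rw [← Regs.toStk_eq_getD] at e
  have := e.outputsWithin (l := (p₁ + (C 4 * p₁ + C 1 + (p₂ + (C 4 * p₁ + C 1 + (C 3 * X + C 1 +
    (C 60 * (p₁ + p₂) + C 50)))))).eval x.length) (by
      simp only [Polynomial.eval_add, Polynomial.eval_mul, Polynomial.eval_C, Polynomial.eval_X]
      omega)
  convert this using 1
  rw [hg, ← hl₁, ← hl₂, ← hs]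
  rfl

/-! ### Amplitudes as path sums -/

/-- The number of Hadamard gates. -/
def Circuit.hads {n : ℕ} : Circuit n → ℕ
  | [] => 0
  | .had _ :: C => Circuit.hads C + 1
  | .tof _ _ _ _ _ _ :: C => Circuit.hads C

/-- The amplitude of the zero state, without normalization. -/
def Circuit.amp {n : ℕ} : Circuit n → (Fin n → Bool) → ℤ
  | [], z => if z = fun _ => false then 1 else 0
  | .had i :: C, z => Circuit.amp C (Function.update z i false) +
      sgn (z i) * Circuit.amp C (Function.update z i true)
  | .tof a b c _ _ _ :: C, z => Circuit.amp C (tofMap a b c z)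

open Matrix in
theorem Circuit.matrix_eq_amp {n : ℕ} (C : Circuit n) (z : Fin n → Bool) :
    Circuit.matrix C (fun _ => false) z * ((Real.sqrt 2 : ℝ) : ℂ) ^ Circuit.hads C =
      (Circuit.amp C z : ℂ) := by
  have hrow : ∀ (g : Gate n) (C : Circuit n) (z : Fin n → Bool),
      Circuit.matrix (g :: C) (fun _ => false) z =
        ((fun w => Circuit.matrix C (fun _ => false) w) ᵥ* g.matrix) z := fun g C z => rfl
  induction C generalizing z with
  | nil =>
    simp only [Circuit.matrix, Circuit.hads, Circuit.amp, Matrix.one_apply, pow_zero, mul_one]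
    by_cases h : z = fun _ => false
    · simp [h]
    · rw [if_neg (fun h' => h h'.symm), if_neg h, Int.cast_zero]
  | cons g C ih =>
    rw [hrow]
    cases g with
    | had i =>
      have h0 := sqrt_two_ne_zero
      rw [had_vecMul, Circuit.hads, Circuit.amp]
      push_cast
      rw [← ih, ← ih, pow_succ]
      field_simp
    | tof a b c hab hac hbc =>
      rw [tof_vecMul, Circuit.hads, Circuit.amp, ← ih]

theorem Circuit.zeroProb_eq_amp {n : ℕ} (C : Circuit n) :
    C.zeroProb = (Circuit.amp C (fun _ => false) : ℝ) ^ 2 / 2 ^ Circuit.hads C := by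
  have h := Circuit.matrix_eq_amp C (fun _ => false)
  have h2 := congrArg (fun w : ℂ => ‖w‖ ^ 2) h
  simp only [norm_mul, norm_pow, Complex.norm_real, Complex.norm_intCast, mul_pow] at h2
  rw [← pow_mul, Nat.mul_comm, pow_mul, Real.norm_eq_abs, sq_abs, Real.sq_sqrt (by norm_num),
    sq_abs] at h2
  rw [eq_div_iff (by positivity), Circuit.zeroProb, h2]

/-- The end of a path: the basis state, the remaining choices and the sign. -/
def Circuit.path {n : ℕ} : Circuit n → (Fin n → Bool) → List Bool → Bool →
    (Fin n → Bool) × List Bool × Bool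
  | [], z, y, s => (z, y, s)
  | .had i :: C, z, y, s => Circuit.path C (Function.update z i (y.headD false)) y.tail
      (xor s (z i && y.headD false))
  | .tof a b c _ _ _ :: C, z, y, s => Circuit.path C (tofMap a b c z) y s

/-- The contribution of a path that is continued by `K`. -/
def Circuit.weight {n : ℕ} (C : Circuit n) (K : List Bool → Bool → ℤ) (y : List Bool) (s : Bool) : ℤ :=
  if (Circuit.path C (fun _ => false) y s).1 = fun _ => false then
    K (Circuit.path C (fun _ => false) y s).2.1 (Circuit.path C (fun _ => false) y s).2.2 else 0

theorem sum_ofFn_succ (m : ℕ) (F : List Bool → ℤ) : ∑ y : Fin (m + 1) → Bool, F (List.ofFn y) =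
    ∑ y : Fin m → Bool, F (false :: List.ofFn y) + ∑ y : Fin m → Bool, F (true :: List.ofFn y) := by
  rw [← (Fin.consEquiv fun _ => Bool).sum_comp, Fintype.sum_prod_type, Fintype.sum_bool, add_comm]
  simp [Fin.consEquiv, List.ofFn_succ]

theorem sgn_xor (a b : Bool) : sgn (xor a b) = sgn a * sgn b := by cases a <;> cases b <;> rfl

/-- Splitting the sum at the first choice reproduces the recursion of `Circuit.amp`, and by `hK` the
sign of a branch can be taken out. The continuation `K` receives the unused choices; with another
pass as continuation, the amplitude gets squared. -/
theorem Circuit.sum_path {n : ℕ} (C : Circuit n) {K : List Bool → Bool → ℤ}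
    (hK : ∀ y s b, K y (xor s b) = sgn b * K y s) (z : Fin n → Bool) (s : Bool) {m r : ℕ}
    (hm : m = Circuit.hads C + r) :
    ∑ y : Fin m → Bool,
      (if (Circuit.path C z (List.ofFn y) s).1 = fun _ => false then
        K (Circuit.path C z (List.ofFn y) s).2.1 (Circuit.path C z (List.ofFn y) s).2.2 else 0) =
      Circuit.amp C z * ∑ y : Fin r → Bool, K (List.ofFn y) s := by
  induction C generalizing z s m with
  | nil =>
    obtain rfl : m = r := by simpa [Circuit.hads] using hm
    simp only [Circuit.path, Circuit.amp]
    by_cases h : z = fun _ => false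
    · simp [h]
    · simp [h]
  | cons g C ih =>
    cases g with
    | had i =>
      obtain rfl : m = (Circuit.hads C + r) + 1 := by rw [hm, Circuit.hads]; omega
      rw [sum_ofFn_succ (F := fun l => if (Circuit.path (.had i :: C) z l s).1 = fun _ => false then
          K (Circuit.path (.had i :: C) z l s).2.1 (Circuit.path (.had i :: C) z l s).2.2 else 0)]
      simp only [Circuit.path, Circuit.amp, List.headD_cons, List.tail_cons, Bool.and_false,
        Bool.and_true]
      rw [ih _ _ rfl, ih _ _ rfl]
      simp only [hK, ← Finset.mul_sum]
      rw [sgn_false, one_mul]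
      ring
    | tof a b c hab hac hbc =>
      simp only [Circuit.amp, Circuit.path]
      exact ih _ _ hm

theorem Circuit.path_xor {n : ℕ} (C : Circuit n) (z : Fin n → Bool) (y : List Bool) (s b : Bool) :
    Circuit.path C z y (xor s b) = ((Circuit.path C z y s).1, (Circuit.path C z y s).2.1,
      xor (Circuit.path C z y s).2.2 b) := by
  induction C generalizing z y s with
  | nil => rfl
  | cons g C ih =>
    cases g with
    | had i =>
      simp only [Circuit.path]
      rw [← ih]
      congr 1
      cases s <;> cases b <;> cases z i <;> cases y.headD false <;> rfl
    | tof a b c hab hac hbc => exact ih _ _ _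

theorem Circuit.weight_xor {n : ℕ} (C : Circuit n) {K : List Bool → Bool → ℤ}
    (hK : ∀ y s b, K y (xor s b) = sgn b * K y s) (y : List Bool) (s b : Bool) :
    Circuit.weight C K y (xor s b) = sgn b * Circuit.weight C K y s := by
  simp only [Circuit.weight, Circuit.path_xor, hK, mul_ite, mul_zero]

/-- The sign of a path whose choices are used up. -/
def lastSign (y : List Bool) (s : Bool) : ℤ := if y.all (!·) then sgn s else 0

theorem lastSign_xor (y : List Bool) (s b : Bool) : lastSign y (xor s b) = sgn b * lastSign y s := by
  simp only [lastSign, sgn_xor]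
  split_ifs
  · ring
  · simp

/-- Certificates may be longer than needed. Since unused choices have to be zero, every pair of
paths is counted once. -/
theorem sum_lastSign (m : ℕ) : ∑ y : Fin m → Bool, lastSign (List.ofFn y) false = 1 := by
  induction m with
  | zero => simp [lastSign]
  | succ m ih =>
    rw [sum_ofFn_succ (F := fun l => lastSign l false)]
    simpa [lastSign] using ih

/-- The square of the amplitude as a sum over pairs of paths. -/
theorem Circuit.sum_weight {n : ℕ} (C : Circuit n) {m : ℕ} (hm : 2 * Circuit.hads C ≤ m) :
    ∑ y : Fin m → Bool, Circuit.weight C (Circuit.weight C lastSign) (List.ofFn y) false =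
      Circuit.amp C (fun _ => false) ^ 2 := by
  -- One block of choices for each of the two paths, and r unused choices.
  obtain ⟨r, rfl⟩ : ∃ r, m = Circuit.hads C + (Circuit.hads C + r) := ⟨m - 2 * Circuit.hads C, by omega⟩
  have h1 := Circuit.sum_path C (K := Circuit.weight C lastSign)
    (Circuit.weight_xor C lastSign_xor) (fun _ => false) false
    (r := Circuit.hads C + r) rfl
  have h2 := Circuit.sum_path C lastSign_xor (fun _ => false) false (r := r) rfl
  unfold Circuit.weight at h1 ⊢
  rw [h1, h2, sum_lastSign, mul_one, sq]

/-! ### Following a path through the code of a circuit -/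

/-- The part of the code that is being read. -/
inductive Mode : Type
  | header
  | gate
  | had
  | first
  | second
  | third

/-- The state of the simulation: the qubits below and above the current one, the choices, the sign,
the controls of the current gate and the number of Hadamard gates in unary. -/
structure Sim : Type where
  mode : Mode := .header
  below : List Bool := []
  above : List Bool := []
  choices : List Bool := []
  sign : Bool := false
  ctrl : List Bool := []
  count : List Bool := []

namespace Sim

/-- Goes to the next qubit. -/
def walk (s : Sim) : Sim :=
  match s.below with
  | [] => s
  | b :: l => { s with below := l, above := b :: s.above }

/-- Returns to the first qubit. -/
def back (s : Sim) (m : Mode) : Sim :=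
  { s with below := s.above.reverse ++ s.below, above := [], mode := m }

/-- Applies a Hadamard gate to the current qubit. -/
def applyHad (s : Sim) : Sim :=
  { s with
    below := s.choices.headD false :: s.below.tail
    choices := s.choices.tail
    sign := xor s.sign (s.below.headD false && s.choices.headD false)
    count := true :: s.count }

/-- Reads a control. -/
def readCtrl (s : Sim) : Sim := { s with ctrl := s.below.headD false :: s.ctrl }

/-- Applies a Toffoli gate to the current qubit. -/
def applyTof (s : Sim) : Sim :=
  { s with
    below := xor (s.below.headD false) (s.ctrl.tail.headD false && s.ctrl.headD false) :: s.below.tail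
    ctrl := s.ctrl.tail.tail }

/-- Reads a bit of the code. -/
def step (s : Sim) (b : Bool) : Sim :=
  match s.mode, b with
  | .header, true => { s with below := false :: s.below }
  | .header, false => { s with mode := .gate }
  | .gate, true => { s with mode := .first }
  | .gate, false => { s with mode := .had }
  | .had, false => s.applyHad.back .gate
  | .first, false => s.readCtrl.back .second
  | .second, false => s.readCtrl.back .third
  | .third, false => s.applyTof.back .gate
  | .had, true => s.walk
  | .first, true => s.walk
  | .second, true => s.walk
  | .third, true => s.walk

/-- Reads a code. -/
def run (s : Sim) (x : List Bool) : Sim := x.foldl step s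

theorem run_append (s : Sim) (x y : List Bool) : s.run (x ++ y) = (s.run x).run y :=
  List.foldl_append

theorem run_header (k : ℕ) (bl ab ch : List Bool) (sg : Bool) (ct cn : List Bool) :
    run ⟨.header, bl, ab, ch, sg, ct, cn⟩ (encodeUnary k) =
      ⟨.gate, List.replicate k false ++ bl, ab, ch, sg, ct, cn⟩ := by
  induction k generalizing bl with
  | zero => rfl
  | succ k ih =>
    have := ih (false :: bl)
    rw [List.replicate_succ', List.append_assoc]
    exact this

/-- Every one of the unary code moves to the next qubit; its final `false` triggers the action of
the current mode on the qubit that has been reached. -/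
theorem run_walk (k : ℕ) (s : Sim) (h1 : s.mode ≠ .header) (h2 : s.mode ≠ .gate)
    (hk : k ≤ s.below.length) : s.run (encodeUnary k) = step { s with
      below := s.below.drop k, above := (s.below.take k).reverse ++ s.above } false := by
  induction k generalizing s with
  | zero => rfl
  | succ k ih =>
    have : encodeUnary (k + 1) = true :: encodeUnary k := rfl
    rw [this, run, List.foldl_cons, ← run]
    obtain ⟨m, bl, ab, ch, sg, ct, cn⟩ := s
    cases bl with
    | nil => simp at hk
    | cons b l =>
      have h3 : step ⟨m, b :: l, ab, ch, sg, ct, cn⟩ true = ⟨m, l, b :: ab, ch, sg, ct, cn⟩ := by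
        cases m <;> simp_all [step, walk]
      rw [h3]
      refine (ih ⟨m, l, b :: ab, ch, sg, ct, cn⟩ h1 h2 (by simpa using hk)).trans ?_
      simp

theorem ofFn_update {n : ℕ} (z : Fin n → Bool) (i : Fin n) (c : Bool) :
    (List.ofFn z).take i ++ c :: (List.ofFn z).drop (i + 1) = List.ofFn (Function.update z i c) := by
  rw [show (List.ofFn z).take i ++ c :: (List.ofFn z).drop (i + 1) = (List.ofFn z).set i c by
    rw [List.set_eq_take_append_cons_drop, if_pos (by simp)]]
  refine List.ext_getElem (by simp) fun j h1 h2 => ?_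
  simp only [List.getElem_set, List.getElem_ofFn, Function.update_apply, Fin.ext_iff, eq_comm]

theorem headD_drop_ofFn {n : ℕ} (z : Fin n → Bool) (i : Fin n) :
    ((List.ofFn z).drop i).headD false = z i := by
  rw [List.drop_eq_getElem_cons (by simp)]
  simp

theorem tail_drop_ofFn {n : ℕ} (z : Fin n → Bool) (i : Fin n) :
    ((List.ofFn z).drop i).tail = (List.ofFn z).drop (i + 1) := List.tail_drop ..

theorem run_had {n : ℕ} (z : Fin n → Bool) (i : Fin n) (y : List Bool) (sg : Bool) (cn : List Bool) :
    run ⟨.gate, List.ofFn z, [], y, sg, [], cn⟩ (Gate.encode (.had i)) =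
      ⟨.gate, List.ofFn (Function.update z i (y.headD false)), [], y.tail,
        xor sg (z i && y.headD false), [], true :: cn⟩ := by
  have h1 : Gate.encode (.had i) = [false] ++ encodeUnary i := rfl
  rw [h1, run_append, show run ⟨.gate, List.ofFn z, [], y, sg, [], cn⟩ [false] =
    ⟨.had, List.ofFn z, [], y, sg, [], cn⟩ from rfl, run_walk _ _ (by simp) (by simp) (by simp)]
  simp only [step, applyHad, back, headD_drop_ofFn, tail_drop_ofFn, List.append_nil,
    List.reverse_reverse, ofFn_update]

theorem run_ctrl {n : ℕ} (m m' : Mode) (h : (m = .first ∧ m' = .second) ∨ (m = .second ∧ m' = .third))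
    (z : Fin n → Bool) (i : Fin n) (y : List Bool) (sg : Bool) (ct cn : List Bool) :
    run ⟨m, List.ofFn z, [], y, sg, ct, cn⟩ (encodeUnary i) =
      ⟨m', List.ofFn z, [], y, sg, z i :: ct, cn⟩ := by
  rw [run_walk]
  · rcases h with ⟨rfl, rfl⟩ | ⟨rfl, rfl⟩ <;>
    simp only [step, readCtrl, back, headD_drop_ofFn, List.append_nil, List.reverse_reverse,
      List.take_append_drop]
  · rcases h with ⟨rfl, rfl⟩ | ⟨rfl, rfl⟩ <;> simp
  · rcases h with ⟨rfl, rfl⟩ | ⟨rfl, rfl⟩ <;> simp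
  · simp

theorem run_tof {n : ℕ} (z : Fin n → Bool) {a b c : Fin n} (hab : a ≠ b) (hac : a ≠ c) (hbc : b ≠ c)
    (y : List Bool) (sg : Bool) (cn : List Bool) :
    run ⟨.gate, List.ofFn z, [], y, sg, [], cn⟩ (Gate.encode (.tof a b c hab hac hbc)) =
      ⟨.gate, List.ofFn (tofMap a b c z), [], y, sg, [], cn⟩ := by
  have h1 : Gate.encode (.tof a b c hab hac hbc) =
      [true] ++ (encodeUnary a ++ encodeUnary b ++ encodeUnary c) := rfl
  rw [h1, run_append, run_append, run_append, show run ⟨.gate, List.ofFn z, [], y, sg, [], cn⟩ [true] =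
    ⟨.first, List.ofFn z, [], y, sg, [], cn⟩ from rfl, run_ctrl _ _ (.inl ⟨rfl, rfl⟩),
    run_ctrl _ _ (.inr ⟨rfl, rfl⟩), run_walk _ _ (by simp) (by simp) (by simp)]
  simp only [step, applyTof, back, headD_drop_ofFn, tail_drop_ofFn, List.append_nil,
    List.reverse_reverse, ofFn_update, List.headD_cons, List.tail_cons, tofMap]

theorem run_gates {n : ℕ} (C : Circuit n) (z : Fin n → Bool) (y : List Bool) (sg : Bool)
    (cn : List Bool) : run ⟨.gate, List.ofFn z, [], y, sg, [], cn⟩ (C.flatMap Gate.encode) =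
      ⟨.gate, List.ofFn (Circuit.path C z y sg).1, [], (Circuit.path C z y sg).2.1,
        (Circuit.path C z y sg).2.2, [], List.replicate (Circuit.hads C) true ++ cn⟩ := by
  induction C generalizing z y sg cn with
  | nil => rfl
  | cons g C ih =>
    rw [List.flatMap_cons, run_append]
    cases g with
    | had i =>
      rw [run_had, ih, Circuit.hads, List.replicate_succ', List.append_assoc]
      rfl
    | tof a b c hab hac hbc =>
      rw [run_tof, ih]
      rfl

theorem run_encode {n : ℕ} (C : Circuit n) (y : List Bool) (sg : Bool) (cn : List Bool) :
    run ⟨.header, [], [], y, sg, [], cn⟩ (Circuit.encode C) =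
      ⟨.gate, List.ofFn (Circuit.path C (fun _ => false) y sg).1, [],
        (Circuit.path C (fun _ => false) y sg).2.1, (Circuit.path C (fun _ => false) y sg).2.2, [],
        List.replicate (Circuit.hads C) true ++ cn⟩ := by
  rw [Circuit.encode, run_append, run_header, ← run_gates, List.append_nil, List.ofFn_const]

/-- The return to the first qubit costs time proportional to the walked distance. The bound is
needed for arbitrary inputs, since the verifier must be fast also on strings that encode no circuit.
-/
theorem length_step (s : Sim) (b : Bool) :
    (s.step b).below.length + (s.step b).above.length ≤ s.below.length + s.above.length + 1 := by
  obtain ⟨m, bl, ab, ch, sg, ct, cn⟩ := s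
  cases m <;> cases b <;> cases bl <;>
    simp [step, walk, back, applyHad, applyTof, readCtrl] <;> omega

end Sim

/-! ### The program of the simulation -/

/-- The number of a mode. -/
def Mode.code : Mode → ℕ
  | .header => 0
  | .gate => 1
  | .had => 2
  | .first => 3
  | .second => 4
  | .third => 5

/-- The stacks of the simulation; stack `8` holds the mode. -/
def Sim.regs (s : Sim) (x u f : List Bool) : Regs where
  r0 := x
  r1 := s.choices
  r5 := u
  r6 := s.below
  r7 := s.above
  r8 := List.replicate s.mode.code true
  r9 := borrow s.sign
  r10 := s.ctrl
  r11 := s.count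
  r12 := f

namespace Prog

/-- Sets the mode. -/
def goto (m : Mode) : Prog := .pushN 8 true m.code

/-- Goes to the next qubit. -/
def walk (m : Mode) : Prog := .seq (.cs 6 .skip (.push 7 false) (.push 7 true)) (goto m)

/-- Returns to the first qubit. -/
def back (m : Mode) : Prog := .seq (.mv 7 6) (goto m)

/-- Changes the sign. -/
def flip (b : Bool) : Prog := if b then .cs 9 (.push 9 true) .skip .skip else .skip

/-- Writes the result of a Hadamard gate. -/
def hadWrite (z c : Bool) : Prog := .seq (.push 6 c) (.seq (flip (z && c)) (.seq (.push 11 true) (back .gate)))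

/-- Reads the choice of a Hadamard gate. -/
def hadChoice (z : Bool) : Prog := .cs 1 (hadWrite z false) (hadWrite z false) (hadWrite z true)

/-- Reads a control. -/
def ctrl (m : Mode) : Prog :=
  .seq (.cs 6 (.push 10 false) (.seq (.push 6 false) (.push 10 false))
    (.seq (.push 6 true) (.push 10 true))) (back m)

/-- Writes the result of a Toffoli gate. -/
def tofWrite (a b t : Bool) : Prog := .seq (.push 6 (xor t (a && b))) (back .gate)

/-- Reads the target of a Toffoli gate. -/
def tofTarget (b a : Bool) : Prog := .cs 6 (tofWrite a b false) (tofWrite a b false) (tofWrite a b true)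

/-- Reads the first control of a Toffoli gate. -/
def tofSecond (b : Bool) : Prog := .cs 10 (tofTarget b false) (tofTarget b false) (tofTarget b true)

/-- Reads a bit of the code in a given mode. -/
def handle : Mode → Bool → Prog
  | .header, true => .push 6 false
  | .header, false => goto .gate
  | .gate, true => goto .first
  | .gate, false => goto .had
  | .had, false => .cs 6 (hadChoice false) (hadChoice false) (hadChoice true)
  | .first, false => ctrl .second
  | .second, false => ctrl .third
  | .third, false => .cs 10 (tofSecond false) (tofSecond false) (tofSecond true)
  | m, true => walk m

/-- Reads a bit of the code. -/
def simStep (b : Bool) : Prog :=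
  .cs 8 (handle .header b) .skip (.cs 8 (handle .gate b) .skip (.cs 8 (handle .had b) .skip
    (.cs 8 (handle .first b) .skip (.cs 8 (handle .second b) .skip (handle .third b)))))

end Prog

section Step

variable {O : List Bool → List Bool} {x u f : List Bool}

theorem runs_goto (s : Regs) (h8 : s.r8 = []) (m : Mode) : Runs O (.goto m) s.toStk 5
    (s.set 8 (List.replicate m.code true)).toStk := by
  refine (Runs.pushN s true m.code).congr (by cases m <;> simp [Mode.code]) ?_
  simp only [Regs.toStk, h8, List.append_nil]

theorem runs_back (s : Regs) (h8 : s.r8 = []) (m : Mode) : Runs O (.back m) s.toStk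
    (4 * s.r7.length + 6)
    (((s.set 7 []).set 6 (s.r7.reverse ++ s.r6)).set 8 (List.replicate m.code true)).toStk := by
  refine ((Runs.mv s).seq (runs_goto _ ?_ m)).congr (by simp only [Regs.toStk]; omega) ?_
  · simp only [Regs.set, h8]
  · simp only [Regs.set, Regs.toStk]

theorem runs_walk (s : Sim) (m : Mode) (hm : s.mode = m) : Runs O (.walk m)
    ((s.regs x u f).set 8 []).toStk 9 (s.walk.regs x u f).toStk := by
  obtain ⟨m, bl, ab, ch, sg, ct, cn⟩ := s
  subst hm
  have e : Runs O (.cs 6 .skip (.push 7 false) (.push 7 true))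
      ((Sim.regs ⟨m, bl, ab, ch, sg, ct, cn⟩ x u f).set 8 []).toStk 4
      (((Sim.walk ⟨m, bl, ab, ch, sg, ct, cn⟩).regs x u f).set 8 []).toStk := by
    rcases bl with _ | ⟨b, l⟩
    · exact (Runs.cs_nil rfl Runs.skip).mono (by norm_num)
    · cases b
      · exact Runs.cs_falseR rfl (by norm_num) (Runs.pushR _ 7 false)
      · exact Runs.cs_trueR rfl (by norm_num) (Runs.pushR _ 7 true)
  refine (e.seq (runs_goto _ (by simp only [Regs.set]) m)).congr le_rfl ?_
  cases bl <;> simp only [Regs.set, Sim.regs, Sim.walk]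

theorem runs_flip (s : Regs) (b c : Bool) (h9 : s.r9 = borrow c) : Runs O (.flip b) s.toStk 4
    (s.set 9 (borrow (xor c b))).toStk := by
  cases b
  · refine Runs.skip.congr (by norm_num) ?_
    rw [Bool.xor_false, ← h9]; rfl
  · cases c
    · refine (Runs.cs_nil h9 (Runs.pushR _ 9 true)).congr le_rfl ?_
      simp only [Regs.toStk, h9]; rfl
    · exact (Runs.cs_trueR (t := []) (show s.toStk 9 = _ from h9) (by norm_num) Runs.skip).congr (by norm_num) rfl

theorem runs_applyHad (s : Sim) : Runs O (.handle .had false) ((s.regs x u f).set 8 []).toStk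
    (4 * s.above.length + 18) ((s.applyHad.back .gate).regs x u f).toStk := by
  obtain ⟨m, bl, ab, ch, sg, ct, cn⟩ := s
  refine Runs.mono (k := 4 * ab.length + 12 + 3 + 3) ?_ (by simp)
  refine runs_cs_tail (P := .hadChoice) (by norm_num) ?_
  refine runs_cs_tail (P := .hadWrite _) (by norm_num) ?_
  refine ((Runs.pushR _ 6 _).seq ((runs_flip _ _ sg (by simp only [Regs.set, Sim.regs])).seq
    ((Runs.pushR _ 11 true).seq (runs_back _ (by simp only [Regs.set]) .gate)))).congr ?_ ?_
  · simp only [Regs.set, Sim.regs]; omega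
  · simp only [Regs.set, Regs.toStk, Sim.regs, Sim.applyHad, Sim.back]

theorem runs_readCtrl (s : Sim) (m : Mode) : Runs O (.ctrl m) ((s.regs x u f).set 8 []).toStk
    (4 * s.above.length + 11) ((s.readCtrl.back m).regs x u f).toStk := by
  obtain ⟨m', bl, ab, ch, sg, ct, cn⟩ := s
  have e : Runs O (.cs 6 (.push 10 false) (.seq (.push 6 false) (.push 10 false))
      (.seq (.push 6 true) (.push 10 true))) ((Sim.regs ⟨m', bl, ab, ch, sg, ct, cn⟩ x u f).set 8 []).toStk
      5 (((Sim.readCtrl ⟨m', bl, ab, ch, sg, ct, cn⟩).regs x u f).set 8 []).toStk := by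
    rcases bl with _ | ⟨b, l⟩
    · exact (Runs.cs_nil rfl (Runs.pushR _ 10 false)).mono (by norm_num)
    · cases b
      · exact Runs.cs_falseR rfl (by norm_num) ((Runs.pushR _ 6 false).seq (Runs.pushR _ 10 false))
      · exact Runs.cs_trueR rfl (by norm_num) ((Runs.pushR _ 6 true).seq (Runs.pushR _ 10 true))
  refine (e.seq (runs_back _ (by simp only [Regs.set]) m)).congr ?_ ?_
  · simp only [Regs.set, Sim.regs, Sim.readCtrl]; omega
  · simp only [Regs.set, Sim.regs, Sim.readCtrl, Sim.back]

theorem runs_applyTof (s : Sim) : Runs O (.handle .third false) ((s.regs x u f).set 8 []).toStk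
    (4 * s.above.length + 16) ((s.applyTof.back .gate).regs x u f).toStk := by
  obtain ⟨m, bl, ab, ch, sg, ct, cn⟩ := s
  refine Runs.mono (k := 4 * ab.length + 7 + 3 + 3 + 3) ?_ (by simp)
  refine runs_cs_tail (P := .tofSecond) (by norm_num) ?_
  refine runs_cs_tail (P := .tofTarget _) (by norm_num) ?_
  refine runs_cs_tail (P := .tofWrite _ _) (by norm_num) ?_
  refine ((Runs.pushR _ 6 _).seq (runs_back _ (by simp only [Regs.set]) .gate)).congr ?_ ?_
  · simp only [Regs.set, Sim.regs]; omega
  · simp only [Regs.set, Regs.toStk, Sim.regs, Sim.applyTof, Sim.back]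

theorem runs_handle (s : Sim) (b : Bool) : Runs O (.handle s.mode b) ((s.regs x u f).set 8 []).toStk
    (4 * s.above.length + 18) ((s.step b).regs x u f).toStk := by
  have hw : ∀ m, s.mode = m → Runs O (.walk m) ((s.regs x u f).set 8 []).toStk
      (4 * s.above.length + 18) (s.walk.regs x u f).toStk := fun m hm => (runs_walk s m hm).mono (by omega)
  have hg : ∀ m, Runs O (.goto m) ((s.regs x u f).set 8 []).toStk
      (4 * s.above.length + 18) (Sim.regs { s with mode := m } x u f).toStk := fun m =>
    (runs_goto _ (by simp only [Regs.set]) m).congr (by omega) (by simp only [Regs.set, Sim.regs])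
  unfold Sim.step
  cases hm : s.mode <;> cases b
  · exact hg _
  · refine (Runs.pushR _ 6 false).congr (by omega) ?_
    simp only [Regs.set, Regs.toStk, Sim.regs, hm, Mode.code, List.replicate_zero]
  · exact hg _
  · exact hg _
  · exact runs_applyHad s
  · exact hw _ hm
  · exact (runs_readCtrl s _).mono (by omega)
  · exact hw _ hm
  · exact (runs_readCtrl s _).mono (by omega)
  · exact hw _ hm
  · exact (runs_applyTof s).mono (by omega)
  · exact hw _ hm

/-- The mode is stored in unary on stack 8, so popping at most five bits identifies it and leaves
the stack empty for the next mode. -/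
theorem runs_simStep (s : Sim) (b : Bool) : Runs O (.simStep b) (s.regs x u f).toStk
    (4 * s.above.length + 36) ((s.step b).regs x u f).toStk := by
  have h := runs_handle (O := O) (x := x) (u := u) (f := f) s b
  have halt : ∀ {P Z E : Prog} (s' : Regs), s'.r8 = [] →
      Runs O P (s'.set 8 []).toStk (4 * s.above.length + 18) ((s.step b).regs x u f).toStk →
      Runs O (.cs 8 P Z E) s'.toStk (4 * s.above.length + 21) ((s.step b).regs x u f).toStk := by
    intro P Z E s' hs' hP
    refine Runs.cs_nil hs' ?_
    rwa [← hs'] at hP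
  have go : ∀ {P Z E : Prog} (s' : Regs) (k n : ℕ), s'.r8 = List.replicate (k + 1) true →
      Runs O E (s'.set 8 (List.replicate k true)).toStk n ((s.step b).regs x u f).toStk →
      Runs O (.cs 8 P Z E) s'.toStk (n + 3) ((s.step b).regs x u f).toStk :=
    fun s' k n hs' hP => Runs.cs_trueR hs' (by norm_num) hP
  cases hm : s.mode <;> rw [hm] at h
  · exact (halt _ (by rw [Sim.regs, hm]; rfl) h).mono (by omega)
  · exact (go _ 0 _ (by rw [Sim.regs, hm]; rfl) (halt _ rfl h)).mono (by omega)
  · exact (go _ 1 _ (by rw [Sim.regs, hm]; rfl) (go _ 0 _ rfl (halt _ rfl h))).mono (by omega)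
  · exact (go _ 2 _ (by rw [Sim.regs, hm]; rfl) (go _ 1 _ rfl (go _ 0 _ rfl (halt _ rfl h)))).mono
      (by omega)
  · exact (go _ 3 _ (by rw [Sim.regs, hm]; rfl) (go _ 2 _ rfl (go _ 1 _ rfl (go _ 0 _ rfl
      (halt _ rfl h))))).mono (by omega)
  · exact (go _ 4 _ (by rw [Sim.regs, hm]; rfl) (go _ 3 _ rfl (go _ 2 _ rfl (go _ 1 _ rfl (go _ 0 _ rfl
      h))))).mono (by omega)

end Step

open Polynomial (C X)

/-! ### Output probabilities are in `GapP` -/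

namespace Sim

theorem length_run (s : Sim) (x : List Bool) :
    (s.run x).below.length + (s.run x).above.length ≤ s.below.length + s.above.length + x.length ∧
    (s.run x).ctrl.length ≤ s.ctrl.length + x.length ∧ (s.run x).choices.length ≤ s.choices.length := by
  induction x generalizing s with
  | nil => exact ⟨le_rfl, le_rfl, le_rfl⟩
  | cons b x ih =>
    have h1 := ih (s.step b)
    have h2 := s.length_step b
    have h3 : (s.step b).ctrl.length ≤ s.ctrl.length + 1 ∧
        (s.step b).choices.length ≤ s.choices.length := by
      obtain ⟨m, bl, ab, ch, sg, ct, cn⟩ := s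
      cases m <;> cases b <;> cases bl <;>
        simp [step, walk, back, applyHad, applyTof, readCtrl] <;> omega
    simp only [List.length_cons]
    exact ⟨h1.1.trans (by omega), h1.2.1.trans (by omega), h1.2.2.trans h3.2⟩

theorem count_run (s : Sim) (x : List Bool) : ∃ k, (s.run x).count = List.replicate k true ++ s.count := by
  induction x generalizing s with
  | nil => exact ⟨0, rfl⟩
  | cons b x ih =>
    obtain ⟨k, hk⟩ := ih (s.step b)
    have h : (s.step b).count = s.count ∨ (s.step b).count = true :: s.count := by
      obtain ⟨m, bl, ab, ch, sg, ct, cn⟩ := s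
      cases m <;> cases b <;> cases bl <;> simp [step, walk, back, applyHad, applyTof, readCtrl]
    rcases h with h | h <;> rw [h] at hk
    · exact ⟨k, hk⟩
    · refine ⟨k + 1, hk.trans ?_⟩
      rw [List.replicate_succ', List.append_assoc]
      rfl

end Sim

namespace Prog

/-- Reads the whole code. -/
def simPass : Prog := .forEach 0 5 (simStep false) (simStep true)

/-- Checks that stack `6` holds only zeros. -/
def checkZero : Prog := .wh 6 true .skip true (.push 12 true)

/-- Checks the final state and prepares another pass. -/
def tidy : Prog := .seq checkZero (.seq (.clr 7) (.seq (.clr 8) (.clr 10)))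

/-- Checks a pair of paths with a given sign. -/
def verify (σ : Bool) : Prog :=
  .seq simPass (.seq tidy (.seq simPass (.seq tidy (.seq (.seq (.mv 1 6) (.seq checkZero (.clr 0)))
    (.cs 12 (.cs 9 (.push 0 !σ) .skip (.push 0 σ)) .skip (.push 0 false))))))

/-- Counts the Hadamard gates. -/
def countHad : Prog := .seq simPass (.seq (.clr 0) (.mv 11 0))

end Prog

theorem runs_simPass (O : List Bool → List Bool) (s : Sim) (x f : List Bool) :
    Runs O .simPass (s.regs x [] f).toStk
      (x.length * (4 * (s.below.length + s.above.length + x.length) + 44) + 2)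
      ((s.run x).regs x [] f).toStk := by
  have e := Runs.forEach (O := O) (r := 0) (t := 5) (P₀ := .simStep false) (P₁ := .simStep true)
    (k := 4 * (s.below.length + s.above.length + x.length) + 36)
    (fun i => (s.run (x.take i)).regs x [] f) x (by norm_num) (by norm_num) (by norm_num) (by
      intro i hi u v
      have hlen := (s.length_run (x.take i)).1
      rw [List.length_take, Nat.min_eq_left hi.le] at hlen
      rw [List.take_succ_eq_append_getElem hi, Sim.run_append]
      cases x[i]
      · exact (runs_simStep (x := u) (u := v) (f := f) (s.run (x.take i)) false).mono (by omega)
      · exact (runs_simStep (x := u) (u := v) (f := f) (s.run (x.take i)) true).mono (by omega))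
  rw [List.take_length] at e
  exact e

theorem runs_checkZero (O : List Bool → List Bool) (l : List Bool) : ∀ s : Regs, s.r6 = l →
    Runs O .checkZero s.toStk (4 * l.length + 1)
      ((s.set 6 []).set 12 (List.replicate (l.count true) true ++ s.r12)).toStk := by
  induction l with
  | nil =>
    intro s hs
    refine (Runs.wh_nil hs).congr le_rfl ?_
    rw [List.count_nil, List.replicate_zero, List.nil_append, ← hs]
    rfl
  | cons b l ih =>
    intro s hs
    cases b
    · refine (Runs.whR (b := false) (show s.toStk 6 = _ from hs) (by norm_num) rfl Runs.skip
        (ih _ rfl)).congr (by simp; omega) ?_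
      simp only [Regs.set, List.count_cons_of_ne (show (true : Bool) ≠ false by simp).symm]
    · refine (Runs.whR (b := true) (show s.toStk 6 = _ from hs) (by norm_num) rfl (Runs.pushR _ 12 true)
        (ih _ rfl)).congr (by simp; omega) ?_
      simp only [Regs.set, Regs.toStk, List.count_cons_self, List.replicate_succ', List.append_assoc]
      rfl

theorem runs_tidy (O : List Bool → List Bool) (s : Sim) (x f : List Bool) :
    Runs O .tidy (s.regs x [] f).toStk
      (4 * s.below.length + 3 * s.above.length + 3 * s.ctrl.length + 20)
      (Sim.regs ⟨.header, [], [], s.choices, s.sign, [], s.count⟩ x []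
        (List.replicate (s.below.count true) true ++ f)).toStk := by
  have hm : s.mode.code ≤ 5 := by cases s.mode <;> simp [Mode.code]
  refine ((runs_checkZero O s.below _ rfl).seq ((Runs.clr _).seq ((Runs.clr _).seq
    (Runs.clr _)))).congr ?_ ?_
  · simp only [Regs.set, Regs.toStk, Sim.regs, List.length_replicate]
    omega
  · simp only [Regs.set, Sim.regs, Mode.code, List.replicate_zero]

/-- The state before the first pass. -/
def Sim.first (y : List Bool) : Sim := ⟨.header, [], [], y, false, [], []⟩

/-- The state before the second pass. -/
def Sim.again (s : Sim) : Sim := ⟨.header, [], [], s.choices, s.sign, [], s.count⟩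

/-- A pair of paths ends in the zero state, uses up the choices and has a given sign. -/
def pairPred (σ : Bool) (x y : List Bool) : Bool :=
  ((Sim.first y).run x).below.all (!·) && (((Sim.first y).run x).again.run x).below.all (!·) &&
    (((Sim.first y).run x).again.run x).choices.all (!·) &&
    ((((Sim.first y).run x).again.run x).sign == σ)

theorem count_true_eq_zero_iff (l : List Bool) : l.count true = 0 ↔ l.all (!·) = true := by
  induction l with
  | nil => simp
  | cons b l ih => cases b <;> simp_all

/-- Stack 12 receives a bit for every nonzero qubit at the end of either pass and for every nonzero
unused choice. The pair is valid exactly if it stays empty; then the sign, accumulated over both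
passes, decides. -/
theorem isPolyTimePred_pairPred (σ : Bool) : IsPolyTimePred (pairPred σ) := by
  refine ⟨(Prog.verify σ).compile 0, X * (C 4 * X + C 44) + C 2 + (C 10 * X + C 20 +
    (X * (C 4 * X + C 44) + C 2 + (C 10 * X + C 20 + (C 11 * X + C 10)))), fun x y => ?_⟩
  set s₁ := (Sim.first y).run x with hs₁
  set s₂ := s₁.again.run x with hs₂
  set f₁ := List.replicate (s₁.below.count true) true ++ [] with hf₁
  set f₂ := List.replicate (s₂.below.count true) true ++ f₁ with hf₂
  have b₁ := (Sim.first y).length_run x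
  have b₂ := s₁.again.length_run x
  rw [← hs₁] at b₁
  rw [← hs₂] at b₂
  simp only [Sim.first, Sim.again, List.length_nil, Nat.zero_add] at b₁ b₂
  have e₁ : Runs noOracle .simPass (Regs.toStk { r0 := x, r1 := y }) (x.length * (4 * x.length + 44) + 2)
      (s₁.regs x [] []).toStk := by
    refine (runs_simPass noOracle (Sim.first y) x []).congr ?_ rfl
    simp [Sim.first]
  have e₂ := runs_tidy noOracle s₁ x []
  have e₃ : Runs noOracle .simPass (s₁.again.regs x [] f₁).toStk (x.length * (4 * x.length + 44) + 2)
      (s₂.regs x [] f₁).toStk := by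
    refine (runs_simPass noOracle s₁.again x f₁).congr ?_ rfl
    simp [Sim.again]
  have e₄ := runs_tidy noOracle s₂ x f₁
  set f₃ := List.replicate (s₂.choices.count true) true ++ f₂ with hf₃
  have e₅ : Runs noOracle (.seq (.mv 1 6) (.seq .checkZero (.clr 0))) (s₂.again.regs x [] f₂).toStk
      (8 * s₂.choices.length + 3 * x.length + 3)
      (Regs.toStk { r9 := borrow s₂.sign, r11 := s₂.count, r12 := f₃ }) := by
    refine ((Runs.mv _).seq ((runs_checkZero noOracle s₂.choices.reverse _ ?_).seq
      (Runs.clr _))).congr ?_ ?_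
    · simp only [Regs.set, Regs.toStk, Sim.regs, Sim.again, List.append_nil]
    · simp only [Regs.set, Regs.toStk, Sim.regs, Sim.again, List.length_reverse]; omega
    · simp only [Regs.set, Sim.regs, Sim.again, List.count_reverse, hf₃, Mode.code, List.replicate_zero]
  have hσ : pairPred σ x y = ((f₃ = [] : Bool) && (s₂.sign == σ)) := by
    have h : f₃ = [] ↔ s₁.below.all (!·) = true ∧ s₂.below.all (!·) = true ∧
        s₂.choices.all (!·) = true := by
      simp only [hf₃, hf₂, hf₁, List.append_eq_nil_iff, List.replicate_eq_nil_iff,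
        count_true_eq_zero_iff]
      tauto
    rw [show decide (f₃ = []) = (s₁.below.all (!·) && s₂.below.all (!·) && s₂.choices.all (!·)) by
      rw [Bool.eq_iff_iff, decide_eq_true_iff, h]
      simp only [Bool.and_eq_true]
      tauto]
    rfl
  obtain ⟨s', hs', e₆⟩ : ∃ s' : Regs, s'.r0 = [pairPred σ x y] ∧ Runs noOracle
      (.cs 12 (.cs 9 (.push 0 !σ) .skip (.push 0 σ)) .skip (.push 0 false))
      (Regs.toStk { r9 := borrow s₂.sign, r11 := s₂.count, r12 := f₃ }) 7 s'.toStk := by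
    rw [hσ]
    rcases hf : f₃ with _ | ⟨b, t⟩
    · cases s₂.sign
      · refine ⟨_, ?_, Runs.cs_nil rfl (Runs.cs_nil rfl (Runs.pushR _ 0 _))⟩
        cases σ <;> rfl
      · refine ⟨_, ?_, Runs.cs_nil rfl (Runs.cs_trueR (t := []) rfl (by norm_num) (Runs.pushR _ 0 _))⟩
        cases σ <;> rfl
    · obtain rfl : b = true := by
        have : b ∈ f₃ := by rw [hf]; exact List.mem_cons_self
        simp only [hf₃, hf₂, hf₁, List.mem_append, List.mem_replicate, List.not_mem_nil] at this
        tauto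
      exact ⟨_, by rfl, (Runs.cs_trueR rfl (by norm_num) (Runs.pushR _ 0 false)).mono (by norm_num)⟩
  have e := e₁.seq (e₂.seq (e₃.seq (e₄.seq (e₅.seq e₆))))
  rw [← Regs.toStk_eq_getD_two] at e
  rw [← hs']
  refine e.outputsWithin ?_
  simp only [Polynomial.eval_add, Polynomial.eval_mul, Polynomial.eval_C, Polynomial.eval_X]
  have : x.length * (4 * x.length + 44) ≤
      (x.length + y.length) * (4 * (x.length + y.length) + 44) := Nat.mul_le_mul (by omega) (by omega)
  omega

/-- The number of Hadamard gates of a code. -/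
def hadCount (x : List Bool) : ℕ := ((Sim.first []).run x).count.length

/-- One pass without choices suffices, since every Hadamard gate is counted whatever value it takes.
-/
theorem isFP_hadCount : IsFP fun x => List.replicate (hadCount x) true := by
  refine ⟨Prog.countHad.compile 0, X * (C 4 * X + C 44) + C 2 + (C 3 * X + C 1 +
    (C 4 * (X * (C 4 * X + C 44) + C 2) + C 1)), fun x => ?_⟩
  have e₁ : Runs noOracle .simPass (Regs.toStk { r0 := x }) (x.length * (4 * x.length + 44) + 2)
      (((Sim.first []).run x).regs x [] []).toStk := by
    refine (runs_simPass noOracle (Sim.first []) x []).congr ?_ rfl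
    simp [Sim.first]
  have hl := e₁.length_le (r := 11) (by norm_num)
  simp only [Regs.toStk, Sim.regs, List.length_nil, Nat.zero_add] at hl
  obtain ⟨k, hk⟩ := (Sim.first []).count_run x
  have hc : ((Sim.first []).run x).count = List.replicate (hadCount x) true := by
    rw [hadCount, hk]; simp [Sim.first]
  have e := e₁.seq ((Runs.clr (r := 0) _).seq (Runs.mv (r := 11) (d := 0) _))
  rw [← Regs.toStk_eq_getD] at e
  have := e.outputsWithin (l := (X * (C 4 * X + C 44) + C 2 + (C 3 * X + C 1 +
    (C 4 * (X * (C 4 * X + C 44) + C 2) + C 1))).eval x.length) (by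
      simp only [Regs.set, Regs.toStk, Sim.regs, Polynomial.eval_add, Polynomial.eval_mul,
        Polynomial.eval_C, Polynomial.eval_X]
      omega)
  simpa only [Prog.countHad, Regs.set, Regs.toStk, Sim.regs, List.append_nil, hc,
    List.reverse_replicate] using this

theorem all_not_ofFn_iff {n : ℕ} (z : Fin n → Bool) :
    (List.ofFn z).all (!·) = true ↔ z = fun _ => false := by
  simp [List.all_eq_true, List.mem_ofFn, funext_iff]

/-- A valid pair is accepted for exactly one of the two signs, an invalid pair for none; so the
difference of the indicators is the signed weight. -/
theorem pairPred_encode {n : ℕ} (C : Circuit n) (y : List Bool) :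
    ((if pairPred false (Circuit.encode C) y = true then 1 else 0 : ℤ) -
      if pairPred true (Circuit.encode C) y = true then 1 else 0) =
      Circuit.weight C (Circuit.weight C lastSign) y false := by
  simp only [pairPred, Sim.first, Sim.again, Sim.run_encode, Bool.and_eq_true, all_not_ofFn_iff,
    Circuit.weight, lastSign]
  set p := Circuit.path C (fun _ => false) y false
  set p' := Circuit.path C (fun _ => false) p.2.1 p.2.2
  by_cases h1 : p.1 = fun _ => false <;> by_cases h2 : p'.1 = fun _ => false <;>
    by_cases h3 : p'.2.1.all (!·) = true <;> cases h4 : p'.2.2 <;> simp [h1, h2, h3]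

theorem hads_le_length {n : ℕ} (C : Circuit n) : Circuit.hads C ≤ (Circuit.encode C).length := by
  have h : ∀ C : Circuit n, Circuit.hads C ≤ (C.flatMap Gate.encode).length := by
    intro C
    induction C with
    | nil => simp [Circuit.hads]
    | cons g C ih =>
      rw [List.flatMap_cons, List.length_append]
      cases g <;> simp only [Circuit.hads, Gate.encode, List.length_cons] <;> omega
  exact (h C).trans (by simp [Circuit.encode])

/-- Output probabilities are computed exactly by a `GapP` function. -/
theorem inGapP_of_exact {P : EstimationProblem} (hP : ∀ (x : List Bool) (s : ℚ),
    (∀ (n : ℕ) (C : Circuit n), x = Circuit.encode C → (s : ℝ) = C.zeroProb) → s ∈ P x) : InGapP P := by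
  set c : Bool → List Bool → ℕ := fun σ x => (Finset.univ.filter
    fun y : Fin ((C 2 * X : Polynomial ℕ).eval x.length) → Bool =>
      pairPred σ x (List.ofFn y) = true).card with hc
  refine ⟨fun x => (c false x : ℤ) - c true x, hadCount,
    ⟨c false, c true, ⟨_, C 2 * X, isPolyTimePred_pairPred false, fun _ => rfl⟩,
      ⟨_, C 2 * X, isPolyTimePred_pairPred true, fun _ => rfl⟩, fun _ => rfl⟩, isFP_hadCount,
    fun x => hP x _ fun n D hx => ?_⟩
  have h1 : hadCount x = Circuit.hads D := by
    rw [hadCount, hx, Sim.first, Sim.run_encode]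
    simp
  have h2 : (c false x : ℤ) - c true x = Circuit.amp D (fun _ => false) ^ 2 := by
    simp only [hc, Finset.card_filter]
    push_cast
    rw [← Finset.sum_sub_distrib, hx]
    simp only [pairPred_encode]
    refine Circuit.sum_weight D ?_
    -- Twice the length of the code is enough choices for two paths, because every Hadamard gate
    -- takes at least one bit of the code.
    have := hads_le_length D
    simp only [Polynomial.eval_mul, Polynomial.eval_C, Polynomial.eval_X]
    omega
  beta_reduce
  rw [h2, h1, Circuit.zeroProb_eq_amp]
  push_cast
  rfl

end QGap

theorem mainTheorem4 (σ : ℕ → ℕ∞) (hσ : ∀ n : ℕ, (n : ℕ∞) ≤ σ n) :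
    (∀ ε : ℝ, 0 < ε → ε < 1 / 2 → QGap.GapPComplete (QGap.RelProblem σ ε)) ∧
      QGap.GapPComplete (QGap.AddProblem σ) := by
  refine ⟨fun ε h0 h1 => ⟨QGap.inGapP_of_exact fun x s hs n C _ hx => ?_,
    QGap.gapPHard_of_good (QGap.good_relProblem hσ h0 h1)⟩,
    QGap.inGapP_of_exact fun x s hs n C _ hx => ?_, QGap.gapPHard_of_good (QGap.good_addProblem hσ)⟩
  · have hp : 0 ≤ C.zeroProb := sq_nonneg _
    rw [hs n C hx]
    constructor <;> nlinarith
  · rw [hs n C hx, QGap.IsAddApprox, sub_self, abs_zero]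
    positivity
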